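/- \textbf{Theorem (Complete Reducibility).} A \emph{fusion category} is a finite semisimple abelian $\mathbb{C}$-linear category with a rigid $\mathbb{C}$-bilinear monoidal structure; its unit object is not assumed to be simple (it is what is often called a multifusion category). Fusion categories $A,B$ are \emph{Morita equivalent} if there are finite semisimple abelian bimodule categories, an $(A,B)$-bimodule $M$ and a $(B,A)$-bimodule $N$, together with equivalences $M\boxtimes_B N\simeq A$ of $(A,A)$-bimodule categories and $N\boxtimes_A M\simeq B$ of $(B,B)$-bimodule categories, where $\boxtimes$ denotes the relative Deligne--Kelly tensor product: the universal target of balanced functors that are $\mathbb{C}$-linear and right exact in each variable, among finitely cocomplete $\mathbb{C}$-linear categories. Let $\Phi$ be a fusion category. (1) $\Phi$ is Morita equivalent to a finite (possibly empty) direct sum $\bigoplus_k\Psi_k$ of fusion categories $\Psi_k$ with simple unit. (2) Let $\mathbf 1=\bigoplus_{i=1}^n p_i$ be a decomposition of the unit of $\Phi$ into simple objects and put $\Phi_{ij}=p_i\cdot\Phi\cdot p_j$. Suppose that $\Phi$ is indecomposable, i.e. that $n\ge 1$ and the equivalence relation on $\{1,\dots,n\}$ generated by the condition $\Phi_{ij}\neq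 0$ has a single class. Then for each index $i$ (for instance $i=1$), $\Phi_{ii}$ is a fusion category with simple unit $p_i$, and the $i$-th row $R=p_i\cdot\Phi=\bigoplus_j\Phi_{ij}$, a $(\Phi_{ii},\Phi)$-bimodule category, and the $i$-th column $C=\Phi\cdot p_i=\bigoplus_j\Phi_{ji}$, a $(\Phi,\Phi_{ii})$-bimodule category, give a Morita equivalence between $\Phi_{ii}$ and $\Phi$: the tensor product of $\Phi$ induces equivalences $R\boxtimes_\Phi C\simeq\Phi_{ii}$ of $(\Phi_{ii},\Phi_{ii})$-bimodule categories and $C\boxtimes_{\Phi_{ii}}R\simeq\Phi$ of $(\Phi,\Phi)$-bimodule categories. -/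

import Mathlib

open CategoryTheory CategoryTheory.Limits CategoryTheory.MonoidalCategory
open scoped CategoryTheory.MonoidalCategory.MonoidalLeftAction
open scoped CategoryTheory.MonoidalCategory.MonoidalRightAction

universe w' w v u v₁ v₂ v₃ v₄ v₅ v₆ u₁ u₂ u₃ u₄ u₅ u₆

noncomputable section

namespace FusionReducibility

/-! ### Finite semisimple categories and fusion categories over `ℂ` -/

/-- A `ℂ`-linear category is *finite semisimple abelian* if it is abelian, has finite-dimensional
morphism spaces, every object is a finite direct sum of simple objects, and there are only finitely
many simple objects up to isomorphism. -/
class IsFiniteSemisimple (C : Type u) [Category.{v} C] [Preadditive C] [Linear ℂ C] : Prop where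
  hasFiniteProducts : HasFiniteProducts C
  hasKernels : HasKernels C
  hasCokernels : HasCokernels C
  isNormalMonoCategory : IsNormalMonoCategory C
  isNormalEpiCategory : IsNormalEpiCategory C
  finiteDimensional_hom : ∀ X Y : C, FiniteDimensional ℂ (X ⟶ Y)
  exists_simple_decomposition : ∀ X : C, ∃ (n : ℕ) (S : Fin n → C) (b : Bicone S),
    (∀ i, Simple (S i)) ∧ Nonempty b.IsBilimit ∧ Nonempty (X ≅ b.pt)
  finitely_many_simples : ∃ (n : ℕ) (S : Fin n → C),
    ∀ X : C, Simple X → ∃ i, Nonempty (X ≅ S i)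

/-- A (multi)fusion category: a finite semisimple rigid `ℂ`-linear tensor category.
The unit object is not required to be simple. -/
class IsFusion (Φ : Type u) [Category.{v} Φ] [Preadditive Φ] [Linear ℂ Φ] [MonoidalCategory Φ]
    [MonoidalPreadditive Φ] [MonoidalLinear ℂ Φ] : Prop extends IsFiniteSemisimple Φ where
  hasLeftDual : ∀ X : Φ, Nonempty (HasLeftDual X)
  hasRightDual : ∀ X : Φ, Nonempty (HasRightDual X)

/-- Bundled (multi)fusion categories. -/
structure FusionCat where
  carrier : Type u
  [category : Category.{v} carrier]
  [preadditive : Preadditive carrier]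
  [linear : Linear ℂ carrier]
  [monoidal : MonoidalCategory carrier]
  [monoidalPreadditive : MonoidalPreadditive carrier]
  [monoidalLinear : MonoidalLinear ℂ carrier]
  [isFusion : IsFusion carrier]

attribute [instance] FusionCat.category FusionCat.preadditive FusionCat.linear FusionCat.monoidal
  FusionCat.monoidalPreadditive FusionCat.monoidalLinear FusionCat.isFusion

/-! ### Direct sums

The direct sum of a finite family of linear tensor categories is the product category with
componentwise structure; its monoidal structure is the one of Mathlib. -/

section Pi

variable {I : Type w} (C : I → Type u) [∀ i, Category.{v} (C i)] [∀ i, Preadditive (C i)]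

instance piPreadditive : Preadditive (∀ i, C i) where
  homGroup X Y := inferInstanceAs (AddCommGroup (∀ i, X i ⟶ Y i))
  add_comp _ _ _ f f' g := funext fun i => Preadditive.add_comp _ _ _ (f i) (f' i) (g i)
  comp_add _ _ _ f g g' := funext fun i => Preadditive.comp_add _ _ _ (f i) (g i) (g' i)

instance piLinear [∀ i, Linear ℂ (C i)] : Linear ℂ (∀ i, C i) where
  homModule X Y := inferInstanceAs (Module ℂ (∀ i, X i ⟶ Y i))
  smul_comp _ _ _ r f g := funext fun i => Linear.smul_comp _ _ _ r (f i) (g i)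
  comp_smul _ _ _ f r g := funext fun i => Linear.comp_smul _ _ _ (f i) r (g i)

end Pi

/-! ### Bimodule categories -/

/-- An `(A, B)`-bimodule category structure on a category carrying a left action of `A` and a right
action of `B`: a natural middle associativity isomorphism, coherent with both actions. -/
class BimoduleCategory (A : Type u₁) (B : Type u₂) (M : Type u₃) [Category.{v₁} A]
    [MonoidalCategory A] [Category.{v₂} B] [MonoidalCategory B] [Category.{v₃} M]
    [MonoidalLeftAction A M] [MonoidalRightAction B M] where
  mid (a : A) (m : M) (b : B) : (a ⊙ₗ m) ⊙ᵣ b ≅ a ⊙ₗ (m ⊙ᵣ b)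
  mid_naturality_left {a a' : A} (f : a ⟶ a') (m : M) (b : B) :
    (f ⊵ₗ m) ⊵ᵣ b ≫ (mid a' m b).hom = (mid a m b).hom ≫ f ⊵ₗ (m ⊙ᵣ b)
  mid_naturality_middle (a : A) {m m' : M} (f : m ⟶ m') (b : B) :
    (a ⊴ₗ f) ⊵ᵣ b ≫ (mid a m' b).hom = (mid a m b).hom ≫ a ⊴ₗ (f ⊵ᵣ b)
  mid_naturality_right (a : A) (m : M) {b b' : B} (f : b ⟶ b') :
    (a ⊙ₗ m) ⊴ᵣ f ≫ (mid a m b').hom = (mid a m b).hom ≫ a ⊴ₗ (m ⊴ᵣ f)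
  pentagon_left (a a' : A) (m : M) (b : B) :
    (αₗ a a' m).hom ⊵ᵣ b ≫ (mid a (a' ⊙ₗ m) b).hom ≫ a ⊴ₗ (mid a' m b).hom =
      (mid (a ⊗ a') m b).hom ≫ (αₗ a a' (m ⊙ᵣ b)).hom
  pentagon_right (a : A) (m : M) (b b' : B) :
    (αᵣ (a ⊙ₗ m) b b').hom ≫ (mid a m b).hom ⊵ᵣ b' ≫ (mid a (m ⊙ᵣ b) b').hom =
      (mid a m (b ⊗ b')).hom ≫ a ⊴ₗ (αᵣ m b b').hom
  triangle_left (m : M) (b : B) :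
    (mid (𝟙_ A) m b).hom ≫ (λₗ (m ⊙ᵣ b)).hom = (λₗ[A] m).hom ⊵ᵣ b
  triangle_right (a : A) (m : M) :
    (mid a m (𝟙_ B)).hom ≫ a ⊴ₗ (ρᵣ m).hom = (ρᵣ (a ⊙ₗ m)).hom

/-- The regular bimodule: a monoidal category acting on itself on both sides. -/
instance regularBimodule (A : Type u) [Category.{v} A] [MonoidalCategory A] :
    BimoduleCategory A A A where
  mid a m b := α_ a m b
  mid_naturality_left := by intros; simp
  mid_naturality_middle := by intros; simp
  mid_naturality_right := by intros; simp
  pentagon_left := by intros; simp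
  pentagon_right := by intros; simp
  triangle_left := by intros; simp
  triangle_right := by intros; simp

/-- A functor of two variables is *bilinear and right exact* if in each variable it is additive,
`ℂ`-linear and preserves finite colimits. -/
structure IsRexBilinear {M : Type u₁} {N : Type u₂} {X : Type u₃} [Category.{v₁} M]
    [Category.{v₂} N] [Category.{v₃} X] [Preadditive M] [Preadditive N] [Preadditive X]
    [Linear ℂ M] [Linear ℂ N] [Linear ℂ X] (F : M ⥤ N ⥤ X) : Prop where
  additive_right : ∀ m, (F.obj m).Additive
  linear_right : ∀ m, (F.obj m).Linear ℂ
  rightExact_right : ∀ m, PreservesFiniteColimits (F.obj m)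
  additive_left : ∀ n, (F.flip.obj n).Additive
  linear_left : ∀ n, (F.flip.obj n).Linear ℂ
  rightExact_left : ∀ n, PreservesFiniteColimits (F.flip.obj n)

/-- A finite semisimple abelian `ℂ`-linear category on which the tensor categories `A` and `B` act
by functors that are linear and right exact in each variable. -/
structure IsFiniteSemisimpleBimodule (A : Type u₁) (B : Type u₂) (M : Type u₃) [Category.{v₁} A]
    [Preadditive A] [Linear ℂ A] [MonoidalCategory A] [Category.{v₂} B] [Preadditive B]
    [Linear ℂ B] [MonoidalCategory B] [Category.{v₃} M] [Preadditive M] [Linear ℂ M]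
    [MonoidalLeftAction A M] [MonoidalRightAction B M] : Prop where
  finiteSemisimple : IsFiniteSemisimple M
  left : IsRexBilinear (MonoidalLeftAction.curriedAction A M)
  right : IsRexBilinear (MonoidalRightAction.curriedAction B M)

/-- Bundled finite semisimple `(A, B)`-bimodule categories. -/
structure BimoduleCat (A : Type u₁) (B : Type u₂) [Category.{v₁} A] [Preadditive A] [Linear ℂ A]
    [MonoidalCategory A] [Category.{v₂} B] [Preadditive B] [Linear ℂ B] [MonoidalCategory B] where
  carrier : Type u
  [category : Category.{v} carrier]
  [preadditive : Preadditive carrier]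
  [linear : Linear ℂ carrier]
  [leftAction : MonoidalLeftAction A carrier]
  [rightAction : MonoidalRightAction B carrier]
  [bimodule : BimoduleCategory A B carrier]
  finiteSemisimple : IsFiniteSemisimpleBimodule A B carrier

attribute [instance] BimoduleCat.category BimoduleCat.preadditive BimoduleCat.linear
  BimoduleCat.leftAction BimoduleCat.rightAction BimoduleCat.bimodule

/-! ### Relative Deligne–Kelly tensor products -/

section RelativeTensor

variable (A : Type u₁) (B : Type u₂) (D : Type u₃) {M : Type u₄} {N : Type u₅} {P : Type u₆}
  [Category.{v₁} A] [Category.{v₂} B] [Category.{v₃} D] [Category.{v₄} M] [Category.{v₅} N]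
  [Category.{v₆} P] [MonoidalCategory A] [MonoidalCategory B] [MonoidalCategory D]

/-- A `B`-balancing of a functor `F : M × N → P`, where `M` is a right and `N` a left
`B`-module category: natural isomorphisms `F (m b, n) ≅ F (m, b n)`, coherent with the
actions of `B`. -/
structure Balancing [MonoidalRightAction B M] [MonoidalLeftAction B N] (F : M ⥤ N ⥤ P) where
  iso (m : M) (b : B) (n : N) : (F.obj (m ⊙ᵣ b)).obj n ≅ (F.obj m).obj (b ⊙ₗ n)
  naturality_left {m m' : M} (f : m ⟶ m') (b : B) (n : N) :
    (F.map (f ⊵ᵣ b)).app n ≫ (iso m' b n).hom = (iso m b n).hom ≫ (F.map f).app (b ⊙ₗ n)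
  naturality_middle (m : M) {b b' : B} (f : b ⟶ b') (n : N) :
    (F.map (m ⊴ᵣ f)).app n ≫ (iso m b' n).hom = (iso m b n).hom ≫ (F.obj m).map (f ⊵ₗ n)
  naturality_right (m : M) (b : B) {n n' : N} (f : n ⟶ n') :
    (F.obj (m ⊙ᵣ b)).map f ≫ (iso m b n').hom = (iso m b n).hom ≫ (F.obj m).map (b ⊴ₗ f)
  pentagon (m : M) (b b' : B) (n : N) :
    (F.map (αᵣ m b b').hom).app n ≫ (iso (m ⊙ᵣ b) b' n).hom ≫ (iso m b (b' ⊙ₗ n)).hom =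
      (iso m (b ⊗ b') n).hom ≫ (F.obj m).map (αₗ b b' n).hom
  triangle (m : M) (n : N) :
    (iso m (𝟙_ B) n).hom ≫ (F.obj m).map (λₗ n).hom = (F.map (ρᵣ[B] m).hom).app n

/-- The structure of a `B`-balanced functor of `(A, D)`-bimodule categories on `T : M × N → P`,
where `M` is an `(A, B)`-bimodule, `N` a `(B, D)`-bimodule and `P` an `(A, D)`-bimodule:
a balancing, a left `A`-module functor structure in the first variable and a right `D`-module
functor structure in the second variable, all compatible with each other. -/
structure BimoduleBalancing [MonoidalLeftAction A M] [MonoidalRightAction B M]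
    [BimoduleCategory A B M] [MonoidalLeftAction B N] [MonoidalRightAction D N]
    [BimoduleCategory B D N] [MonoidalLeftAction A P] [MonoidalRightAction D P]
    [BimoduleCategory A D P] (T : M ⥤ N ⥤ P) extends Balancing B T where
  left (a : A) (m : M) (n : N) : (T.obj (a ⊙ₗ m)).obj n ≅ a ⊙ₗ (T.obj m).obj n
  left_naturality₁ {a a' : A} (f : a ⟶ a') (m : M) (n : N) :
    (T.map (f ⊵ₗ m)).app n ≫ (left a' m n).hom = (left a m n).hom ≫ f ⊵ₗ (T.obj m).obj n
  left_naturality₂ (a : A) {m m' : M} (f : m ⟶ m') (n : N) :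
    (T.map (a ⊴ₗ f)).app n ≫ (left a m' n).hom = (left a m n).hom ≫ a ⊴ₗ (T.map f).app n
  left_naturality₃ (a : A) (m : M) {n n' : N} (f : n ⟶ n') :
    (T.obj (a ⊙ₗ m)).map f ≫ (left a m n').hom = (left a m n).hom ≫ a ⊴ₗ (T.obj m).map f
  left_assoc (a a' : A) (m : M) (n : N) :
    (T.map (αₗ a a' m).hom).app n ≫ (left a (a' ⊙ₗ m) n).hom ≫ a ⊴ₗ (left a' m n).hom =
      (left (a ⊗ a') m n).hom ≫ (αₗ a a' ((T.obj m).obj n)).hom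
  left_unit (m : M) (n : N) :
    (left (𝟙_ A) m n).hom ≫ (λₗ ((T.obj m).obj n)).hom = (T.map (λₗ[A] m).hom).app n
  right (m : M) (n : N) (d : D) : (T.obj m).obj (n ⊙ᵣ d) ≅ (T.obj m).obj n ⊙ᵣ d
  right_naturality₁ {m m' : M} (f : m ⟶ m') (n : N) (d : D) :
    (T.map f).app (n ⊙ᵣ d) ≫ (right m' n d).hom = (right m n d).hom ≫ (T.map f).app n ⊵ᵣ d
  right_naturality₂ (m : M) {n n' : N} (f : n ⟶ n') (d : D) :
    (T.obj m).map (f ⊵ᵣ d) ≫ (right m n' d).hom = (right m n d).hom ≫ (T.obj m).map f ⊵ᵣ d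
  right_naturality₃ (m : M) (n : N) {d d' : D} (f : d ⟶ d') :
    (T.obj m).map (n ⊴ᵣ f) ≫ (right m n d').hom = (right m n d).hom ≫ (T.obj m).obj n ⊴ᵣ f
  right_assoc (m : M) (n : N) (d d' : D) :
    (T.obj m).map (αᵣ n d d').hom ≫ (right m (n ⊙ᵣ d) d').hom ≫ (right m n d).hom ⊵ᵣ d' =
      (right m n (d ⊗ d')).hom ≫ (αᵣ ((T.obj m).obj n) d d').hom
  right_unit (m : M) (n : N) :
    (right m n (𝟙_ D)).hom ≫ (ρᵣ ((T.obj m).obj n)).hom = (T.obj m).map (ρᵣ[D] n).hom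
  left_balancing (a : A) (m : M) (b : B) (n : N) :
    (iso (a ⊙ₗ m) b n).hom ≫ (left a m (b ⊙ₗ n)).hom =
      (T.map (BimoduleCategory.mid a m b).hom).app n ≫ (left a (m ⊙ᵣ b) n).hom ≫
        a ⊴ₗ (iso m b n).hom
  right_balancing (m : M) (b : B) (n : N) (d : D) :
    (iso m b (n ⊙ᵣ d)).hom ≫ (T.obj m).map (BimoduleCategory.mid b n d).inv ≫
        (right m (b ⊙ₗ n) d).hom =
      (right (m ⊙ᵣ b) n d).hom ≫ (iso m b n).hom ⊵ᵣ d
  left_right (a : A) (m : M) (n : N) (d : D) :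
    (left a m (n ⊙ᵣ d)).hom ≫ a ⊴ₗ (right m n d).hom =
      (right (a ⊙ₗ m) n d).hom ≫ (left a m n).hom ⊵ᵣ d ≫
        (BimoduleCategory.mid a ((T.obj m).obj n) d).hom

variable {B}

/-- A `B`-balanced functor `T : M × N → P` exhibits `P` as the relative Deligne–Kelly tensor product
`M ⊠_B N`: it is bilinear and right exact, and for every finitely cocomplete `ℂ`-linear category `X`
composition with `T` is an equivalence from the category of right exact linear functors `P → X` to
the category of `B`-balanced bilinear right exact functors `M × N → X`. The equivalence is
spelled out as essential surjectivity (`exists_lift`) and full faithfulness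
(`existsUnique_natTrans`). -/
structure IsRelativeTensor [Preadditive M] [Linear ℂ M] [Preadditive N] [Linear ℂ N]
    [Preadditive P] [Linear ℂ P] [MonoidalRightAction B M] [MonoidalLeftAction B N]
    (T : M ⥤ N ⥤ P) (β : Balancing B T) : Prop where
  isRexBilinear : IsRexBilinear T
  exists_lift : ∀ (X : Type w) [Category.{w'} X] [Preadditive X] [Linear ℂ X] [HasFiniteColimits X]
    (F : M ⥤ N ⥤ X) (γ : Balancing B F), IsRexBilinear F →
    ∃ G : P ⥤ X, G.Additive ∧ G.Linear ℂ ∧ PreservesFiniteColimits G ∧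
      ∃ e : T ⋙ (Functor.whiskeringRight N P X).obj G ≅ F, ∀ (m : M) (b : B) (n : N),
        G.map (β.iso m b n).hom ≫ (e.hom.app m).app (b ⊙ₗ n) =
          (e.hom.app (m ⊙ᵣ b)).app n ≫ (γ.iso m b n).hom
  existsUnique_natTrans : ∀ (X : Type w) [Category.{w'} X] [Preadditive X] [Linear ℂ X]
    [HasFiniteColimits X] (G G' : P ⥤ X) [G.Additive] [G.Linear ℂ] [PreservesFiniteColimits G]
    [G'.Additive] [G'.Linear ℂ] [PreservesFiniteColimits G']
    (θ : T ⋙ (Functor.whiskeringRight N P X).obj G ⟶ T ⋙ (Functor.whiskeringRight N P X).obj G'),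
    (∀ (m : M) (b : B) (n : N),
      G.map (β.iso m b n).hom ≫ (θ.app m).app (b ⊙ₗ n) =
        (θ.app (m ⊙ᵣ b)).app n ≫ G'.map (β.iso m b n).hom) →
    ∃! η : G ⟶ G', ∀ (m : M) (n : N), η.app ((T.obj m).obj n) = (θ.app m).app n

end RelativeTensor

/-! ### Morita equivalence -/

section Morita

variable {A : Type u₁} {B : Type u₂} [Category.{v₁} A] [Preadditive A] [Linear ℂ A]
  [MonoidalCategory A] [Category.{v₂} B] [Preadditive B] [Linear ℂ B] [MonoidalCategory B]

/-- The finite semisimple `(A, B)`-bimodule category `M` and `(B, A)`-bimodule category `N`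
form a Morita equivalence between `A` and `B`: the bimodule functors `S` and `T` induce
equivalences of bimodule categories `M ⊠_B N ≃ A` and `N ⊠_A M ≃ B`. -/
structure IsMoritaEquivalence {M : Type u₃} {N : Type u₄} [Category.{v₃} M] [Preadditive M]
    [Linear ℂ M] [MonoidalLeftAction A M] [MonoidalRightAction B M] [BimoduleCategory A B M]
    [Category.{v₄} N] [Preadditive N] [Linear ℂ N] [MonoidalLeftAction B N]
    [MonoidalRightAction A N] [BimoduleCategory B A N]
    (S : M ⥤ N ⥤ A) (σ : BimoduleBalancing A B A S)
    (T : N ⥤ M ⥤ B) (τ : BimoduleBalancing B A B T) : Prop where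
  finiteSemisimple_left : IsFiniteSemisimpleBimodule A B M
  finiteSemisimple_right : IsFiniteSemisimpleBimodule B A N
  isRelativeTensor_left : IsRelativeTensor.{w', w} S σ.toBalancing
  isRelativeTensor_right : IsRelativeTensor.{w', w} T τ.toBalancing

end Morita

/-- Tensor categories `A` and `B` are *Morita equivalent* if there are finite semisimple bimodule
categories `M` and `N` with `M ⊠_B N ≃ A` and `N ⊠_A M ≃ B` as bimodule categories. -/
def MoritaEquivalent (A B : Type u) [Category.{v} A] [Preadditive A] [Linear ℂ A]
    [MonoidalCategory A] [Category.{v} B] [Preadditive B] [Linear ℂ B] [MonoidalCategory B] :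
    Prop :=
  ∃ (M : BimoduleCat.{v, u} A B) (N : BimoduleCat.{v, u} B A)
    (S : M.carrier ⥤ N.carrier ⥤ A) (σ : BimoduleBalancing A B A S)
    (T : N.carrier ⥤ M.carrier ⥤ B) (τ : BimoduleBalancing B A B T),
    IsMoritaEquivalence.{w', w} S σ T τ

/-! ### Rows, columns and corners

Let `p` be a direct summand of the unit object, with inclusion `P.i : p ⟶ 𝟙_ Φ`. The row `p·Φ`
is the full subcategory of those `x` for which the canonical map `p ⊗ x ⟶ 𝟙 ⊗ x` is an isomorphism,
the column `Φ·p` is the one of those `x` for which `x ⊗ p ⟶ x ⊗ 𝟙` is an isomorphism,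
and the corner `p·Φ·p` is their intersection. -/

section Corner

variable {Φ : Type u} [Category.{v} Φ] [MonoidalCategory Φ] {p : Φ} (P : Retract p (𝟙_ Φ))

/-- `x` lies in the row `p·Φ`. -/
def rowProperty : ObjectProperty Φ := fun x => IsIso (P.i ▷ x)

/-- `x` lies in the column `Φ·p`. -/
def colProperty : ObjectProperty Φ := fun x => IsIso (x ◁ P.i)

/-- `x` lies in the corner `p·Φ·p`. -/
def cornerProperty : ObjectProperty Φ := fun x => IsIso (P.i ▷ x) ∧ IsIso (x ◁ P.i)

/-- The row `p·Φ`. -/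
abbrev Row := (rowProperty P).FullSubcategory

/-- The column `Φ·p`. -/
abbrev Col := (colProperty P).FullSubcategory

/-- The corner `p·Φ·p`. -/
abbrev Corner := (cornerProperty P).FullSubcategory

variable {P}

lemma isIso_whiskerRight_tensor {x : Φ} (h : IsIso (P.i ▷ x)) (y : Φ) : IsIso (P.i ▷ (x ⊗ y)) := by
  rw [MonoidalCategory.whiskerRight_tensor]
  infer_instance

lemma isIso_tensor_whiskerLeft (x : Φ) {y : Φ} (h : IsIso (y ◁ P.i)) : IsIso ((x ⊗ y) ◁ P.i) := by
  rw [MonoidalCategory.tensor_whiskerLeft]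
  infer_instance

lemma tensor_cornerProperty {x y : Φ} (hx : IsIso (P.i ▷ x)) (hy : IsIso (y ◁ P.i)) :
    cornerProperty P (x ⊗ y) :=
  ⟨isIso_whiskerRight_tensor hx y, isIso_tensor_whiskerLeft x hy⟩

variable (P)

lemma summand_cornerProperty : cornerProperty P p := by
  have h₁ : (P.r ≫ P.i) ▷ p = 𝟙 (𝟙_ Φ ⊗ p) := by
    have hm : Mono (𝟙_ Φ ◁ P.i) :=
      (⟨⟨𝟙_ Φ ◁ P.r, by rw [← MonoidalCategory.whiskerLeft_comp, P.retract,
        MonoidalCategory.whiskerLeft_id]⟩⟩ : IsSplitMono (𝟙_ Φ ◁ P.i)).mono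
    rw [← cancel_mono (𝟙_ Φ ◁ P.i), ← whisker_exchange]
    simp [unitors_inv_equal]
  have h₂ : p ◁ (P.r ≫ P.i) = 𝟙 (p ⊗ 𝟙_ Φ) := by
    have hm : Mono (P.i ▷ 𝟙_ Φ) :=
      (⟨⟨P.r ▷ 𝟙_ Φ, by rw [← MonoidalCategory.comp_whiskerRight, P.retract,
        MonoidalCategory.id_whiskerRight]⟩⟩ : IsSplitMono (P.i ▷ 𝟙_ Φ)).mono
    rw [← cancel_mono (P.i ▷ 𝟙_ Φ), whisker_exchange]
    simp [unitors_equal, unitors_inv_equal]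
  constructor
  · exact ⟨P.r ▷ p, by rw [← MonoidalCategory.comp_whiskerRight, P.retract,
      MonoidalCategory.id_whiskerRight], by rw [← MonoidalCategory.comp_whiskerRight, h₁]⟩
  · exact ⟨p ◁ P.r, by rw [← MonoidalCategory.whiskerLeft_comp, P.retract,
      MonoidalCategory.whiskerLeft_id], by rw [← MonoidalCategory.whiskerLeft_comp, h₂]⟩

instance (x : Row P) : IsIso (P.i ▷ x.obj) := x.property

instance (x : Col P) : IsIso (x.obj ◁ P.i) := x.property

instance (x : Corner P) : IsIso (P.i ▷ x.obj) := x.property.1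

instance (x : Corner P) : IsIso (x.obj ◁ P.i) := x.property.2

/-- The isomorphism `p ⊗ x ≅ x` for `x` in the row `p·Φ`. -/
def rowUnitor (x : Φ) [IsIso (P.i ▷ x)] : p ⊗ x ≅ x := asIso (P.i ▷ x) ≪≫ λ_ x

/-- The isomorphism `x ⊗ p ≅ x` for `x` in the column `Φ·p`. -/
def colUnitor (x : Φ) [IsIso (x ◁ P.i)] : x ⊗ p ≅ x := asIso (x ◁ P.i) ≪≫ ρ_ x

@[simp]
lemma rowUnitor_hom (x : Φ) [IsIso (P.i ▷ x)] : (rowUnitor P x).hom = P.i ▷ x ≫ (λ_ x).hom := rfl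

@[simp]
lemma colUnitor_hom (x : Φ) [IsIso (x ◁ P.i)] : (colUnitor P x).hom = x ◁ P.i ≫ (ρ_ x).hom := rfl

/-- The tensor product of the corner is the one of `Φ`, with unit object `p`. -/
@[simps]
instance cornerMonoidalStruct : MonoidalCategoryStruct (Corner P) where
  tensorObj x y := ⟨x.obj ⊗ y.obj, tensor_cornerProperty x.property.1 y.property.2⟩
  whiskerLeft x _ _ f := ObjectProperty.homMk (x.obj ◁ f.hom)
  whiskerRight f y := ObjectProperty.homMk (f.hom ▷ y.obj)
  tensorHom f g := ObjectProperty.homMk (f.hom ⊗ₘ g.hom)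
  tensorUnit := ⟨p, summand_cornerProperty P⟩
  associator x y z := ObjectProperty.isoMk _ (α_ x.obj y.obj z.obj)
  leftUnitor x := ObjectProperty.isoMk _ (rowUnitor P x.obj)
  rightUnitor x := ObjectProperty.isoMk _ (colUnitor P x.obj)

/-- The corner is a monoidal category with unit object `p`. -/
instance cornerMonoidal : MonoidalCategory (Corner P) where
  tensorHom_def _ _ := by ext; simp [MonoidalCategory.tensorHom_def]
  id_tensorHom_id _ _ := by ext; simp
  tensorHom_comp_tensorHom _ _ _ _ := by ext; simp
  whiskerLeft_id _ _ := by ext; simp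
  id_whiskerRight _ _ := by ext; simp
  associator_naturality _ _ _ := by ext; simp
  leftUnitor_naturality _ := by ext; simp [whisker_exchange_assoc]
  rightUnitor_naturality _ := by ext; simp [← whisker_exchange_assoc]
  pentagon _ _ _ _ := by ext; simp
  triangle _ _ := by ext; simp

/-- The corner acts on the row from the left by the tensor product. -/
@[simps!]
instance rowLeftAction : MonoidalLeftAction (Corner P) (Row P) where
  actionObj c x := ⟨c.obj ⊗ x.obj, isIso_whiskerRight_tensor c.property.1 x.obj⟩
  actionHomLeft f x := ObjectProperty.homMk (f.hom ▷ x.obj)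
  actionHomRight c _ _ f := ObjectProperty.homMk (c.obj ◁ f.hom)
  actionHom f g := ObjectProperty.homMk (f.hom ⊗ₘ g.hom)
  actionAssocIso c c' x := ObjectProperty.isoMk _ (α_ c.obj c'.obj x.obj)
  actionUnitIso x := ObjectProperty.isoMk _ (rowUnitor P x.obj)
  actionHom_def _ _ := by ext; simp [MonoidalCategory.tensorHom_def]
  actionHomRight_id _ _ := by ext; simp
  id_actionHomLeft _ _ := by ext; simp
  actionHom_comp _ _ _ _ := by ext; simp
  actionAssocIso_hom_naturality _ _ _ := by ext; simp
  actionUnitIso_hom_naturality _ := by ext; simp [whisker_exchange_assoc]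
  whiskerLeft_actionHomLeft _ _ _ _ _ := by ext; simp
  whiskerRight_actionHomLeft _ _ _ := by ext; simp
  associator_actionHom _ _ _ _ := by ext; simp
  leftUnitor_actionHom _ _ := by ext; simp
  rightUnitor_actionHom _ _ := by ext; simp

/-- `Φ` acts on the row from the right by the tensor product. -/
@[simps!]
instance rowRightAction : MonoidalRightAction Φ (Row P) where
  actionObj x y := ⟨x.obj ⊗ y, isIso_whiskerRight_tensor x.property y⟩
  actionHomLeft f y := ObjectProperty.homMk (f.hom ▷ y)
  actionHomRight x _ _ f := ObjectProperty.homMk (x.obj ◁ f)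
  actionHom f g := ObjectProperty.homMk (f.hom ⊗ₘ g)
  actionAssocIso x y z := ObjectProperty.isoMk _ (α_ x.obj y z).symm
  actionUnitIso x := ObjectProperty.isoMk _ (ρ_ x.obj)
  actionHom_def _ _ := by ext; simp [MonoidalCategory.tensorHom_def]
  actionHomRight_id _ _ := by ext; simp
  id_actionHomLeft _ _ := by ext; simp
  actionHom_comp _ _ _ _ := by ext; simp
  actionAssocIso_hom_naturality _ _ _ := by ext; simp
  actionUnitIso_hom_naturality _ := by ext; simp
  actionHomRight_whiskerRight _ _ _ := by ext; simp
  whiskerRight_actionHomLeft _ _ _ _ _ := by ext; simp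
  actionHom_associator _ _ _ _ := by ext; simp
  actionHom_leftUnitor _ _ := by ext; simp
  actionHom_rightUnitor _ _ := by ext; simp

/-- `Φ` acts on the column from the left by the tensor product. -/
@[simps!]
instance colLeftAction : MonoidalLeftAction Φ (Col P) where
  actionObj y x := ⟨y ⊗ x.obj, isIso_tensor_whiskerLeft y x.property⟩
  actionHomLeft f x := ObjectProperty.homMk (f ▷ x.obj)
  actionHomRight y _ _ f := ObjectProperty.homMk (y ◁ f.hom)
  actionHom f g := ObjectProperty.homMk (f ⊗ₘ g.hom)
  actionAssocIso y z x := ObjectProperty.isoMk _ (α_ y z x.obj)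
  actionUnitIso x := ObjectProperty.isoMk _ (λ_ x.obj)
  actionHom_def _ _ := by ext; simp [MonoidalCategory.tensorHom_def]
  actionHomRight_id _ _ := by ext; simp
  id_actionHomLeft _ _ := by ext; simp
  actionHom_comp _ _ _ _ := by ext; simp
  actionAssocIso_hom_naturality _ _ _ := by ext; simp
  actionUnitIso_hom_naturality _ := by ext; simp
  whiskerLeft_actionHomLeft _ _ _ _ _ := by ext; simp
  whiskerRight_actionHomLeft _ _ _ := by ext; simp
  associator_actionHom _ _ _ _ := by ext; simp
  leftUnitor_actionHom _ _ := by ext; simp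
  rightUnitor_actionHom _ _ := by ext; simp

/-- The corner acts on the column from the right by the tensor product. -/
@[simps!]
instance colRightAction : MonoidalRightAction (Corner P) (Col P) where
  actionObj x c := ⟨x.obj ⊗ c.obj, isIso_tensor_whiskerLeft x.obj c.property.2⟩
  actionHomLeft f c := ObjectProperty.homMk (f.hom ▷ c.obj)
  actionHomRight x _ _ f := ObjectProperty.homMk (x.obj ◁ f.hom)
  actionHom f g := ObjectProperty.homMk (f.hom ⊗ₘ g.hom)
  actionAssocIso x c c' := ObjectProperty.isoMk _ (α_ x.obj c.obj c'.obj).symm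
  actionUnitIso x := ObjectProperty.isoMk _ (colUnitor P x.obj)
  actionHom_def _ _ := by ext; simp [MonoidalCategory.tensorHom_def]
  actionHomRight_id _ _ := by ext; simp
  id_actionHomLeft _ _ := by ext; simp
  actionHom_comp _ _ _ _ := by ext; simp
  actionAssocIso_hom_naturality _ _ _ := by ext; simp
  actionUnitIso_hom_naturality _ := by ext; simp [← whisker_exchange_assoc]
  actionHomRight_whiskerRight _ _ _ := by ext; simp
  whiskerRight_actionHomLeft _ _ _ _ _ := by ext; simp
  actionHom_associator _ _ _ _ := by ext; simp
  actionHom_leftUnitor _ _ := by ext; simp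
  actionHom_rightUnitor _ _ := by ext; simp

/-- The row is a bimodule category over the corner and `Φ`. -/
instance rowBimodule : BimoduleCategory (Corner P) Φ (Row P) where
  mid c x y := ObjectProperty.isoMk _ (α_ c.obj x.obj y)
  mid_naturality_left _ _ _ := by ext; simp
  mid_naturality_middle _ _ _ _ _ := by ext; simp
  mid_naturality_right _ _ _ _ _ := by ext; simp
  pentagon_left _ _ _ _ := by ext; simp
  pentagon_right _ _ _ _ := by ext; simp
  triangle_left _ _ := by ext; simp
  triangle_right _ _ := by ext; simp

/-- The column is a bimodule category over `Φ` and the corner. -/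
instance colBimodule : BimoduleCategory Φ (Corner P) (Col P) where
  mid y x c := ObjectProperty.isoMk _ (α_ y x.obj c.obj)
  mid_naturality_left _ _ _ := by ext; simp
  mid_naturality_middle _ _ _ _ _ := by ext; simp
  mid_naturality_right _ _ _ _ _ := by ext; simp
  pentagon_left _ _ _ _ := by ext; simp
  pentagon_right _ _ _ _ := by ext; simp
  triangle_left _ _ := by ext; simp
  triangle_right _ _ := by ext; simp

/-- The multiplication functor `p·Φ × Φ·p → p·Φ·p`. -/
@[simps]
def rowColMul : Row P ⥤ Col P ⥤ Corner P where
  obj x :=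
    { obj := fun y => ⟨x.obj ⊗ y.obj, tensor_cornerProperty x.property y.property⟩
      map := fun f => ObjectProperty.homMk (x.obj ◁ f.hom)
      map_id := fun _ => by ext; simp
      map_comp := fun _ _ => by ext; simp }
  map f :=
    { app := fun y => ObjectProperty.homMk (f.hom ▷ y.obj)
      naturality := fun _ _ _ => by ext; simp [whisker_exchange] }
  map_id _ := by ext; simp
  map_comp _ _ := by ext; simp

/-- The multiplication functor `Φ·p × p·Φ → Φ`. -/
@[simps]
def colRowMul : Col P ⥤ Row P ⥤ Φ where
  obj x :=
    { obj := fun y => x.obj ⊗ y.obj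
      map := fun f => x.obj ◁ f.hom
      map_id := fun _ => by simp
      map_comp := fun _ _ => by simp }
  map f :=
    { app := fun y => f.hom ▷ y.obj
      naturality := fun _ _ _ => by simp [whisker_exchange] }
  map_id _ := by ext; simp
  map_comp _ _ := by ext; simp

lemma assoc_balancing_pentagon (x b b' z : Φ) :
    (α_ x b b').inv ▷ z ≫ (α_ (x ⊗ b) b' z).hom ≫ (α_ x b (b' ⊗ z)).hom =
      (α_ x (b ⊗ b') z).hom ≫ x ◁ (α_ b b' z).hom := by simp

lemma assoc_right_assoc (x z c c' : Φ) :
    x ◁ (α_ z c c').inv ≫ (α_ x (z ⊗ c) c').inv ≫ (α_ x z c).inv ▷ c' =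
      (α_ x z (c ⊗ c')).inv ≫ (α_ (x ⊗ z) c c').inv := by simp

lemma assoc_right_balancing (x b z c : Φ) :
    (α_ x b (z ⊗ c)).hom ≫ x ◁ (α_ b z c).inv ≫ (α_ x (b ⊗ z) c).inv =
      (α_ (x ⊗ b) z c).inv ≫ (α_ x b z).hom ▷ c := by simp

lemma assoc_left_right (c x z c' : Φ) :
    (α_ c x (z ⊗ c')).hom ≫ c ◁ (α_ x z c').inv =
      (α_ (c ⊗ x) z c').inv ≫ (α_ c x z).hom ▷ c' ≫ (α_ c (x ⊗ z) c').hom := by simp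

lemma assoc_left_unit (x z : Φ) :
    (α_ (𝟙_ Φ) x z).hom ≫ (λ_ (x ⊗ z)).hom = (λ_ x).hom ▷ z := by simp

lemma assoc_right_unit (x z : Φ) :
    (α_ x z (𝟙_ Φ)).inv ≫ (ρ_ (x ⊗ z)).hom = x ◁ (ρ_ z).hom := by simp

lemma assoc_corner_left_unit (x z : Φ) :
    (α_ p x z).hom ≫ P.i ▷ (x ⊗ z) ≫ (λ_ (x ⊗ z)).hom = (P.i ▷ x ≫ (λ_ x).hom) ▷ z := by simp

lemma assoc_corner_right_unit (x z : Φ) :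
    (α_ x z p).inv ≫ (x ⊗ z) ◁ P.i ≫ (ρ_ (x ⊗ z)).hom = x ◁ (z ◁ P.i ≫ (ρ_ z).hom) := by simp

lemma assoc_corner_triangle (x z : Φ) :
    (α_ x p z).hom ≫ x ◁ (P.i ▷ z ≫ (λ_ z).hom) = (x ◁ P.i ≫ (ρ_ x).hom) ▷ z := by simp

/-- The multiplication `p·Φ × Φ·p → p·Φ·p` as a `Φ`-balanced functor of bimodule categories over the
corner; all structure isomorphisms are associators of `Φ`. -/
def rowColBalancing : BimoduleBalancing (Corner P) Φ (Corner P) (rowColMul P) where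
  iso x b z := ObjectProperty.isoMk _ (α_ x.obj b z.obj)
  naturality_left f b z := ObjectProperty.hom_ext _ (associator_naturality_left f.hom b z.obj)
  naturality_middle x _ _ f z := ObjectProperty.hom_ext _ (associator_naturality_middle x.obj f z.obj)
  naturality_right x b _ _ f := ObjectProperty.hom_ext _ (associator_naturality_right x.obj b f.hom)
  pentagon x b b' z := ObjectProperty.hom_ext _ (assoc_balancing_pentagon x.obj b b' z.obj)
  triangle x z := ObjectProperty.hom_ext _ (triangle x.obj z.obj)
  left c x z := ObjectProperty.isoMk _ (α_ c.obj x.obj z.obj)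
  left_naturality₁ f x z := ObjectProperty.hom_ext _ (associator_naturality_left f.hom x.obj z.obj)
  left_naturality₂ c _ _ f z := ObjectProperty.hom_ext _ (associator_naturality_middle c.obj f.hom z.obj)
  left_naturality₃ c x _ _ f := ObjectProperty.hom_ext _ (associator_naturality_right c.obj x.obj f.hom)
  left_assoc c c' x z := ObjectProperty.hom_ext _ (pentagon c.obj c'.obj x.obj z.obj)
  left_unit x z := ObjectProperty.hom_ext _ (assoc_corner_left_unit P x.obj z.obj)
  right x z c := ObjectProperty.isoMk _ (α_ x.obj z.obj c.obj).symm
  right_naturality₁ f z c := ObjectProperty.hom_ext _ (associator_inv_naturality_left f.hom z.obj c.obj)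
  right_naturality₂ x _ _ f c := ObjectProperty.hom_ext _ (associator_inv_naturality_middle x.obj f.hom c.obj)
  right_naturality₃ x z _ _ f := ObjectProperty.hom_ext _ (associator_inv_naturality_right x.obj z.obj f.hom)
  right_assoc x z c c' := ObjectProperty.hom_ext _ (assoc_right_assoc x.obj z.obj c.obj c'.obj)
  right_unit x z := ObjectProperty.hom_ext _ (assoc_corner_right_unit P x.obj z.obj)
  left_balancing c x b z := ObjectProperty.hom_ext _ ((pentagon c.obj x.obj b z.obj).symm)
  right_balancing x b z c := ObjectProperty.hom_ext _ (assoc_right_balancing x.obj b z.obj c.obj)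
  left_right c x z c' := ObjectProperty.hom_ext _ (assoc_left_right c.obj x.obj z.obj c'.obj)

/-- The multiplication `Φ·p × p·Φ → Φ` as a functor of `Φ`-bimodule categories balanced over the
corner; all structure isomorphisms are associators of `Φ`. -/
def colRowBalancing : BimoduleBalancing Φ (Corner P) Φ (colRowMul P) where
  iso x b z := (α_ x.obj b.obj z.obj)
  naturality_left f b z := associator_naturality_left f.hom b.obj z.obj
  naturality_middle x _ _ f z := associator_naturality_middle x.obj f.hom z.obj
  naturality_right x b _ _ f := associator_naturality_right x.obj b.obj f.hom
  pentagon x b b' z := assoc_balancing_pentagon x.obj b.obj b'.obj z.obj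
  triangle x z := assoc_corner_triangle P x.obj z.obj
  left c x z := (α_ c x.obj z.obj)
  left_naturality₁ f x z := associator_naturality_left f x.obj z.obj
  left_naturality₂ c _ _ f z := associator_naturality_middle c f.hom z.obj
  left_naturality₃ c x _ _ f := associator_naturality_right c x.obj f.hom
  left_assoc c c' x z := pentagon c c' x.obj z.obj
  left_unit x z := assoc_left_unit x.obj z.obj
  right x z c := (α_ x.obj z.obj c).symm
  right_naturality₁ f z c := associator_inv_naturality_left f.hom z.obj c
  right_naturality₂ x _ _ f c := associator_inv_naturality_middle x.obj f.hom c
  right_naturality₃ x z _ _ f := associator_inv_naturality_right x.obj z.obj f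
  right_assoc x z c c' := assoc_right_assoc x.obj z.obj c c'
  right_unit x z := assoc_right_unit x.obj z.obj
  left_balancing c x b z := (pentagon c x.obj b.obj z.obj).symm
  right_balancing x b z c := assoc_right_balancing x.obj b.obj z.obj c
  left_right c x z c' := assoc_left_right c x.obj z.obj c'

instance [Preadditive Φ] [MonoidalPreadditive Φ] : MonoidalPreadditive (Corner P) where
  whiskerLeft_zero := by intros; ext; exact MonoidalPreadditive.whiskerLeft_zero
  zero_whiskerRight := by intros; ext; exact MonoidalPreadditive.zero_whiskerRight
  whiskerLeft_add _ _ := by ext; exact MonoidalPreadditive.whiskerLeft_add _ _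
  add_whiskerRight _ _ := by ext; exact MonoidalPreadditive.add_whiskerRight _ _

instance [Preadditive Φ] [MonoidalPreadditive Φ] [Linear ℂ Φ] [MonoidalLinear ℂ Φ] :
    MonoidalLinear ℂ (Corner P) where
  whiskerLeft_smul _ _ _ _ _ := by ext; exact MonoidalLinear.whiskerLeft_smul _ _ _
  smul_whiskerRight _ _ _ _ _ := by ext; exact MonoidalLinear.smul_whiskerRight _ _ _

end Corner

/-! ### Decompositions of the unit and indecomposability -/

section Unit

variable (Φ : Type u) [Category.{v} Φ] [Preadditive Φ] [MonoidalCategory Φ]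

/-- A decomposition `𝟙 = p₁ ⊕ ⋯ ⊕ pₙ` of the unit object as a direct sum of simple objects. -/
structure UnitDecomposition where
  n : ℕ
  summand : Fin n → Φ
  simple : ∀ i, Simple (summand i)
  inc : ∀ i, summand i ⟶ 𝟙_ Φ
  proj : ∀ i, 𝟙_ Φ ⟶ summand i
  inc_proj_self : ∀ i, inc i ≫ proj i = 𝟙 (summand i)
  inc_proj_ne : ∀ i j, i ≠ j → inc i ≫ proj j = 0
  sum_proj_inc : ∑ i, proj i ≫ inc i = 𝟙 (𝟙_ Φ)

variable {Φ}

/-- The summand `pᵢ` as a direct summand of the unit. -/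
def UnitDecomposition.retract (D : UnitDecomposition Φ) (i : Fin D.n) :
    Retract (D.summand i) (𝟙_ Φ) where
  i := D.inc i
  r := D.proj i
  retract := D.inc_proj_self i

/-- The matrix entry `Φᵢⱼ = pᵢ·Φ·pⱼ` is nonzero. -/
def UnitDecomposition.EntryNonzero (D : UnitDecomposition Φ) (i j : Fin D.n) : Prop :=
  ∃ x : Φ, ¬ IsZero (D.summand i ⊗ (x ⊗ D.summand j))

/-- `Φ` is indecomposable: the block decomposition of the matrix `(Φᵢⱼ)`, given by the equivalence
relation on indices generated by `Φᵢⱼ ≠ 0`, consists of exactly one block. -/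
def UnitDecomposition.IsIndecomposable (D : UnitDecomposition Φ) : Prop :=
  0 < D.n ∧ ∀ i j : Fin D.n, Relation.EqvGen D.EntryNonzero i j

end Unit

end FusionReducibility

end

open FusionReducibility

/-!
# Complete reducibility of multifusion categories

Everything rests on one recognition principle for relative tensor products. Let `T : M × N → P` be
the multiplication of a Morita context between tensor categories `P` and `B`, let `mul : N × M → B`
be the other multiplication, and suppose that the unit of `P` is a direct summand of
`T (x, y)` for some `x : M` and `y : N`. Then every `a : P` is a direct summand of
`T (x, y) · a ≅ T (x, y · a)`, and every `m : M` is a direct summand of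
`T (x, y) · m ≅ x · mul (y, m)`. For a balanced functor `F` on `M × N` the functor
`a ↦ F (x, y · a)` therefore carries a natural idempotent, whose image is the functor on `P` induced
by `F`: on `T (m, n)` the balancing identifies the image with `F (m, n)`. Natural transformations
are determined and constructed by the same retraction. The data that this argument uses is a
`TensorContext`, and `TensorContext.isRelativeTensor` is the conclusion. The target only needs split
idempotents, which finitely cocomplete categories have, and right exactness costs nothing, because
an additive functor on a semisimple category preserves the split cokernels and so all finite
colimits.

For a summand `p` of the unit the principle applies to `p·Φ × Φ·p → p·Φ·p` with `x = y = p`. For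
`Φ·p × p·Φ → Φ` one needs `𝟙` as a summand of some `x ⊗ y`. If `pⱼ·Φ·p ≠ 0`, choose a nonzero
object `z` in it; the coevaluation restricts to a nonzero, hence split, monomorphism
`pⱼ ⟶ z ⊗ z*`, because `pⱼ` is simple (`exists_retract_tensor_dual`). Duals and this splitting show
also that `Φᵢⱼ ≠ 0` is already an equivalence relation (`equivalence_entryNonzero`). In the
indecomposable case all `pⱼ` are reached, and the sum of the objects `z` over all `j` gives `x`,
the sum of their duals gives `y`.

In general choose a representative `pₖ` of each block. Then `pₖ·Φ·pₗ = 0` for `k ≠ l`, and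
`M = ∏ Φ·pₖ` and `N = ∏ pₖ·Φ`, with multiplications `(x, y) ↦ ⨁ xₖ ⊗ yₖ` and
`(y, x) ↦ (yₖ ⊗ xₖ)ₖ`, form a Morita context between `Φ` and `∏ pₖ·Φ·pₖ` to which the principle
applies in both directions, orthogonality removing the mixed terms.

That rows, columns, corners and finite products are again finite semisimple is obtained from the
characterisation of semisimplicity by von Neumann regularity, idempotent completeness and
finite-dimensional morphism spaces, all of which visibly pass to them.
-/

noncomputable section

namespace FusionReducibility

/-! ### Von Neumann regular categories -/

section Regular

variable {C : Type u} [Category.{v} C]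

variable (C) in
/-- A category is *von Neumann regular* if every morphism `f` has a pseudo-inverse `g`, that is
`f ≫ g ≫ f = f`. Together with split idempotents and finite-dimensional morphism spaces this is
equivalent to semisimplicity, and it passes at once to full subcategories and to products. -/
def IsVonNeumannRegular : Prop :=
  ∀ ⦃X Y : C⦄ (f : X ⟶ Y), ∃ g : Y ⟶ X, f ≫ g ≫ f = f

lemma IsVonNeumannRegular.exists_retraction (hC : IsVonNeumannRegular C) {X Y : C} (f : X ⟶ Y)
    [Mono f] : ∃ g, f ≫ g = 𝟙 X := by
  obtain ⟨g, hg⟩ := hC f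
  exact ⟨g, by rw [← cancel_mono f]; simpa using hg⟩

lemma IsVonNeumannRegular.exists_section (hC : IsVonNeumannRegular C) {X Y : C} (f : X ⟶ Y)
    [Epi f] : ∃ g, g ≫ f = 𝟙 Y := by
  obtain ⟨g, hg⟩ := hC f
  exact ⟨g, by rw [← cancel_epi f]; simpa using hg⟩

lemma exists_splitting [IsIdempotentComplete C] {X : C} {e : X ⟶ X} (he : e ≫ e = e) :
    ∃ (Y : C) (i : Y ⟶ X) (r : X ⟶ Y), i ≫ r = 𝟙 Y ∧ r ≫ i = e :=
  IsIdempotentComplete.idempotents_split X e he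

/-- In a von Neumann regular category an object is simple if and only if it is nonzero and its only
idempotent endomorphisms are `0` and `1`. -/
lemma IsVonNeumannRegular.simple_iff [Preadditive C] [IsIdempotentComplete C]
    (hC : IsVonNeumannRegular C) (X : C) :
    Simple X ↔ 𝟙 X ≠ 0 ∧ ∀ e : X ⟶ X, e ≫ e = e → e = 0 ∨ e = 𝟙 X := by
  constructor
  · intro hX
    refine ⟨id_nonzero X, fun e he => ?_⟩
    obtain ⟨Y, i, r, hir, hri⟩ := exists_splitting he
    have : Mono i := (⟨⟨⟨r, hir⟩⟩⟩ : IsSplitMono i).mono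
    by_cases hi : i = 0
    · exact Or.inl (by rw [← hri, hi, comp_zero])
    · have := isIso_of_mono_of_nonzero hi
      refine Or.inr ?_
      rw [← hri, ← cancel_epi i, reassoc_of% hir, Category.comp_id]
  · rintro ⟨hX, h⟩
    refine ⟨fun {Y} f _ => ⟨?_, fun hf => ?_⟩⟩
    · rintro _ rfl
      exact hX (by rw [← IsIso.inv_hom_id (0 : Y ⟶ X), comp_zero])
    · obtain ⟨g, hg⟩ := hC.exists_retraction f
      rcases h (g ≫ f) (by rw [Category.assoc, reassoc_of% hg]) with h0 | h1
      · exact absurd (by rw [← Category.id_comp f, ← hg, Category.assoc, h0, comp_zero]) hf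
      · exact ⟨g, hg, h1⟩

/-- A kernel of `f` is obtained by splitting `1 - f ≫ g`, where `g` is a pseudo-inverse of `f`. -/
lemma IsVonNeumannRegular.hasKernels [Preadditive C] [IsIdempotentComplete C]
    (hC : IsVonNeumannRegular C) : HasKernels C := by
  refine ⟨fun {X Y} f => ?_⟩
  obtain ⟨g, hg⟩ := hC f
  have he : (𝟙 X - f ≫ g) ≫ f = 0 := by simp [Preadditive.sub_comp, hg]
  obtain ⟨K, i, r, hir, hri⟩ := exists_splitting (e := 𝟙 X - f ≫ g) (by
    rw [Preadditive.comp_sub, Category.comp_id, ← Category.assoc, he, zero_comp, sub_zero])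
  have hi : i ≫ f = 0 := by
    rw [← Category.id_comp i, ← hir, Category.assoc, Category.assoc, reassoc_of% hri, he, comp_zero]
  refine ⟨⟨⟨KernelFork.ofι i hi, KernelFork.IsLimit.ofι i hi (fun k _ => k ≫ r) ?_ ?_⟩⟩⟩
  · intro W k hk
    rw [Category.assoc, hri, Preadditive.comp_sub, Category.comp_id, reassoc_of% hk, zero_comp,
      sub_zero]
  · intro W k hk m hm
    rw [← hm, Category.assoc, hir, Category.comp_id]

/-- The colimit cofork that computes the cokernel of a morphism with a pseudo-inverse. It is
defined by equations, hence preserved by every additive functor. -/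
def isColimitCokernelCofork [Preadditive C] {X Y Q : C} (f : X ⟶ Y) (g : Y ⟶ X) (i : Q ⟶ Y)
    (r : Y ⟶ Q) (hf : f ≫ r = 0) (hir : i ≫ r = 𝟙 Q) (hri : r ≫ i = 𝟙 Y - g ≫ f) :
    IsColimit (CokernelCofork.ofπ r hf) :=
  CokernelCofork.IsColimit.ofπ r hf (fun k _ => i ≫ k)
    (fun k hk => by
      rw [← Category.assoc, hri, Preadditive.sub_comp, Category.id_comp, Category.assoc, hk,
        comp_zero, sub_zero])
    (fun k hk m hm => by rw [← hm, ← Category.assoc, hir, Category.id_comp])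

lemma IsVonNeumannRegular.exists_cokernel [Preadditive C] [IsIdempotentComplete C]
    (hC : IsVonNeumannRegular C) {X Y : C} (f : X ⟶ Y) :
    ∃ (g : Y ⟶ X) (Q : C) (i : Q ⟶ Y) (r : Y ⟶ Q),
      f ≫ r = 0 ∧ i ≫ r = 𝟙 Q ∧ r ≫ i = 𝟙 Y - g ≫ f := by
  obtain ⟨g, hg⟩ := hC f
  have he : f ≫ (𝟙 Y - g ≫ f) = 0 := by simp [Preadditive.comp_sub, hg]
  obtain ⟨Q, i, r, hir, hri⟩ := exists_splitting (e := 𝟙 Y - g ≫ f) (by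
    rw [Preadditive.sub_comp, Category.id_comp, Category.assoc, he, comp_zero, sub_zero])
  refine ⟨g, Q, i, r, ?_, hir, hri⟩
  rw [← Category.comp_id r, ← hir, reassoc_of% hri, reassoc_of% he, zero_comp]

lemma IsVonNeumannRegular.hasCokernels [Preadditive C] [IsIdempotentComplete C]
    (hC : IsVonNeumannRegular C) : HasCokernels C := by
  refine ⟨fun {X Y} f => ?_⟩
  obtain ⟨g, Q, i, r, hf, hir, hri⟩ := hC.exists_cokernel f
  exact ⟨⟨⟨_, isColimitCokernelCofork f g i r hf hir hri⟩⟩⟩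

lemma IsVonNeumannRegular.isNormalMonoCategory [Preadditive C] (hC : IsVonNeumannRegular C) :
    IsNormalMonoCategory C := by
  refine ⟨fun {X Y} f _ => ?_⟩
  obtain ⟨g, hg⟩ := hC.exists_retraction f
  refine ⟨⟨Y, 𝟙 Y - g ≫ f, by simp [Preadditive.comp_sub, reassoc_of% hg],
    KernelFork.IsLimit.ofι f _ (fun k _ => k ≫ g) (fun k hk => ?_) (fun k hk m hm => ?_)⟩⟩
  · rw [Preadditive.comp_sub, Category.comp_id, sub_eq_zero] at hk
    rw [Category.assoc, ← hk]
  · rw [← hm, Category.assoc, hg, Category.comp_id]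

lemma IsVonNeumannRegular.isNormalEpiCategory [Preadditive C] (hC : IsVonNeumannRegular C) :
    IsNormalEpiCategory C := by
  refine ⟨fun {X Y} f _ => ?_⟩
  obtain ⟨g, hg⟩ := hC.exists_section f
  refine ⟨⟨X, 𝟙 X - f ≫ g, by simp [Preadditive.sub_comp, hg],
    CokernelCofork.IsColimit.ofπ f _ (fun k _ => g ≫ k) (fun k hk => ?_) (fun k hk m hm => ?_)⟩⟩
  · rw [Preadditive.sub_comp, Category.id_comp, sub_eq_zero, Category.assoc] at hk
    exact hk.symm
  · rw [← hm, ← Category.assoc, hg, Category.id_comp]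

/-- An additive functor out of a von Neumann regular category is right exact, because all cokernels
are split. -/
lemma IsVonNeumannRegular.preservesFiniteColimits [Preadditive C] [IsIdempotentComplete C]
    [HasFiniteProducts C] (hC : IsVonNeumannRegular C) {X : Type u₁} [Category.{v₁} X]
    [Preadditive X] [HasFiniteColimits X] (F : C ⥤ X) [F.Additive] : PreservesFiniteColimits F := by
  have := hC.hasCokernels
  have := HasFiniteBiproducts.of_hasFiniteProducts (C := C)
  have := HasBinaryBiproducts.of_hasBinaryProducts (C := C)
  have : HasCoequalizers C := Preadditive.hasCoequalizers_of_hasCokernels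
  have : HasZeroObject X := hasZeroObject_of_hasInitial_object
  have (A B : C) (f : A ⟶ B) : PreservesColimit (parallelPair f 0) F := by
    obtain ⟨g, Q, i, r, hf, hir, hri⟩ := hC.exists_cokernel f
    refine preservesColimit_of_preserves_colimit_cocone
      (isColimitCokernelCofork f g i r hf hir hri) ?_
    exact (CokernelCofork.isColimitMapCoconeEquiv _ F).symm
      (isColimitCokernelCofork (F.map f) (F.map g) (F.map i) (F.map r)
        (by rw [← F.map_comp, hf, F.map_zero]) (by rw [← F.map_comp, hir, F.map_id])
        (by rw [← F.map_comp, hri, F.map_sub, F.map_id, F.map_comp]))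
  exact F.preservesFiniteColimits_of_preservesCokernels

/-- A finitely cocomplete category has split idempotents. -/
lemma isIdempotentComplete_of_hasFiniteColimits (X : Type u₁) [Category.{v₁} X]
    [HasFiniteColimits X] : IsIdempotentComplete X := by
  refine ⟨fun A e he => ?_⟩
  refine ⟨coequalizer (𝟙 A) e, coequalizer.desc e (by rw [Category.id_comp, he]),
    coequalizer.π _ _, ?_, coequalizer.π_desc _ _⟩
  ext
  rw [coequalizer.π_desc_assoc, Category.comp_id, ← coequalizer.condition, Category.id_comp]

end Regular

/-! ### Decomposition into simple objects -/

section Decomposition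

variable {C : Type u} [Category.{v} C] [Preadditive C]

/-- `X` is a finite direct sum of simple objects. -/
def HasSimpleDecomposition (X : C) : Prop :=
  ∃ (J : Type) (_ : Fintype J) (_ : DecidableEq J) (S : J → C) (ι : ∀ j, S j ⟶ X)
    (π : ∀ j, X ⟶ S j), (∀ j, Simple (S j)) ∧
    (∀ j k, ι j ≫ π k = if h : j = k then eqToHom (congrArg S h) else 0) ∧ ∑ j, π j ≫ ι j = 𝟙 X

lemma hasSimpleDecomposition_of_isZero {X : C} (hX : IsZero X) : HasSimpleDecomposition X :=
  ⟨Empty, inferInstance, inferInstance, Empty.elim, fun j => j.elim, fun j => j.elim,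
    fun j => j.elim, fun j => j.elim, hX.eq_of_src _ _⟩

lemma hasSimpleDecomposition_of_simple {X : C} (hX : Simple X) : HasSimpleDecomposition X :=
  ⟨Unit, inferInstance, inferInstance, fun _ => X, fun _ => 𝟙 X, fun _ => 𝟙 X, fun _ => hX,
    fun _ _ => by simp, by simp⟩

/-- Decompositions of two complementary summands combine to a decomposition. -/
lemma HasSimpleDecomposition.add {X Y Z : C} (hY : HasSimpleDecomposition Y)
    (hZ : HasSimpleDecomposition Z) (i : Y ⟶ X) (r : X ⟶ Y) (i' : Z ⟶ X) (r' : X ⟶ Z)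
    (h : i ≫ r = 𝟙 Y) (h' : i' ≫ r' = 𝟙 Z) (hir' : i ≫ r' = 0) (hi'r : i' ≫ r = 0)
    (hsum : r ≫ i + r' ≫ i' = 𝟙 X) : HasSimpleDecomposition X := by
  obtain ⟨J, _, _, S, ι, π, hS, ho, ht⟩ := hY
  obtain ⟨J', _, _, S', ι', π', hS', ho', ht'⟩ := hZ
  refine ⟨J ⊕ J', inferInstance, inferInstance, Sum.elim S S',
    Sum.rec (fun j => ι j ≫ i) (fun j => ι' j ≫ i'),
    Sum.rec (fun j => r ≫ π j) (fun j => r' ≫ π' j), ?_, ?_, ?_⟩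
  · rintro (j | j)
    exacts [hS j, hS' j]
  · rintro (j | j) (k | k)
    · change (ι j ≫ i) ≫ r ≫ π k = _
      rw [Category.assoc, reassoc_of% h, ho]
      by_cases hjk : j = k
      · rw [dif_pos hjk, dif_pos (congrArg Sum.inl hjk)]; rfl
      · rw [dif_neg hjk, dif_neg (by simpa using hjk)]; rfl
    · change (ι j ≫ i) ≫ r' ≫ π' k = _
      rw [Category.assoc, reassoc_of% hir', zero_comp, comp_zero, dif_neg (by simp)]; rfl
    · change (ι' j ≫ i') ≫ r ≫ π k = _
      rw [Category.assoc, reassoc_of% hi'r, zero_comp, comp_zero, dif_neg (by simp)]; rfl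
    · change (ι' j ≫ i') ≫ r' ≫ π' k = _
      rw [Category.assoc, reassoc_of% h', ho']
      by_cases hjk : j = k
      · rw [dif_pos hjk, dif_pos (congrArg Sum.inr hjk)]; rfl
      · rw [dif_neg hjk, dif_neg (by simpa using hjk)]; rfl
  · have e₁ : ∑ j, (r ≫ π j) ≫ ι j ≫ i = r ≫ (∑ j, π j ≫ ι j) ≫ i := by
      simp [Preadditive.sum_comp, Preadditive.comp_sum]
    have e₂ : ∑ j, (r' ≫ π' j) ≫ ι' j ≫ i' = r' ≫ (∑ j, π' j ≫ ι' j) ≫ i' := by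
      simp [Preadditive.sum_comp, Preadditive.comp_sum]
    rw [Fintype.sum_sum_type]
    change ∑ j, (r ≫ π j) ≫ ι j ≫ i + ∑ j, (r' ≫ π' j) ≫ ι' j ≫ i' = _
    rw [e₁, e₂, ht, ht', Category.id_comp, Category.id_comp, hsum]

/-- The endomorphism algebra of a direct summand is strictly smaller. -/
lemma finrank_end_lt [Linear ℂ C] {X Y Z : C} [FiniteDimensional ℂ (X ⟶ X)] (i : Y ⟶ X) (r : X ⟶ Y)
    (h : i ≫ r = 𝟙 Y) (i' : Z ⟶ X) (r' : X ⟶ Z) (hir' : i ≫ r' = 0) (h' : r' ≫ i' ≠ 0)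
    (hi' : i' ≫ r' = 𝟙 Z) :
    Module.finrank ℂ (Y ⟶ Y) < Module.finrank ℂ (X ⟶ X) := by
  let L : (Y ⟶ Y) →ₗ[ℂ] (X ⟶ X) :=
    { toFun := fun f => r ≫ f ≫ i
      map_add' := by intros; simp
      map_smul' := by intros; simp }
  have hL : Function.Injective L := by
    intro f g hfg
    have := congrArg (fun t => i ≫ t ≫ r) (show r ≫ f ≫ i = r ≫ g ≫ i from hfg)
    simpa [reassoc_of% h, h] using this
  rw [← LinearMap.finrank_range_of_inj hL]
  refine Submodule.finrank_lt fun htop => h' ?_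
  obtain ⟨f, hf⟩ : r' ≫ i' ∈ LinearMap.range L := by rw [htop]; trivial
  have hf' : r ≫ f ≫ i = r' ≫ i' := hf
  have := congrArg (· ≫ r') hf'
  simp only [Category.assoc, hir', comp_zero, hi', Category.comp_id] at this
  rw [← this, zero_comp]

lemma IsVonNeumannRegular.hasSimpleDecomposition [Linear ℂ C] [IsIdempotentComplete C]
    (hC : IsVonNeumannRegular C) (hfd : ∀ X Y : C, FiniteDimensional ℂ (X ⟶ Y)) (X : C) :
    HasSimpleDecomposition X := by
  induction hn : Module.finrank ℂ (X ⟶ X) using Nat.strong_induction_on generalizing X with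
  | _ n ih =>
  by_cases hX : 𝟙 X = 0
  · exact hasSimpleDecomposition_of_isZero ((IsZero.iff_id_eq_zero X).2 hX)
  by_cases hs : Simple X
  · exact hasSimpleDecomposition_of_simple hs
  rw [hC.simple_iff] at hs
  push Not at hs
  obtain ⟨e, he, he0, he1⟩ := hs hX
  have he' : (𝟙 X - e) ≫ (𝟙 X - e) = 𝟙 X - e := by simp [Preadditive.comp_sub, he]
  obtain ⟨Y, i, r, hir, hri⟩ := exists_splitting he
  obtain ⟨Z, i', r', hir', hri'⟩ := exists_splitting he'
  have h₁ : i ≫ r' = 0 := by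
    have : i ≫ (r ≫ i) ≫ (r' ≫ i') ≫ r' = 0 := by
      rw [hri, hri']; simp [Preadditive.comp_sub, reassoc_of% he]
    simpa [reassoc_of% hir, hir'] using this
  have h₂ : i' ≫ r = 0 := by
    have : i' ≫ (r' ≫ i') ≫ (r ≫ i) ≫ r = 0 := by
      rw [hri, hri']; simp [Preadditive.sub_comp, reassoc_of% he]
    simpa [reassoc_of% hir', hir] using this
  refine HasSimpleDecomposition.add (ih _ ?_ Y rfl) (ih _ ?_ Z rfl) i r i' r' hir hir' h₁ h₂
    (by rw [hri, hri']; abel)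
  · rw [← hn]
    exact finrank_end_lt i r hir i' r' h₁
      (by rw [hri', Ne, sub_eq_zero]; exact fun h => he1 h.symm) hir'
  · rw [← hn]
    exact finrank_end_lt i' r' hir' i r h₂ (by rwa [hri]) hir

/-- A `ℂ`-linear von Neumann regular category with finite products, split idempotents,
finite-dimensional morphism spaces and finitely many simple objects is finite semisimple. -/
theorem IsVonNeumannRegular.isFiniteSemisimple [Linear ℂ C] [IsIdempotentComplete C]
    [HasFiniteProducts C] (hC : IsVonNeumannRegular C)
    (hfd : ∀ X Y : C, FiniteDimensional ℂ (X ⟶ Y))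
    (hfin : ∃ (J : Type) (_ : Finite J) (S : J → C), ∀ X : C, Simple X → ∃ j, Nonempty (X ≅ S j)) :
    IsFiniteSemisimple C where
  hasFiniteProducts := inferInstance
  hasKernels := hC.hasKernels
  hasCokernels := hC.hasCokernels
  isNormalMonoCategory := hC.isNormalMonoCategory
  isNormalEpiCategory := hC.isNormalEpiCategory
  finiteDimensional_hom := hfd
  exists_simple_decomposition X := by
    obtain ⟨J, _, _, S, ι, π, hS, ho, ht⟩ := hC.hasSimpleDecomposition hfd X
    let E := (Fintype.equivFin J).symm
    refine ⟨_, S ∘ E, ⟨X, fun k => π (E k), fun k => ι (E k), fun j k => ?_⟩, fun k => hS _,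
      ⟨isBilimitOfTotal _ ?_⟩, ⟨Iso.refl X⟩⟩
    · simp only [ho, E.apply_eq_iff_eq, Function.comp]
    · exact (E.sum_comp fun j => π j ≫ ι j).trans ht
  finitely_many_simples := by
    obtain ⟨J, _, S, hS⟩ := hfin
    obtain ⟨n, ⟨E⟩⟩ := Finite.exists_equiv_fin J
    exact ⟨n, S ∘ E.symm, fun X hX => by
      obtain ⟨j, ⟨f⟩⟩ := hS X hX
      exact ⟨E j, ⟨f ≪≫ eqToIso (by simp)⟩⟩⟩

end Decomposition

/-! ### Finite semisimple categories are von Neumann regular -/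

section Semisimple

variable (C : Type u) [Category.{v} C] [Preadditive C] [Linear ℂ C] [IsFiniteSemisimple C]

/-- A finite semisimple category is abelian. -/
abbrev abelianOfIsFiniteSemisimple : Abelian C :=
  { ‹Preadditive C› with
    has_finite_products := IsFiniteSemisimple.hasFiniteProducts
    has_kernels := IsFiniteSemisimple.hasKernels
    has_cokernels := IsFiniteSemisimple.hasCokernels
    normalMonoOfMono := IsFiniteSemisimple.isNormalMonoCategory.normalMonoOfMono
    normalEpiOfEpi := IsFiniteSemisimple.isNormalEpiCategory.normalEpiOfEpi }

instance hasFiniteBiproducts_of_isFiniteSemisimple : HasFiniteBiproducts C :=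
  let _ := abelianOfIsFiniteSemisimple C
  Abelian.hasFiniteBiproducts

instance hasFiniteColimits_of_isFiniteSemisimple : HasFiniteColimits C :=
  let _ := abelianOfIsFiniteSemisimple C
  Abelian.hasFiniteColimits

instance isIdempotentComplete_of_isFiniteSemisimple : IsIdempotentComplete C :=
  let _ := abelianOfIsFiniteSemisimple C
  Idempotents.isIdempotentComplete_of_abelian C

variable {C}

/-- Every epimorphism onto a simple object splits, as some simple summand of its source maps
isomorphically. -/
lemma exists_section_of_simple {X S : C} [Simple S] (f : X ⟶ S) [Epi f] : ∃ g, g ≫ f = 𝟙 S := by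
  let _ := abelianOfIsFiniteSemisimple C
  obtain ⟨n, T, b, hT, ⟨hb⟩, ⟨e⟩⟩ := IsFiniteSemisimple.exists_simple_decomposition X
  by_cases h : ∀ j, b.ι j ≫ e.inv ≫ f = 0
  · have h0 : e.inv ≫ f = 0 := hb.isColimit.hom_ext fun ⟨j⟩ => by simpa using h j
    have hf : f = 0 := by rw [← cancel_epi e.inv, h0, comp_zero]
    exact absurd (by rw [← cancel_epi f, hf, zero_comp, zero_comp]) (id_nonzero S)
  · push Not at h
    obtain ⟨j, hj⟩ := h
    have := hT j
    have := isIso_of_hom_simple hj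
    exact ⟨inv (b.ι j ≫ e.inv ≫ f) ≫ b.ι j ≫ e.inv, by simp only [Category.assoc, IsIso.inv_hom_id]⟩

lemma projective_of_simple (S : C) [Simple S] : Projective S where
  factors {E X} f e _ := by
    let _ := abelianOfIsFiniteSemisimple C
    obtain ⟨g, hg⟩ := exists_section_of_simple (pullback.fst f e)
    exact ⟨g ≫ pullback.snd f e, by
      rw [Category.assoc, ← pullback.condition, reassoc_of% hg]⟩

lemma projective_of_isFiniteSemisimple (X : C) : Projective X where
  factors {E Y} f e _ := by
    obtain ⟨n, T, b, hT, ⟨hb⟩, ⟨i⟩⟩ := IsFiniteSemisimple.exists_simple_decomposition X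
    have (j : Fin n) : Projective (T j) := have := hT j; projective_of_simple (T j)
    refine ⟨∑ j, i.hom ≫ b.π j ≫ Projective.factorThru (b.ι j ≫ i.inv ≫ f) e, ?_⟩
    have h : ∑ j, i.hom ≫ (b.π j ≫ b.ι j) ≫ i.inv ≫ f = f := by
      rw [← Preadditive.comp_sum, ← Preadditive.sum_comp, IsBilimit.total hb]
      simp
    rw [Preadditive.sum_comp]
    simpa using h

variable (C) in
theorem isVonNeumannRegular_of_isFiniteSemisimple : IsVonNeumannRegular C := by
  let _ := abelianOfIsFiniteSemisimple C
  have hsec {X Y : C} (f : X ⟶ Y) [Epi f] : ∃ g, g ≫ f = 𝟙 Y :=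
    have := projective_of_isFiniteSemisimple Y
    ⟨Projective.factorThru (𝟙 Y) f, Projective.factorThru_comp _ _⟩
  have hret {X Y : C} (f : X ⟶ Y) [Mono f] : ∃ g, f ≫ g = 𝟙 X := by
    obtain ⟨s, hs⟩ := hsec (cokernel.π f)
    refine ⟨Abelian.monoLift f (𝟙 Y - cokernel.π f ≫ s) ?_, ?_⟩
    · rw [Preadditive.sub_comp, Category.assoc, hs, Category.comp_id, Category.id_comp, sub_self]
    · rw [← cancel_mono f, Category.assoc, Abelian.monoLift_comp]
      simp [Preadditive.comp_sub]
  intro X Y f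
  obtain ⟨s, hs⟩ := hsec (Abelian.factorThruImage f)
  obtain ⟨t, ht⟩ := hret (Abelian.image.ι f)
  refine ⟨t ≫ s, ?_⟩
  have h : (Abelian.factorThruImage f ≫ Abelian.image.ι f) ≫ (t ≫ s) ≫
      (Abelian.factorThruImage f ≫ Abelian.image.ι f) =
      Abelian.factorThruImage f ≫ Abelian.image.ι f := by
    simp only [Category.assoc, reassoc_of% ht, reassoc_of% hs]
  rwa [Abelian.image.fac] at h

/-- An additive functor out of a finite semisimple category is right exact. -/
lemma preservesFiniteColimits_of_isFiniteSemisimple {X : Type u₁} [Category.{v₁} X]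
    [Preadditive X] [HasFiniteColimits X] (F : C ⥤ X) [F.Additive] : PreservesFiniteColimits F :=
  have : HasFiniteProducts C := IsFiniteSemisimple.hasFiniteProducts
  (isVonNeumannRegular_of_isFiniteSemisimple C).preservesFiniteColimits F

end Semisimple

/-! ### Full subcategories and products -/

section Constructions

variable {C : Type u} [Category.{v} C] [Preadditive C] [Linear ℂ C] [IsFiniteSemisimple C]

/-- A full subcategory of a finite semisimple category that is closed under direct summands and
finite products is finite semisimple. -/
theorem isFiniteSemisimple_fullSubcategory (Q : ObjectProperty C) [Q.IsClosedUnderFiniteProducts]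
    (hQ : ∀ {X Y : C} (_ : Retract X Y), Q Y → Q X) : IsFiniteSemisimple Q.FullSubcategory := by
  have : HasFiniteProducts C := IsFiniteSemisimple.hasFiniteProducts
  have hC := isVonNeumannRegular_of_isFiniteSemisimple C
  have hreg : IsVonNeumannRegular Q.FullSubcategory := fun X Y f => by
    obtain ⟨g, hg⟩ := hC f.hom
    exact ⟨ObjectProperty.homMk g, by ext; exact hg⟩
  have hidem : IsIdempotentComplete Q.FullSubcategory := ⟨fun X e he => by
    obtain ⟨Y, i, r, hir, hri⟩ := exists_splitting (congrArg InducedCategory.Hom.hom he)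
    exact ⟨⟨Y, hQ ⟨i, r, hir⟩ X.property⟩, ObjectProperty.homMk i, ObjectProperty.homMk r,
      by ext; exact hir, by ext; exact hri⟩⟩
  refine hreg.isFiniteSemisimple (fun X Y => ?_) ?_
  · have := IsFiniteSemisimple.finiteDimensional_hom X.obj Y.obj
    let L : (X ⟶ Y) →ₗ[ℂ] (X.obj ⟶ Y.obj) :=
      { toFun := fun f => f.hom, map_add' := fun _ _ => rfl, map_smul' := fun _ _ => rfl }
    exact FiniteDimensional.of_injective L fun f g h => by ext; exact h
  · obtain ⟨n, S, hS⟩ := IsFiniteSemisimple.finitely_many_simples (C := C)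
    refine ⟨{i : Fin n // Q (S i)}, inferInstance, fun i => ⟨S i.1, i.2⟩, fun X hX => ?_⟩
    have hX' : Simple X.obj := by
      rw [hreg.simple_iff] at hX
      rw [hC.simple_iff]
      refine ⟨fun h => hX.1 (by ext; exact h), fun e he => ?_⟩
      refine (hX.2 (ObjectProperty.homMk e) (by ext; exact he)).imp
        (fun h => congrArg InducedCategory.Hom.hom h) (fun h => congrArg InducedCategory.Hom.hom h)
    obtain ⟨i, ⟨e⟩⟩ := hS X.obj hX'
    exact ⟨⟨i, hQ ⟨e.inv, e.hom, e.inv_hom_id⟩ X.property⟩, ⟨ObjectProperty.isoMk _ e⟩⟩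

lemma simple_fullSubcategory (Q : ObjectProperty C) [IsFiniteSemisimple Q.FullSubcategory]
    (X : Q.FullSubcategory) [Simple X.obj] : Simple X := by
  have hX : Simple X.obj := inferInstance
  rw [(isVonNeumannRegular_of_isFiniteSemisimple C).simple_iff] at hX
  rw [(isVonNeumannRegular_of_isFiniteSemisimple Q.FullSubcategory).simple_iff]
  exact ⟨fun h => hX.1 (congrArg InducedCategory.Hom.hom h), fun e he =>
    (hX.2 e.hom (congrArg InducedCategory.Hom.hom he)).imp (fun h => by ext; exact h)
      (fun h => by ext; exact h)⟩

open scoped ZeroObject in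
/-- A finite product of finite semisimple categories is finite semisimple. -/
theorem isFiniteSemisimple_pi {K : Type} [Finite K] (D : K → Type u) [∀ k, Category.{v} (D k)]
    [∀ k, Preadditive (D k)] [∀ k, Linear ℂ (D k)] [∀ k, IsFiniteSemisimple (D k)] :
    IsFiniteSemisimple (∀ k, D k) := by
  classical
  have hreg : IsVonNeumannRegular (∀ k, D k) := fun X Y f => by
    choose g hg using fun k => isVonNeumannRegular_of_isFiniteSemisimple (D k) (f k)
    exact ⟨g, funext hg⟩
  have hidem : IsIdempotentComplete (∀ k, D k) := ⟨fun X e he => by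
    choose Y i r hir hri using fun k => exists_splitting (congrFun he k)
    exact ⟨Y, i, r, funext hir, funext hri⟩⟩
  have hprod : HasFiniteProducts (∀ k, D k) := ⟨fun n => ⟨fun F => by
    have (k : K) : HasFiniteProducts (D k) := IsFiniteSemisimple.hasFiniteProducts
    exact ⟨⟨
      { cone :=
          { pt := fun k => limit (F ⋙ Pi.eval D k)
            π :=
              { app := fun j k => limit.π (F ⋙ Pi.eval D k) j
                naturality := fun i j f => funext fun k =>
                  (limit.cone (F ⋙ Pi.eval D k)).π.naturality f } }
        isLimit :=
          { lift := fun s k => limit.lift (F ⋙ Pi.eval D k) ((Pi.eval D k).mapCone s)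
            fac := fun s j => funext fun k => limit.lift_π _ _
            uniq := fun s m hm => funext fun k => limit.hom_ext fun j =>
              (congrFun (hm j) k).trans (limit.lift_π ((Pi.eval D k).mapCone s) j).symm } }⟩⟩⟩⟩
  have hzero (k : K) : HasZeroObject (D k) := hasZeroObject_of_hasInitial_object
  refine hreg.isFiniteSemisimple (fun X Y => ?_) ?_
  · have (k : K) := IsFiniteSemisimple.finiteDimensional_hom (X k) (Y k)
    have : Fintype K := Fintype.ofFinite K
    exact inferInstanceAs (FiniteDimensional ℂ (∀ k, X k ⟶ Y k))
  · choose n S hS using fun k => IsFiniteSemisimple.finitely_many_simples (C := D k)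
    -- The simple objects are concentrated in a single component `k`.
    let T (k : K) (j : Fin (n k)) : ∀ l, D l := Function.update (fun l => (0 : D l)) k (S k j)
    refine ⟨Σ k, Fin (n k), inferInstance, fun a => T a.1 a.2, fun X hX => ?_⟩
    have hX' := (hreg.simple_iff X).1 hX
    let e (k : K) : X ⟶ X := fun l => if l = k then 𝟙 (X l) else 0
    have he (k : K) : e k ≫ e k = e k := funext fun l => by
      by_cases h : l = k <;> simp [e, h]
    obtain ⟨k, hk⟩ : ∃ k, e k = 𝟙 X := by
      by_contra! h
      refine hX'.1 (funext fun k => ?_)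
      have := congrFun ((hX'.2 (e k) (he k)).resolve_right (h k)) k
      simpa [e] using this
    have hz (l : K) (hl : l ≠ k) : IsZero (X l) := by
      rw [IsZero.iff_id_eq_zero]
      have := congrFun hk l
      simpa [e, hl] using this.symm
    have hs : Simple (X k) := by
      rw [(isVonNeumannRegular_of_isFiniteSemisimple (D k)).simple_iff]
      have hext {f g : X ⟶ X} (h : f k = g k) : f = g := funext fun l => by
        by_cases hl : l = k
        · subst hl; exact h
        · exact (hz l hl).eq_of_src _ _
      refine ⟨fun h => hX'.1 (hext h), fun f hf => ?_⟩
      let f' : X ⟶ X := Function.update (fun l => 𝟙 (X l)) k f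
      have hf' : f' k = f := Function.update_self ..
      refine (hX'.2 f' (hext ?_)).imp (fun h => ?_) (fun h => ?_)
      · change f' k ≫ f' k = f' k
        rw [hf', hf]
      · rw [← hf', h]; rfl
      · rw [← hf', h]; rfl
    obtain ⟨j, ⟨i⟩⟩ := hS k (X k) hs
    refine ⟨⟨k, j⟩, ⟨Pi.isoMk fun l => ?_⟩⟩
    by_cases hl : l = k
    · subst hl
      exact i ≪≫ eqToIso (by simp [T])
    · exact (hz l hl).iso (by simp only [T, Function.update_of_ne hl]; exact isZero_zero _)

end Constructions

/-! ### Recognition of relative tensor products -/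

section Recognition

variable {B : Type u₂} {M : Type u₄} {N : Type u₅} {P : Type u₆}
  [Category.{v₂} B] [Category.{v₄} M] [Category.{v₅} N] [Category.{v₆} P] [MonoidalCategory B]
  [MonoidalRightAction B M] [MonoidalLeftAction B N]

/-- Data showing that a balanced functor `T : M × N → P` is a relative tensor product. In the case
of a Morita context, with `T` the multiplication `M × N → P` and `mul : N × M → B` the other
multiplication, and with `base : M`, `cobase : N` such that the unit of `P` is a retract of
`T (base, cobase)`, one has `comp m = mul (cobase, m)` and `ret a = cobase · a`. Then `inc` and
`proj` exhibit `m` as a retract of `base · mul (cobase, m)`, which is `T (base, cobase) · m`, and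
`coinc`, `coproj` exhibit `a` as a retract of `T (base, cobase · a)`. -/
structure TensorContext (T : M ⥤ N ⥤ P) (β : Balancing B T) where
  /-- the fixed object of `M` -/
  base : M
  /-- the functor `m ↦ mul (cobase, m)` -/
  comp : M ⥤ B
  /-- the functor `a ↦ cobase · a` -/
  ret : P ⥤ N
  /-- the associativity `mul (cobase, m) · n ≅ cobase · T (m, n)` -/
  assoc (m : M) (n : N) : comp.obj m ⊙ₗ n ≅ ret.obj ((T.obj m).obj n)
  assoc_naturality_left {m m' : M} (f : m ⟶ m') (n : N) :
    comp.map f ⊵ₗ n ≫ (assoc m' n).hom = (assoc m n).hom ≫ ret.map ((T.map f).app n)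
  assoc_naturality_right (m : M) {n n' : N} (f : n ⟶ n') :
    comp.obj m ⊴ₗ f ≫ (assoc m n').hom = (assoc m n).hom ≫ ret.map ((T.obj m).map f)
  inc (m : M) : m ⟶ base ⊙ᵣ comp.obj m
  proj (m : M) : base ⊙ᵣ comp.obj m ⟶ m
  proj_naturality {m m' : M} (f : m ⟶ m') : base ⊴ᵣ comp.map f ≫ proj m' = proj m ≫ f
  inc_proj (m : M) : inc m ≫ proj m = 𝟙 m
  coinc (a : P) : a ⟶ (T.obj base).obj (ret.obj a)
  coproj (a : P) : (T.obj base).obj (ret.obj a) ⟶ a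
  coinc_naturality {a a' : P} (f : a ⟶ a') :
    f ≫ coinc a' = coinc a ≫ (T.obj base).map (ret.map f)
  coproj_naturality {a a' : P} (f : a ⟶ a') :
    (T.obj base).map (ret.map f) ≫ coproj a' = coproj a ≫ f
  coinc_coproj (a : P) : coinc a ≫ coproj a = 𝟙 a
  inc_coinc (m : M) (n : N) :
    (T.map (inc m)).app n ≫ (β.iso base (comp.obj m) n).hom ≫ (T.obj base).map (assoc m n).hom =
      coinc ((T.obj m).obj n)
  /-- the right `B`-module structure of `comp` -/
  compAct (m : M) (b : B) : comp.obj (m ⊙ᵣ b) ⟶ comp.obj m ⊗ b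
  compAct_assoc (m : M) (b : B) (n : N) :
    compAct m b ⊵ₗ n ≫ (αₗ (comp.obj m) b n).hom ≫ (assoc m (b ⊙ₗ n)).hom =
      (assoc (m ⊙ᵣ b) n).hom ≫ ret.map (β.iso m b n).hom
  compAct_proj (m : M) (b : B) :
    base ⊴ᵣ compAct m b ≫ (αᵣ base (comp.obj m) b).hom ≫ proj m ⊵ᵣ b = proj (m ⊙ᵣ b)

namespace TensorContext

variable {T : M ⥤ N ⥤ P} {β : Balancing B T} (Z : TensorContext T β)
  {X : Type w} [Category.{w'} X] {F : M ⥤ N ⥤ X} (γ : Balancing B F)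

/-- For a balanced functor `F`, the projection `F (base, cobase · T (m, n)) ⟶ F (m, n)`. -/
def lower (m : M) (n : N) :
    (F.obj Z.base).obj (Z.ret.obj ((T.obj m).obj n)) ⟶ (F.obj m).obj n :=
  (F.obj Z.base).map (Z.assoc m n).inv ≫ (γ.iso Z.base (Z.comp.obj m) n).inv ≫
    (F.map (Z.proj m)).app n

/-- For a balanced functor `F`, the section `F (m, n) ⟶ F (base, cobase · T (m, n))` of `lower`. -/
def upper (m : M) (n : N) :
    (F.obj m).obj n ⟶ (F.obj Z.base).obj (Z.ret.obj ((T.obj m).obj n)) :=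
  (F.map (Z.inc m)).app n ≫ (γ.iso Z.base (Z.comp.obj m) n).hom ≫
    (F.obj Z.base).map (Z.assoc m n).hom

lemma upper_lower (m : M) (n : N) : Z.upper γ m n ≫ Z.lower γ m n = 𝟙 _ := by
  simp [upper, lower, ← Functor.map_comp_assoc, ← NatTrans.comp_app, ← Functor.map_comp, Z.inc_proj]

lemma lower_naturality_left {m m' : M} (f : m ⟶ m') (n : N) :
    (F.obj Z.base).map (Z.ret.map ((T.map f).app n)) ≫ Z.lower γ m' n =
      Z.lower γ m n ≫ (F.map f).app n := by
  have h : Z.ret.map ((T.map f).app n) ≫ (Z.assoc m' n).inv =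
      (Z.assoc m n).inv ≫ Z.comp.map f ⊵ₗ n := by
    rw [Iso.comp_inv_eq, Category.assoc, Z.assoc_naturality_left, Iso.inv_hom_id_assoc]
  have h' : (F.obj Z.base).map (Z.comp.map f ⊵ₗ n) ≫ (γ.iso Z.base (Z.comp.obj m') n).inv =
      (γ.iso Z.base (Z.comp.obj m) n).inv ≫ (F.map (Z.base ⊴ᵣ Z.comp.map f)).app n := by
    rw [Iso.comp_inv_eq, Category.assoc, γ.naturality_middle, Iso.inv_hom_id_assoc]
  simp only [lower, Category.assoc]
  rw [← Functor.map_comp_assoc, h, Functor.map_comp_assoc, reassoc_of% h', ← NatTrans.comp_app,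
    ← F.map_comp, Z.proj_naturality, F.map_comp, NatTrans.comp_app]

lemma lower_naturality_right (m : M) {n n' : N} (f : n ⟶ n') :
    (F.obj Z.base).map (Z.ret.map ((T.obj m).map f)) ≫ Z.lower γ m n' =
      Z.lower γ m n ≫ (F.obj m).map f := by
  have h : Z.ret.map ((T.obj m).map f) ≫ (Z.assoc m n').inv =
      (Z.assoc m n).inv ≫ Z.comp.obj m ⊴ₗ f := by
    rw [Iso.comp_inv_eq, Category.assoc, Z.assoc_naturality_right, Iso.inv_hom_id_assoc]
  have h' : (F.obj Z.base).map (Z.comp.obj m ⊴ₗ f) ≫ (γ.iso Z.base (Z.comp.obj m) n').inv =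
      (γ.iso Z.base (Z.comp.obj m) n).inv ≫ (F.obj (Z.base ⊙ᵣ Z.comp.obj m)).map f := by
    rw [Iso.comp_inv_eq, Category.assoc, γ.naturality_right, Iso.inv_hom_id_assoc]
  simp only [lower, Category.assoc]
  rw [← Functor.map_comp_assoc, h, Functor.map_comp_assoc, reassoc_of% h', NatTrans.naturality]

/-- The projections `lower` are compatible with the balancings of `T` and `F`. -/
lemma lower_balanced (m : M) (b : B) (n : N) :
    (F.obj Z.base).map (Z.ret.map (β.iso m b n).hom) ≫ Z.lower γ m (b ⊙ₗ n) =
      Z.lower γ (m ⊙ᵣ b) n ≫ (γ.iso m b n).hom := by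
  have h : Z.ret.map (β.iso m b n).hom ≫ (Z.assoc m (b ⊙ₗ n)).inv =
      (Z.assoc (m ⊙ᵣ b) n).inv ≫ Z.compAct m b ⊵ₗ n ≫ (αₗ (Z.comp.obj m) b n).hom := by
    rw [Iso.comp_inv_eq, Category.assoc, Category.assoc, Z.compAct_assoc, Iso.inv_hom_id_assoc]
  have h' : (F.obj Z.base).map (Z.compAct m b ⊵ₗ n) ≫
        (γ.iso Z.base (Z.comp.obj m ⊗ b) n).inv =
      (γ.iso Z.base (Z.comp.obj (m ⊙ᵣ b)) n).inv ≫ (F.map (Z.base ⊴ᵣ Z.compAct m b)).app n := by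
    rw [Iso.comp_inv_eq, Category.assoc, γ.naturality_middle, Iso.inv_hom_id_assoc]
  have h'' : (F.obj Z.base).map (αₗ (Z.comp.obj m) b n).hom ≫
        (γ.iso Z.base (Z.comp.obj m) (b ⊙ₗ n)).inv =
      (γ.iso Z.base (Z.comp.obj m ⊗ b) n).inv ≫
        (F.map (αᵣ Z.base (Z.comp.obj m) b).hom).app n ≫
          (γ.iso (Z.base ⊙ᵣ Z.comp.obj m) b n).hom := by
    rw [Iso.comp_inv_eq, Category.assoc, Category.assoc, γ.pentagon, Iso.inv_hom_id_assoc]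
  simp only [lower, Category.assoc]
  rw [← Functor.map_comp_assoc, h, Functor.map_comp_assoc, Functor.map_comp_assoc,
    reassoc_of% h'', reassoc_of% h', ← γ.naturality_left, ← Z.compAct_proj]
  simp only [F.map_comp, NatTrans.comp_app, Category.assoc]

/-- The natural endomorphism of `a ↦ F (base, cobase · a)` which is the idempotent splitting to
the functor `P ⥤ X` induced by the balanced functor `F`. -/
def idem : Z.ret ⋙ F.obj Z.base ⟶ Z.ret ⋙ F.obj Z.base where
  app a := (F.obj Z.base).map (Z.ret.map (Z.coinc a)) ≫ Z.lower γ Z.base (Z.ret.obj a)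
  naturality a a' f := by
    simp only [Functor.comp_obj, Functor.comp_map, Category.assoc]
    rw [← Z.lower_naturality_right γ Z.base (Z.ret.map f)]
    simp only [← Functor.map_comp_assoc, ← Functor.map_comp, Z.coinc_naturality]

/-- On objects of the form `T (m, n)` the idempotent is split by `F (m, n)`. -/
lemma idem_app (m : M) (n : N) :
    (Z.idem γ).app ((T.obj m).obj n) = Z.lower γ m n ≫ Z.upper γ m n := by
  simp only [idem, ← Z.inc_coinc, Functor.map_comp, Category.assoc]
  rw [Z.lower_naturality_right, reassoc_of% Z.lower_balanced γ,
    reassoc_of% Z.lower_naturality_left γ, upper]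

lemma idem_idem : Z.idem γ ≫ Z.idem γ = Z.idem γ := by
  ext a
  -- The claim holds on `T (base, cobase · a)`, of which `a` is a retract.
  have h := (Z.idem γ).naturality (Z.coinc a)
  have : IsSplitMono ((Z.ret ⋙ F.obj Z.base).map (Z.coinc a)) :=
    ⟨⟨(Z.ret ⋙ F.obj Z.base).map (Z.coproj a),
      by rw [← Functor.map_comp, Z.coinc_coproj, CategoryTheory.Functor.map_id]⟩⟩
  rw [← cancel_mono ((Z.ret ⋙ F.obj Z.base).map (Z.coinc a)), NatTrans.comp_app, Category.assoc,
    ← h, ← Category.assoc, ← h, Category.assoc, Z.idem_app, Category.assoc,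
    reassoc_of% Z.upper_lower γ]

lemma existsUnique_natTrans (Z : TensorContext T β) (G G' : P ⥤ X)
    (θ : T ⋙ (Functor.whiskeringRight N P X).obj G ⟶ T ⋙ (Functor.whiskeringRight N P X).obj G')
    (hθ : ∀ (m : M) (b : B) (n : N),
      G.map (β.iso m b n).hom ≫ (θ.app m).app (b ⊙ₗ n) =
        (θ.app (m ⊙ᵣ b)).app n ≫ G'.map (β.iso m b n).hom) :
    ∃! η : G ⟶ G', ∀ (m : M) (n : N), η.app ((T.obj m).obj n) = (θ.app m).app n := by
  have nat_right (m : M) {n n' : N} (f : n ⟶ n') :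
      G.map ((T.obj m).map f) ≫ (θ.app m).app n' = (θ.app m).app n ≫ G'.map ((T.obj m).map f) :=
    (θ.app m).naturality f
  have nat_left {m m' : M} (f : m ⟶ m') (n : N) :
      G.map ((T.map f).app n) ≫ (θ.app m').app n = (θ.app m).app n ≫ G'.map ((T.map f).app n) :=
    congrArg (fun t => NatTrans.app t n) (θ.naturality f)
  refine ⟨{ app := fun a => G.map (Z.coinc a) ≫ (θ.app Z.base).app (Z.ret.obj a) ≫
      G'.map (Z.coproj a), naturality := fun a a' f => ?_ }, fun m n => ?_, fun η hη => ?_⟩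
  · rw [← G.map_comp_assoc, Z.coinc_naturality, G.map_comp_assoc, reassoc_of% nat_right,
      ← G'.map_comp, Z.coproj_naturality, G'.map_comp, Category.assoc, Category.assoc]
  · dsimp only
    rw [← Z.inc_coinc, G.map_comp_assoc, G.map_comp_assoc, reassoc_of% nat_right, reassoc_of% hθ,
      reassoc_of% nat_left, ← G'.map_comp, ← G'.map_comp, ← G'.map_comp]
    have := Z.inc_coinc m n
    simp only [reassoc_of% this, Z.coinc_coproj, G'.map_id]
    exact Category.comp_id _
  · ext a
    dsimp only
    rw [← hη, η.naturality_assoc, ← G'.map_comp, Z.coinc_coproj, G'.map_id, Category.comp_id]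

variable [Preadditive M] [Linear ℂ M] [Preadditive N] [Linear ℂ N] [Preadditive P] [Linear ℂ P]
  [IsFiniteSemisimple P] [Preadditive X] [Linear ℂ X]

lemma exists_lift (Z : TensorContext T β) (γ : Balancing B F) [Z.ret.Additive] [Z.ret.Linear ℂ]
    [HasFiniteColimits X] (hF : IsRexBilinear F) :
    ∃ G : P ⥤ X, G.Additive ∧ G.Linear ℂ ∧ PreservesFiniteColimits G ∧
      ∃ e : T ⋙ (Functor.whiskeringRight N P X).obj G ≅ F, ∀ (m : M) (b : B) (n : N),
        G.map (β.iso m b n).hom ≫ (e.hom.app m).app (b ⊙ₗ n) =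
          (e.hom.app (m ⊙ᵣ b)).app n ≫ (γ.iso m b n).hom := by
  have := isIdempotentComplete_of_hasFiniteColimits X
  obtain ⟨G, u, v, huv, hvu⟩ := exists_splitting (Z.idem_idem γ)
  have huv' (a : P) : u.app a ≫ v.app a = 𝟙 _ := by rw [← NatTrans.comp_app, huv, NatTrans.id_app]
  have hvu' (a : P) : v.app a ≫ u.app a = (Z.idem γ).app a := by rw [← NatTrans.comp_app, hvu]
  have := hF.additive_right Z.base
  have := hF.linear_right Z.base
  have hmap {a a' : P} (f : a ⟶ a') :
      G.map f = u.app a ≫ (F.obj Z.base).map (Z.ret.map f) ≫ v.app a' := by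
    have := u.naturality f
    simp only [Functor.comp_map] at this
    rw [← reassoc_of% this, huv', Category.comp_id]
  have hadd : G.Additive := ⟨fun {a a' f g} => by simp [hmap, Functor.map_add]⟩
  have hlin : G.Linear ℂ := ⟨fun f r => by simp [hmap]⟩
  refine ⟨G, hadd, hlin, preservesFiniteColimits_of_isFiniteSemisimple G, ?_⟩
  let e (m : M) (n : N) : G.obj ((T.obj m).obj n) ≅ (F.obj m).obj n :=
    { hom := u.app _ ≫ Z.lower γ m n
      inv := Z.upper γ m n ≫ v.app _
      hom_inv_id := by
        rw [Category.assoc, ← reassoc_of% Z.idem_app γ m n, ← hvu', Category.assoc, huv',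
          Category.comp_id, huv']
      inv_hom_id := by
        rw [Category.assoc, reassoc_of% hvu', Z.idem_app, Category.assoc, Z.upper_lower,
          Category.comp_id, Z.upper_lower] }
  refine ⟨NatIso.ofComponents (fun m => NatIso.ofComponents (fun n => e m n) ?_) ?_, ?_⟩
  · intro n n' f
    have := u.naturality ((T.obj m).map f)
    simp only [Functor.comp_map] at this
    simp [e, reassoc_of% this, Z.lower_naturality_right γ]
  · intro m m' f
    ext n
    have := u.naturality ((T.map f).app n)
    simp only [Functor.comp_map] at this
    simp [e, reassoc_of% this, Z.lower_naturality_left γ]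
  · intro m b n
    have := u.naturality (β.iso m b n).hom
    simp only [Functor.comp_map] at this
    simp [e, reassoc_of% this, Z.lower_balanced γ]

/-- The functor `T` of a `TensorContext` is a relative tensor product. -/
theorem isRelativeTensor [Z.ret.Additive] [Z.ret.Linear ℂ] (hT : IsRexBilinear T) :
    IsRelativeTensor.{w', w} T β where
  isRexBilinear := hT
  exists_lift _ _ _ _ _ _ γ hF := Z.exists_lift γ hF
  existsUnique_natTrans _ _ _ _ _ G G' _ _ _ _ _ _ θ hθ := Z.existsUnique_natTrans G G' θ hθ

end TensorContext

end Recognition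

/-! ### Rows, columns and corners as finite semisimple categories -/

section EndomorphismsOfIdentity

/-- If the objects in `Q` are those on which certain natural endomorphisms of the identity functor
are trivial, then `Q` is closed under direct summands and limits, so that it inherits finite
semisimplicity. -/
theorem isFiniteSemisimple_of_endomorphisms {C : Type u} [Category.{v} C] [Preadditive C]
    [Linear ℂ C] [IsFiniteSemisimple C] (Q : ObjectProperty C) {I : Type} (E : I → (𝟭 C ⟶ 𝟭 C))
    (hQ : ∀ x, Q x ↔ ∀ i, (E i).app x = 𝟙 x) : IsFiniteSemisimple Q.FullSubcategory := by
  have : Q.IsClosedUnderFiniteProducts := ⟨fun J _ => ⟨fun X ⟨h⟩ => (hQ X).2 fun i =>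
    h.isLimit.hom_ext fun j => by
      have h₁ := (E i).naturality (h.π.app j)
      have h₂ := (hQ _).1 (h.prop_diag_obj j) i
      simp only [Functor.id_map] at h₁
      exact (h₁.symm.trans (by rw [h₂]; exact Category.comp_id _)).trans (Category.id_comp _).symm⟩⟩
  refine isFiniteSemisimple_fullSubcategory Q fun {X Y} ρ hY => (hQ X).2 fun i => ?_
  have h₁ := (E i).naturality ρ.i
  have h₂ := (hQ _).1 hY i
  simp only [Functor.id_map, h₂] at h₁
  have : Mono ρ.i := (⟨⟨⟨ρ.r, ρ.retract⟩⟩⟩ : IsSplitMono ρ.i).mono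
  rw [← cancel_mono ρ.i]
  exact h₁.symm.trans ((Category.comp_id _).trans (Category.id_comp _).symm)

end EndomorphismsOfIdentity

section Idempotent

variable {Φ : Type u} [Category.{v} Φ] [MonoidalCategory Φ] {p : Φ} (P : Retract p (𝟙_ Φ))

lemma rowProperty_iff (x : Φ) : rowProperty P x ↔ (P.r ≫ P.i) ▷ x = 𝟙 _ := by
  have h : P.i ▷ x ≫ P.r ▷ x = 𝟙 _ := by
    rw [← comp_whiskerRight, P.retract, id_whiskerRight]
  rw [comp_whiskerRight]
  refine ⟨fun hx => ?_, fun hx => ⟨P.r ▷ x, h, hx⟩⟩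
  have : IsIso (P.i ▷ x) := hx
  rw [← cancel_epi (P.i ▷ x), reassoc_of% h, Category.comp_id]

lemma colProperty_iff (x : Φ) : colProperty P x ↔ x ◁ (P.r ≫ P.i) = 𝟙 _ := by
  have h : x ◁ P.i ≫ x ◁ P.r = 𝟙 _ := by
    rw [← whiskerLeft_comp, P.retract, whiskerLeft_id]
  rw [whiskerLeft_comp]
  refine ⟨fun hx => ?_, fun hx => ⟨x ◁ P.r, h, hx⟩⟩
  have : IsIso (x ◁ P.i) := hx
  rw [← cancel_epi (x ◁ P.i), reassoc_of% h, Category.comp_id]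

/-- The left action of an endomorphism of the unit on all objects. -/
def unitEndLeft (e : 𝟙_ Φ ⟶ 𝟙_ Φ) : 𝟭 Φ ⟶ 𝟭 Φ where
  app x := (λ_ x).inv ≫ e ▷ x ≫ (λ_ x).hom
  naturality x y f := by
    change f ≫ (λ_ y).inv ≫ e ▷ y ≫ (λ_ y).hom = ((λ_ x).inv ≫ e ▷ x ≫ (λ_ x).hom) ≫ f
    rw [Category.assoc, Category.assoc, leftUnitor_inv_naturality_assoc,
      whisker_exchange_assoc, leftUnitor_naturality]

/-- The right action of an endomorphism of the unit on all objects. -/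
def unitEndRight (e : 𝟙_ Φ ⟶ 𝟙_ Φ) : 𝟭 Φ ⟶ 𝟭 Φ where
  app x := (ρ_ x).inv ≫ x ◁ e ≫ (ρ_ x).hom
  naturality x y f := by
    change f ≫ (ρ_ y).inv ≫ y ◁ e ≫ (ρ_ y).hom = ((ρ_ x).inv ≫ x ◁ e ≫ (ρ_ x).hom) ≫ f
    rw [Category.assoc, Category.assoc, rightUnitor_inv_naturality_assoc,
      ← whisker_exchange_assoc, rightUnitor_naturality]

lemma unitEndLeft_app_eq_id_iff (e : 𝟙_ Φ ⟶ 𝟙_ Φ) (x : Φ) :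
    (unitEndLeft e).app x = 𝟙 x ↔ e ▷ x = 𝟙 _ := by
  change (λ_ x).inv ≫ e ▷ x ≫ (λ_ x).hom = 𝟙 x ↔ _
  rw [Iso.inv_comp_eq, Category.comp_id, ← Iso.eq_comp_inv, Iso.hom_inv_id]

lemma unitEndRight_app_eq_id_iff (e : 𝟙_ Φ ⟶ 𝟙_ Φ) (x : Φ) :
    (unitEndRight e).app x = 𝟙 x ↔ x ◁ e = 𝟙 _ := by
  change (ρ_ x).inv ≫ x ◁ e ≫ (ρ_ x).hom = 𝟙 x ↔ _
  rw [Iso.inv_comp_eq, Category.comp_id, ← Iso.eq_comp_inv, Iso.hom_inv_id]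

variable [Preadditive Φ] [Linear ℂ Φ] [IsFiniteSemisimple Φ]

instance isFiniteSemisimple_row : IsFiniteSemisimple (Row P) :=
  isFiniteSemisimple_of_endomorphisms _ (fun _ : Unit => unitEndLeft (P.r ≫ P.i)) fun x => by
    simp only [unitEndLeft_app_eq_id_iff, rowProperty_iff, forall_const]

instance isFiniteSemisimple_col : IsFiniteSemisimple (Col P) :=
  isFiniteSemisimple_of_endomorphisms _ (fun _ : Unit => unitEndRight (P.r ≫ P.i)) fun x => by
    simp only [unitEndRight_app_eq_id_iff, colProperty_iff, forall_const]

instance isFiniteSemisimple_corner : IsFiniteSemisimple (Corner P) :=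
  isFiniteSemisimple_of_endomorphisms _
    (fun b : Bool => if b then unitEndLeft (P.r ≫ P.i) else unitEndRight (P.r ≫ P.i)) fun x => by
      rw [Bool.forall_bool]
      simp only [Bool.false_eq_true, if_false, if_true, unitEndLeft_app_eq_id_iff,
        unitEndRight_app_eq_id_iff, ← rowProperty_iff, ← colProperty_iff]
      exact and_comm

instance simple_corner_unit [Simple p] : Simple (𝟙_ (Corner P)) :=
  have : Simple (𝟙_ (Corner P)).obj := ‹Simple p›
  simple_fullSubcategory _ _

end Idempotent

/-! ### Duals in a corner -/

section Duals

variable {Φ : Type u} [Category.{v} Φ] [MonoidalCategory Φ]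

lemma comp_unitEnd_of_whiskerLeft {x y : Φ} {e : 𝟙_ Φ ⟶ 𝟙_ Φ} (h : x ◁ e = 𝟙 _)
    (f : y ⊗ x ⟶ 𝟙_ Φ) : f ≫ e = f := by
  have h' : (y ⊗ x) ◁ e = 𝟙 _ := by simp [h]
  have h₁ : (ρ_ (y ⊗ x)).hom ≫ f ≫ e = (y ⊗ x) ◁ e ≫ f ▷ 𝟙_ Φ ≫ (ρ_ _).hom := by
    rw [whisker_exchange_assoc]; simp [unitors_equal, unitors_inv_equal]
  rw [← cancel_epi (ρ_ (y ⊗ x)).hom, h₁, h']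
  simp

lemma comp_unitEnd_of_whiskerRight {x y : Φ} {e : 𝟙_ Φ ⟶ 𝟙_ Φ} (h : e ▷ x = 𝟙 _)
    (f : x ⊗ y ⟶ 𝟙_ Φ) : f ≫ e = f := by
  have h' : e ▷ (x ⊗ y) = 𝟙 _ := by simp [h]
  have h₁ : (λ_ (x ⊗ y)).hom ≫ f ≫ e = e ▷ (x ⊗ y) ≫ 𝟙_ Φ ◁ f ≫ (λ_ _).hom := by
    rw [← whisker_exchange_assoc]; simp [unitors_equal, unitors_inv_equal]
  rw [← cancel_epi (λ_ (x ⊗ y)).hom, h₁, h']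
  simp

lemma unitEnd_comp_of_whiskerRight {x y : Φ} {e : 𝟙_ Φ ⟶ 𝟙_ Φ} (h : e ▷ x = 𝟙 _)
    (f : 𝟙_ Φ ⟶ x ⊗ y) : e ≫ f = f := by
  have h' : e ▷ (x ⊗ y) = 𝟙 _ := by simp [h]
  have h₁ : (e ≫ f) ≫ (λ_ (x ⊗ y)).inv = (λ_ _).inv ≫ 𝟙_ Φ ◁ f ≫ e ▷ (x ⊗ y) := by
    rw [whisker_exchange]; simp [unitors_equal, unitors_inv_equal]
  rw [← cancel_mono (λ_ (x ⊗ y)).inv, h₁, h']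
  simp

lemma unitEnd_comp_of_whiskerLeft {x y : Φ} {e : 𝟙_ Φ ⟶ 𝟙_ Φ} (h : x ◁ e = 𝟙 _)
    (f : 𝟙_ Φ ⟶ y ⊗ x) : e ≫ f = f := by
  have h' : (y ⊗ x) ◁ e = 𝟙 _ := by simp [h]
  have h₁ : (e ≫ f) ≫ (ρ_ (y ⊗ x)).inv = (ρ_ _).inv ≫ f ▷ 𝟙_ Φ ≫ (y ⊗ x) ◁ e := by
    rw [← whisker_exchange]; simp [unitors_equal, unitors_inv_equal]
  rw [← cancel_mono (ρ_ (y ⊗ x)).inv, h₁, h']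
  simp

variable {x y : Φ} [ExactPairing x y] {e : 𝟙_ Φ ⟶ 𝟙_ Φ}

lemma whiskerRight_right_of_whiskerLeft_left (h : x ◁ e = 𝟙 _) : e ▷ y = 𝟙 _ := by
  have := ExactPairing.coevaluation_evaluation x y
  rw [← comp_unitEnd_of_whiskerLeft h (ε_ x y), comp_whiskerRight,
    ExactPairing.coevaluation_evaluation_assoc] at this
  rw [← cancel_epi ((ρ_ y).hom ≫ (λ_ y).inv), Category.assoc, this, Category.comp_id]

lemma whiskerLeft_right_of_whiskerRight_left (h : e ▷ x = 𝟙 _) : y ◁ e = 𝟙 _ := by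
  have := ExactPairing.coevaluation_evaluation x y
  rw [← unitEnd_comp_of_whiskerRight h (η_ x y), whiskerLeft_comp, Category.assoc,
    ExactPairing.coevaluation_evaluation] at this
  rw [← cancel_mono ((ρ_ y).hom ≫ (λ_ y).inv), this, Category.id_comp]

lemma whiskerLeft_left_of_whiskerRight_right (h : e ▷ y = 𝟙 _) : x ◁ e = 𝟙 _ := by
  have := ExactPairing.evaluation_coevaluation x y
  rw [← comp_unitEnd_of_whiskerRight h (ε_ x y), whiskerLeft_comp,
    ExactPairing.evaluation_coevaluation_assoc] at this
  rw [← cancel_epi ((λ_ x).hom ≫ (ρ_ x).inv), Category.assoc, this, Category.comp_id]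

lemma whiskerRight_left_of_whiskerLeft_right (h : y ◁ e = 𝟙 _) : e ▷ x = 𝟙 _ := by
  have := ExactPairing.evaluation_coevaluation x y
  rw [← unitEnd_comp_of_whiskerLeft h (η_ x y), comp_whiskerRight, Category.assoc,
    ExactPairing.evaluation_coevaluation] at this
  rw [← cancel_mono ((λ_ x).hom ≫ (ρ_ x).inv), this, Category.id_comp]

variable {p : Φ} (P : Retract p (𝟙_ Φ))

/-- An exact pairing in `Φ` between objects of the corner is one in the corner. -/
abbrev cornerExactPairing (x y : Corner P) [ExactPairing x.obj y.obj] : ExactPairing x y where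
  coevaluation' := ObjectProperty.homMk (P.i ≫ η_ x.obj y.obj)
  evaluation' := ObjectProperty.homMk (ε_ x.obj y.obj ≫ P.r)
  coevaluation_evaluation' := by
    ext
    change y.obj ◁ (P.i ≫ η_ x.obj y.obj) ≫ (α_ _ _ _).inv ≫ (ε_ x.obj y.obj ≫ P.r) ▷ y.obj =
      (colUnitor P y.obj).hom ≫ (rowUnitor P y.obj).inv
    have h : ε_ x.obj y.obj ≫ P.r ≫ P.i = ε_ x.obj y.obj :=
      comp_unitEnd_of_whiskerRight ((rowProperty_iff P _).1 y.property.1) _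
    rw [Iso.eq_comp_inv]
    simp only [rowUnitor_hom, colUnitor_hom, Category.assoc, ← comp_whiskerRight_assoc, h,
      whiskerLeft_comp, ExactPairing.coevaluation_evaluation_assoc, Iso.inv_hom_id,
      Category.comp_id]
  evaluation_coevaluation' := by
    ext
    change (P.i ≫ η_ x.obj y.obj) ▷ x.obj ≫ (α_ _ _ _).hom ≫ x.obj ◁ (ε_ x.obj y.obj ≫ P.r) =
      (rowUnitor P x.obj).hom ≫ (colUnitor P x.obj).inv
    have h : ε_ x.obj y.obj ≫ P.r ≫ P.i = ε_ x.obj y.obj :=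
      comp_unitEnd_of_whiskerLeft ((colProperty_iff P _).1 x.property.2) _
    rw [Iso.eq_comp_inv]
    simp only [rowUnitor_hom, colUnitor_hom, Category.assoc, ← whiskerLeft_comp_assoc, h,
      comp_whiskerRight, ExactPairing.evaluation_coevaluation_assoc, Iso.inv_hom_id,
      Category.comp_id]

instance isFusion_corner [Preadditive Φ] [Linear ℂ Φ] [MonoidalPreadditive Φ] [MonoidalLinear ℂ Φ]
    [IsFusion Φ] : IsFusion (Corner P) where
  hasLeftDual x := by
    obtain ⟨y, hy⟩ := (IsFusion.hasLeftDual x.obj).some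
    have h := x.property
    change rowProperty P _ ∧ colProperty P _ at h
    rw [rowProperty_iff, colProperty_iff] at h
    have hy' : cornerProperty P y := by
      change rowProperty P _ ∧ colProperty P _
      rw [rowProperty_iff, colProperty_iff]
      exact ⟨whiskerRight_left_of_whiskerLeft_right h.2, whiskerLeft_left_of_whiskerRight_right h.1⟩
    have := cornerExactPairing P ⟨y, hy'⟩ x
    exact ⟨⟨⟨y, hy'⟩⟩⟩
  hasRightDual x := by
    obtain ⟨y, hy⟩ := (IsFusion.hasRightDual x.obj).some
    have h := x.property
    change rowProperty P _ ∧ colProperty P _ at h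
    rw [rowProperty_iff, colProperty_iff] at h
    have hy' : cornerProperty P y := by
      change rowProperty P _ ∧ colProperty P _
      rw [rowProperty_iff, colProperty_iff]
      exact ⟨whiskerRight_right_of_whiskerLeft_left h.2, whiskerLeft_right_of_whiskerRight_left h.1⟩
    have := cornerExactPairing P x ⟨y, hy'⟩
    exact ⟨⟨⟨y, hy'⟩⟩⟩

end Duals

/-! ### Bilinearity -/

section Bilinear

/-- On finite semisimple categories, right exactness of a bilinear functor is automatic. -/
lemma isRexBilinear_of_isFiniteSemisimple {M : Type u₁} {N : Type u₂} {X : Type u₃}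
    [Category.{v₁} M] [Category.{v₂} N] [Category.{v₃} X] [Preadditive M] [Preadditive N]
    [Preadditive X] [Linear ℂ M] [Linear ℂ N] [Linear ℂ X] [IsFiniteSemisimple M]
    [IsFiniteSemisimple N] [HasFiniteColimits X] {F : M ⥤ N ⥤ X}
    (map_add : ∀ (m : M) {n n' : N} (f g : n ⟶ n'),
      (F.obj m).map (f + g) = (F.obj m).map f + (F.obj m).map g)
    (map_smul : ∀ (m : M) {n n' : N} (c : ℂ) (f : n ⟶ n'),
      (F.obj m).map (c • f) = c • (F.obj m).map f)
    (add_map : ∀ {m m' : M} (f g : m ⟶ m') (n : N),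
      (F.map (f + g)).app n = (F.map f).app n + (F.map g).app n)
    (smul_map : ∀ {m m' : M} (c : ℂ) (f : m ⟶ m') (n : N),
      (F.map (c • f)).app n = c • (F.map f).app n) : IsRexBilinear F := by
  have h₁ (m : M) : (F.obj m).Additive := ⟨fun {_ _ f g} => map_add m f g⟩
  have h₂ (n : N) : (F.flip.obj n).Additive := ⟨fun {_ _ f g} => add_map f g n⟩
  exact ⟨h₁, fun m => ⟨fun f c => map_smul m c f⟩,
    fun m => preservesFiniteColimits_of_isFiniteSemisimple _, h₂,
    fun n => ⟨fun f c => smul_map c f n⟩, fun n => preservesFiniteColimits_of_isFiniteSemisimple _⟩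

variable {Φ : Type u} [Category.{v} Φ] [MonoidalCategory Φ] [Preadditive Φ] [Linear ℂ Φ]
  [MonoidalPreadditive Φ] [MonoidalLinear ℂ Φ] [IsFiniteSemisimple Φ] {p : Φ}
  (P : Retract p (𝟙_ Φ))

lemma isFiniteSemisimpleBimodule_row :
    IsFiniteSemisimpleBimodule (Corner P) Φ (Row P) where
  finiteSemisimple := inferInstance
  left := isRexBilinear_of_isFiniteSemisimple
    (fun _ _ _ _ _ => by ext; exact MonoidalPreadditive.whiskerLeft_add _ _)
    (fun _ _ _ _ _ => by ext; exact MonoidalLinear.whiskerLeft_smul _ _ _)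
    (fun _ _ _ => by ext; exact MonoidalPreadditive.add_whiskerRight _ _)
    (fun _ _ _ => by ext; exact MonoidalLinear.smul_whiskerRight _ _ _)
  right := isRexBilinear_of_isFiniteSemisimple
    (fun _ _ _ _ _ => by ext; exact MonoidalPreadditive.add_whiskerRight _ _)
    (fun _ _ _ _ _ => by ext; exact MonoidalLinear.smul_whiskerRight _ _ _)
    (fun _ _ _ => by ext; exact MonoidalPreadditive.whiskerLeft_add _ _)
    (fun _ _ _ => by ext; exact MonoidalLinear.whiskerLeft_smul _ _ _)

lemma isFiniteSemisimpleBimodule_col :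
    IsFiniteSemisimpleBimodule Φ (Corner P) (Col P) where
  finiteSemisimple := inferInstance
  left := isRexBilinear_of_isFiniteSemisimple
    (fun _ _ _ _ _ => by ext; exact MonoidalPreadditive.whiskerLeft_add _ _)
    (fun _ _ _ _ _ => by ext; exact MonoidalLinear.whiskerLeft_smul _ _ _)
    (fun _ _ _ => by ext; exact MonoidalPreadditive.add_whiskerRight _ _)
    (fun _ _ _ => by ext; exact MonoidalLinear.smul_whiskerRight _ _ _)
  right := isRexBilinear_of_isFiniteSemisimple
    (fun _ _ _ _ _ => by ext; exact MonoidalPreadditive.add_whiskerRight _ _)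
    (fun _ _ _ _ _ => by ext; exact MonoidalLinear.smul_whiskerRight _ _ _)
    (fun _ _ _ => by ext; exact MonoidalPreadditive.whiskerLeft_add _ _)
    (fun _ _ _ => by ext; exact MonoidalLinear.whiskerLeft_smul _ _ _)

lemma isRexBilinear_rowColMul : IsRexBilinear (rowColMul P) :=
  isRexBilinear_of_isFiniteSemisimple
    (fun _ _ _ _ _ => by ext; exact MonoidalPreadditive.whiskerLeft_add _ _)
    (fun _ _ _ _ _ => by ext; exact MonoidalLinear.whiskerLeft_smul _ _ _)
    (fun _ _ _ => by ext; exact MonoidalPreadditive.add_whiskerRight _ _)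
    (fun _ _ _ => by ext; exact MonoidalLinear.smul_whiskerRight _ _ _)

lemma isRexBilinear_colRowMul : IsRexBilinear (colRowMul P) :=
  isRexBilinear_of_isFiniteSemisimple
    (fun _ _ _ _ _ => MonoidalPreadditive.whiskerLeft_add _ _)
    (fun _ _ _ _ _ => MonoidalLinear.whiskerLeft_smul _ _ _)
    (fun _ _ _ => MonoidalPreadditive.add_whiskerRight _ _)
    (fun _ _ _ => MonoidalLinear.smul_whiskerRight _ _ _)

end Bilinear

/-! ### The row and the column of a summand of the unit -/

section Contraction

variable {Φ : Type u} [Category.{v} Φ] [MonoidalCategory Φ] {x y : Φ}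

/-- The map `a ⟶ x ⊗ (y ⊗ a)` induced by `s : 𝟙 ⟶ x ⊗ y`. -/
def insertion (s : 𝟙_ Φ ⟶ x ⊗ y) (a : Φ) : a ⟶ x ⊗ (y ⊗ a) :=
  (λ_ a).inv ≫ s ▷ a ≫ (α_ x y a).hom

/-- The map `x ⊗ (y ⊗ a) ⟶ a` induced by `r : x ⊗ y ⟶ 𝟙`. -/
def contraction (r : x ⊗ y ⟶ 𝟙_ Φ) (a : Φ) : x ⊗ (y ⊗ a) ⟶ a :=
  (α_ x y a).inv ≫ r ▷ a ≫ (λ_ a).hom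

variable (s : 𝟙_ Φ ⟶ x ⊗ y) (r : x ⊗ y ⟶ 𝟙_ Φ)

lemma insertion_naturality {a b : Φ} (f : a ⟶ b) :
    f ≫ insertion s b = insertion s a ≫ x ◁ (y ◁ f) := by
  simp only [insertion, Category.assoc]
  rw [leftUnitor_inv_naturality_assoc, whisker_exchange_assoc, tensor_whiskerLeft]
  simp

lemma contraction_naturality {a b : Φ} (f : a ⟶ b) :
    x ◁ (y ◁ f) ≫ contraction r b = contraction r a ≫ f := by
  simp only [contraction, Category.assoc]
  rw [← leftUnitor_naturality, ← whisker_exchange_assoc, tensor_whiskerLeft]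
  simp

lemma insertion_contraction {a : Φ} (h : (s ≫ r) ▷ a = 𝟙 _) :
    insertion s a ≫ contraction r a = 𝟙 a := by
  simp only [insertion, contraction, Category.assoc, Iso.hom_inv_id_assoc]
  rw [← comp_whiskerRight_assoc, h]
  simp

lemma insertion_tensor (a b : Φ) :
    insertion s a ▷ b ≫ (α_ x (y ⊗ a) b).hom ≫ x ◁ (α_ y a b).hom = insertion s (a ⊗ b) := by
  simp [insertion]

lemma contraction_tensor (a b : Φ) :
    x ◁ (α_ y a b).inv ≫ (α_ x (y ⊗ a) b).inv ≫ contraction r a ▷ b = contraction r (a ⊗ b) := by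
  simp [contraction]

end Contraction

section RowColumn

variable {Φ : Type u} [Category.{v} Φ] [MonoidalCategory Φ] {p : Φ} (P : Retract p (𝟙_ Φ))

/-- The inclusion of the corner `p·Φ·p` into the column `Φ·p`. -/
def cornerToCol : Corner P ⥤ Col P where
  obj c := ⟨c.obj, c.property.2⟩
  map f := ObjectProperty.homMk f.hom
  map_id _ := rfl
  map_comp _ _ := rfl

lemma rowUnitor_hom_tensor (x y : Φ) [IsIso (P.i ▷ x)] [IsIso (P.i ▷ (x ⊗ y))] :
    (α_ p x y).inv ≫ (rowUnitor P x).hom ▷ y = (rowUnitor P (x ⊗ y)).hom := by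
  simp

lemma rowUnitor_inv_tensor (x y : Φ) [IsIso (P.i ▷ x)] [IsIso (P.i ▷ (x ⊗ y))] :
    (rowUnitor P x).inv ▷ y ≫ (α_ p x y).hom = (rowUnitor P (x ⊗ y)).inv := by
  rw [← cancel_mono (rowUnitor P (x ⊗ y)).hom, Iso.inv_hom_id, ← rowUnitor_hom_tensor,
    Category.assoc, Iso.hom_inv_id_assoc, ← comp_whiskerRight, Iso.inv_hom_id, id_whiskerRight]

/-- For `x` in the row, `x ≅ p ⊗ x`, where `p` and `x` are objects of the row and of `Φ`. -/
def rowTensorContext : TensorContext (rowColMul P) (rowColBalancing P).toBalancing where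
  base := ⟨p, (summand_cornerProperty P).1⟩
  comp := (rowProperty P).ι
  ret := cornerToCol P
  assoc _ _ := Iso.refl _
  assoc_naturality_left f _ := (Category.comp_id _).trans (Category.id_comp _).symm
  assoc_naturality_right _ _ _ f := (Category.comp_id _).trans (Category.id_comp _).symm
  inc x := ObjectProperty.homMk (rowUnitor P x.obj).inv
  proj x := ObjectProperty.homMk (rowUnitor P x.obj).hom
  proj_naturality f := by ext; simp [whisker_exchange_assoc]
  inc_proj x := by ext; exact (rowUnitor P x.obj).inv_hom_id
  coinc c := ObjectProperty.homMk (rowUnitor P c.obj).inv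
  coproj c := ObjectProperty.homMk (rowUnitor P c.obj).hom
  coinc_naturality {a b} f := by
    ext
    change f.hom ≫ (rowUnitor P b.obj).inv = (rowUnitor P a.obj).inv ≫ p ◁ f.hom
    rw [Iso.comp_inv_eq, Category.assoc, Iso.eq_inv_comp]
    simp [whisker_exchange_assoc]
  coproj_naturality {a b} f := by
    ext
    change p ◁ f.hom ≫ (rowUnitor P b.obj).hom = (rowUnitor P a.obj).hom ≫ f.hom
    simp [whisker_exchange_assoc]
  coinc_coproj c := by ext; exact (rowUnitor P c.obj).inv_hom_id
  inc_coinc x y := by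
    ext
    have : IsIso (P.i ▷ (x.obj ⊗ y.obj)) := isIso_whiskerRight_tensor x.property y.obj
    change (rowUnitor P x.obj).inv ▷ y.obj ≫ (α_ p x.obj y.obj).hom ≫ p ◁ 𝟙 (x.obj ⊗ y.obj) =
      (rowUnitor P (x.obj ⊗ y.obj)).inv
    rw [whiskerLeft_id, Category.comp_id, rowUnitor_inv_tensor]
  compAct _ _ := 𝟙 _
  compAct_assoc x b y := by
    ext
    change 𝟙 (x.obj ⊗ b) ▷ y.obj ≫ (α_ x.obj b y.obj).hom ≫ 𝟙 _ = 𝟙 _ ≫ (α_ x.obj b y.obj).hom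
    simp
  compAct_proj x b := by
    ext
    have : IsIso (P.i ▷ (x.obj ⊗ b)) := isIso_whiskerRight_tensor x.property b
    change p ◁ 𝟙 (x.obj ⊗ b) ≫ (α_ p x.obj b).inv ≫ (rowUnitor P x.obj).hom ▷ b =
      (rowUnitor P (x.obj ⊗ b)).hom
    rw [whiskerLeft_id, Category.id_comp, rowUnitor_hom_tensor]

/-- The multiplication `p·Φ × Φ·p → p·Φ·p` is always a relative tensor product over `Φ`. -/
theorem isRelativeTensor_rowColMul [Preadditive Φ] [Linear ℂ Φ] [MonoidalPreadditive Φ]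
    [MonoidalLinear ℂ Φ] [IsFiniteSemisimple Φ] :
    IsRelativeTensor.{w', w} (rowColMul P) (rowColBalancing P).toBalancing :=
  have : (rowTensorContext P).ret.Additive := ⟨rfl⟩
  have : (rowTensorContext P).ret.Linear ℂ := ⟨fun _ _ => rfl⟩
  (rowTensorContext P).isRelativeTensor (isRexBilinear_rowColMul P)

variable {P} (x : Col P) (y : Row P) (s : 𝟙_ Φ ⟶ x.obj ⊗ y.obj) (r : x.obj ⊗ y.obj ⟶ 𝟙_ Φ)

/-- If the unit of `Φ` is a retract of `x ⊗ y`, with `x` in the column and `y` in the row, then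
every `m` in the column is a retract of `x ⊗ (y ⊗ m)`. -/
def colTensorContext (h : s ≫ r = 𝟙 _) :
    TensorContext (colRowMul P) (colRowBalancing P).toBalancing where
  base := x
  comp := (rowColMul P).obj y
  ret :=
    { obj a := y ⊙ᵣ a
      map f := y ⊴ᵣ f }
  assoc m n := ObjectProperty.isoMk _ (α_ y.obj m.obj n.obj)
  assoc_naturality_left f n := by ext; exact associator_naturality_middle y.obj f.hom n.obj
  assoc_naturality_right m _ _ f := by ext; exact associator_naturality_right y.obj m.obj f.hom
  inc m := ObjectProperty.homMk (insertion s m.obj)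
  proj m := ObjectProperty.homMk (contraction r m.obj)
  proj_naturality f := by ext; exact contraction_naturality r f.hom
  inc_proj m := by ext; exact insertion_contraction s r (by rw [h, id_whiskerRight])
  coinc a := insertion s a
  coproj a := contraction r a
  coinc_naturality f := insertion_naturality s f
  coproj_naturality f := contraction_naturality r f
  coinc_coproj a := insertion_contraction s r (by rw [h, id_whiskerRight])
  inc_coinc m n := insertion_tensor s m.obj n.obj
  compAct m b := ObjectProperty.homMk (α_ y.obj m.obj b.obj).inv
  compAct_assoc m b n := by
    ext
    change (α_ y.obj m.obj b.obj).inv ▷ n.obj ≫ (α_ (y.obj ⊗ m.obj) b.obj n.obj).hom ≫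
      (α_ y.obj m.obj (b.obj ⊗ n.obj)).hom =
        (α_ y.obj (m.obj ⊗ b.obj) n.obj).hom ≫ y.obj ◁ (α_ m.obj b.obj n.obj).hom
    simp
  compAct_proj m b := by ext; exact contraction_tensor r m.obj b.obj

/-- The multiplication `Φ·p × p·Φ → Φ` is a relative tensor product over the corner as soon as the
unit of `Φ` is a retract of a product. -/
theorem isRelativeTensor_colRowMul (h : s ≫ r = 𝟙 _) [Preadditive Φ] [Linear ℂ Φ]
    [MonoidalPreadditive Φ] [MonoidalLinear ℂ Φ] [IsFiniteSemisimple Φ] :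
    IsRelativeTensor.{w', w} (colRowMul P) (colRowBalancing P).toBalancing :=
  have : (colTensorContext x y s r h).ret.Additive :=
    ⟨by intros; ext; exact MonoidalPreadditive.whiskerLeft_add _ _⟩
  have : (colTensorContext x y s r h).ret.Linear ℂ :=
    ⟨by intros; ext; exact MonoidalLinear.whiskerLeft_smul _ _ _⟩
  (colTensorContext x y s r h).isRelativeTensor (isRexBilinear_colRowMul P)

end RowColumn

/-! ### Blocks of the decomposition of the unit -/

section UnitDecomposition

variable {Φ : Type u} [Category.{v} Φ] [Preadditive Φ] [MonoidalCategory Φ]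

lemma nonempty_unitDecomposition [Linear ℂ Φ] [IsFiniteSemisimple Φ] :
    Nonempty (UnitDecomposition Φ) := by
  obtain ⟨n, S, b, hS, ⟨hb⟩, ⟨e⟩⟩ := IsFiniteSemisimple.exists_simple_decomposition (𝟙_ Φ)
  refine ⟨⟨n, S, hS, fun i => b.ι i ≫ e.inv, fun i => e.hom ≫ b.π i, ?_, ?_, ?_⟩⟩
  · intro i
    simp
  · intro i j hij
    simp [b.ι_π, hij]
  · have := IsBilimit.total hb
    have h : ∑ i, (e.hom ≫ b.π i) ≫ b.ι i ≫ e.inv = e.hom ≫ (∑ i, b.π i ≫ b.ι i) ≫ e.inv := by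
      simp [Preadditive.sum_comp, Preadditive.comp_sum]
    rw [h, this, Category.id_comp, e.hom_inv_id]

namespace UnitDecomposition

variable (D : UnitDecomposition Φ)

instance (i : Fin D.n) : Simple (D.summand i) := D.simple i

/-- The entry `Φᵢⱼ` is nonzero if and only if some nonzero object lies both in the `i`-th row and
in the `j`-th column. -/
lemma entryNonzero_iff (i j : Fin D.n) : D.EntryNonzero i j ↔
    ∃ z, rowProperty (D.retract i) z ∧ colProperty (D.retract j) z ∧ ¬ IsZero z := by
  constructor
  · rintro ⟨x, hx⟩
    exact ⟨_, isIso_whiskerRight_tensor (summand_cornerProperty (D.retract i)).1 _,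
      isIso_tensor_whiskerLeft _ (isIso_tensor_whiskerLeft _
        (summand_cornerProperty (D.retract j)).2), hx⟩
  · rintro ⟨z, h₁, h₂, hz⟩
    refine ⟨z, fun h => hz ?_⟩
    have : IsIso ((D.retract i).i ▷ z) := h₁
    have : IsIso (z ◁ (D.retract j).i) := h₂
    exact h.of_iso ((rowUnitor (D.retract i) z).symm ≪≫
      whiskerLeftIso _ (colUnitor (D.retract j) z).symm)

lemma entryNonzero_refl (i : Fin D.n) : D.EntryNonzero i i :=
  (D.entryNonzero_iff i i).2 ⟨D.summand i, (summand_cornerProperty (D.retract i)).1,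
    (summand_cornerProperty (D.retract i)).2, Simple.not_isZero _⟩

end UnitDecomposition

end UnitDecomposition

section Blocks

variable {Φ : Type u} [Category.{v} Φ] [Preadditive Φ] [MonoidalCategory Φ] [MonoidalPreadditive Φ]

lemma isZero_tensor_left {x : Φ} (hx : IsZero x) (y : Φ) : IsZero (x ⊗ y) :=
  (tensorRight y).map_isZero hx

lemma isZero_tensor_right (x : Φ) {y : Φ} (hy : IsZero y) : IsZero (x ⊗ y) :=
  (tensorLeft x).map_isZero hy

lemma isZero_of_coevaluation_eq_zero {x y : Φ} [ExactPairing x y] (h : η_ x y = 0) :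
    IsZero x := by
  have := ExactPairing.evaluation_coevaluation x y
  rw [h, MonoidalPreadditive.zero_whiskerRight, zero_comp] at this
  rw [IsZero.iff_id_eq_zero, ← cancel_epi (λ_ x).hom, ← cancel_mono (ρ_ x).inv, Category.comp_id,
    ← this, comp_zero, zero_comp]

lemma isZero_left_of_isZero_right {x y : Φ} [ExactPairing x y] (hy : IsZero y) : IsZero x :=
  isZero_of_coevaluation_eq_zero ((isZero_tensor_right x hy).eq_of_tgt _ _)

lemma isZero_right_of_isZero_left {x y : Φ} [ExactPairing x y] (hx : IsZero x) : IsZero y := by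
  have := ExactPairing.coevaluation_evaluation x y
  rw [(isZero_tensor_left hx y).eq_of_tgt (η_ x y) 0, MonoidalPreadditive.whiskerLeft_zero,
    zero_comp] at this
  rw [IsZero.iff_id_eq_zero, ← cancel_epi (ρ_ y).hom, ← cancel_mono (λ_ y).inv, Category.comp_id,
    ← this, comp_zero, zero_comp]

/-- If `p` is a simple summand of the unit and `x` is a nonzero object of the row of `p` with dual
`y`, then the coevaluation exhibits `p` as a direct summand of `x ⊗ y`. -/
lemma exists_retract_tensor_dual [Linear ℂ Φ] [IsFiniteSemisimple Φ] {p : Φ} [Simple p]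
    (P : Retract p (𝟙_ Φ)) {x y : Φ} [ExactPairing x y] (hx : rowProperty P x) (hx0 : ¬ IsZero x) :
    ∃ (s : p ⟶ x ⊗ y) (r : x ⊗ y ⟶ p), s ≫ r = 𝟙 p := by
  have h₀ : P.i ≫ η_ x y ≠ 0 := fun h => hx0 (isZero_of_coevaluation_eq_zero (y := y) (by
    rw [← unitEnd_comp_of_whiskerRight ((rowProperty_iff P x).1 hx) (η_ x y), Category.assoc, h,
      comp_zero]))
  have := (isVonNeumannRegular_of_isFiniteSemisimple Φ).hasKernels
  have := mono_of_nonzero_from_simple h₀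
  exact ⟨_, (isVonNeumannRegular_of_isFiniteSemisimple Φ).exists_retraction (P.i ≫ η_ x y)⟩

namespace UnitDecomposition

variable (D : UnitDecomposition Φ)

variable [Linear ℂ Φ] [MonoidalLinear ℂ Φ] [IsFusion Φ]

variable {D}

/-- Taking duals exchanges `Φᵢⱼ` and `Φⱼᵢ`. -/
lemma EntryNonzero.symm {i j : Fin D.n} (h : D.EntryNonzero i j) : D.EntryNonzero j i := by
  obtain ⟨z, h₁, h₂, hz⟩ := (D.entryNonzero_iff i j).1 h
  obtain ⟨y, hy⟩ := (IsFusion.hasRightDual z).some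
  rw [rowProperty_iff] at h₁
  rw [colProperty_iff] at h₂
  refine (D.entryNonzero_iff j i).2 ⟨y, ?_, ?_, fun h => hz (isZero_left_of_isZero_right h)⟩
  · rw [rowProperty_iff]
    exact whiskerRight_right_of_whiskerLeft_left h₂
  · rw [colProperty_iff]
    exact whiskerLeft_right_of_whiskerRight_left h₁

/-- The product of nonzero objects of `Φᵢⱼ` and `Φⱼₖ` is nonzero, because `pⱼ` is simple. -/
lemma EntryNonzero.trans {i j k : Fin D.n} (h : D.EntryNonzero i j) (h' : D.EntryNonzero j k) :
    D.EntryNonzero i k := by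
  obtain ⟨z, h₁, h₂, hz⟩ := (D.entryNonzero_iff i j).1 h
  obtain ⟨w, h₃, h₄, hw⟩ := (D.entryNonzero_iff j k).1 h'
  refine (D.entryNonzero_iff i k).2
    ⟨z ⊗ w, isIso_whiskerRight_tensor h₁ w, isIso_tensor_whiskerLeft z h₄, fun h₀ => hw ?_⟩
  obtain ⟨y, hy⟩ := (IsFusion.hasLeftDual z).some
  have hy' : rowProperty (D.retract j) y := by
    rw [colProperty_iff] at h₂
    rw [rowProperty_iff]
    exact whiskerRight_left_of_whiskerLeft_right h₂
  obtain ⟨s, r, hsr⟩ := exists_retract_tensor_dual (D.retract j) (x := y) (y := z) hy'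
    fun h => hz (isZero_right_of_isZero_left h)
  have h₅ : IsZero ((y ⊗ z) ⊗ w) := (isZero_tensor_right y h₀).of_iso (α_ y z w)
  have h₆ : IsZero (D.summand j ⊗ w) := by
    rw [IsZero.iff_id_eq_zero, ← id_whiskerRight, ← hsr, comp_whiskerRight,
      h₅.eq_of_tgt (s ▷ w) 0, zero_comp]
  have : IsIso ((D.retract j).i ▷ w) := h₃
  exact h₆.of_iso (rowUnitor (D.retract j) w).symm

variable (D)

lemma equivalence_entryNonzero : Equivalence D.EntryNonzero :=
  ⟨D.entryNonzero_refl, EntryNonzero.symm, EntryNonzero.trans⟩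

/-- If `Φⱼᵢ ≠ 0` for all `j` in `J`, then `⨁ pⱼ` is a direct summand of `x ⊗ y` for
`x = ⨁ zⱼ` in the `i`-th column and `y` the sum of the duals of the `zⱼ` in the `i`-th row, where
`zⱼ` is any nonzero object of `Φⱼᵢ`. -/
lemma exists_retract_of_entryNonzero (i : Fin D.n) (J : Finset (Fin D.n))
    (hJ : ∀ j ∈ J, D.EntryNonzero j i) :
    ∃ (x : Col (D.retract i)) (y : Row (D.retract i)) (s : 𝟙_ Φ ⟶ x.obj ⊗ y.obj)
      (r : x.obj ⊗ y.obj ⟶ 𝟙_ Φ), s ≫ r = ∑ j ∈ J, D.proj j ≫ D.inc j := by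
  have key (j : J) : ∃ (z : Col (D.retract i)) (z' : Row (D.retract i))
      (s : D.summand j ⟶ z.obj ⊗ z'.obj) (r : z.obj ⊗ z'.obj ⟶ D.summand j), s ≫ r = 𝟙 _ := by
    obtain ⟨z, h₁, h₂, hz⟩ := (D.entryNonzero_iff j i).1 (hJ j j.2)
    obtain ⟨y, hy⟩ := (IsFusion.hasRightDual z).some
    have hy' : rowProperty (D.retract i) y := by
      rw [colProperty_iff] at h₂
      rw [rowProperty_iff]
      exact whiskerRight_right_of_whiskerLeft_left h₂
    obtain ⟨s, r, hsr⟩ := exists_retract_tensor_dual (D.retract j) (x := z) (y := y) h₁ hz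
    exact ⟨⟨z, h₂⟩, ⟨y, hy'⟩, s, r, hsr⟩
  choose z z' s r hsr using key
  refine ⟨⨁ z, ⨁ z', ∑ j : J, D.proj j ≫ s j ≫ ((biproduct.ι z j).hom ⊗ₘ (biproduct.ι z' j).hom),
    ∑ j : J, ((biproduct.π z j).hom ⊗ₘ (biproduct.π z' j).hom) ≫ r j ≫ D.inc j, ?_⟩
  have h (j k : J) : ((biproduct.ι z j).hom ⊗ₘ (biproduct.ι z' j).hom) ≫
      ((biproduct.π z k).hom ⊗ₘ (biproduct.π z' k).hom) ≫ r k ≫ D.inc k =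
        if j = k then r j ≫ D.inc j else 0 := by
    rw [tensorHom_comp_tensorHom_assoc, ← ObjectProperty.FullSubcategory.comp_hom,
      ← ObjectProperty.FullSubcategory.comp_hom]
    split_ifs with hjk
    · subst hjk
      simp
    · rw [biproduct.ι_π_ne z hjk]
      change (0 ⊗ₘ _) ≫ _ = _
      simp
  simp only [Preadditive.sum_comp, Preadditive.comp_sum, Category.assoc, h]
  simp only [comp_ite, comp_zero, reassoc_of% hsr, Finset.sum_ite_eq', Finset.mem_univ, if_true]
  exact Finset.sum_coe_sort J fun j => D.proj j ≫ D.inc j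

/-- The blocks of `Φ` can be numbered, and a representative of each can be chosen. -/
lemma exists_blocks : ∃ (m : ℕ) (c : Fin D.n → Fin m) (rep : Fin m → Fin D.n),
    (∀ k, c (rep k) = k) ∧ ∀ i j, D.EntryNonzero i j ↔ c i = c j := by
  let S : Setoid (Fin D.n) := ⟨D.EntryNonzero, D.equivalence_entryNonzero⟩
  obtain ⟨m, ⟨E⟩⟩ := Finite.exists_equiv_fin (Quotient S)
  refine ⟨m, fun i => E ⟦i⟧, fun k => (E.symm k).out, fun k => by simp, fun i j => ?_⟩
  rw [E.apply_eq_iff_eq, Quotient.eq]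
  exact Iff.rfl

end UnitDecomposition

end Blocks

/-! ### The indecomposable case -/

section Indecomposable

variable {Φ : Type u} [Category.{v} Φ] [Preadditive Φ] [Linear ℂ Φ]
    [MonoidalCategory Φ] [MonoidalPreadditive Φ] [MonoidalLinear ℂ Φ] [IsFusion Φ]

theorem isMoritaEquivalence_row_col (D : UnitDecomposition Φ) (hD : D.IsIndecomposable)
    (i : Fin D.n) : IsMoritaEquivalence.{w', w}
      (rowColMul (D.retract i)) (rowColBalancing (D.retract i))
      (colRowMul (D.retract i)) (colRowBalancing (D.retract i)) := by
  have hJ (j : Fin D.n) : D.EntryNonzero j i :=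
    D.equivalence_entryNonzero.eqvGen_iff.1 (hD.2 j i)
  obtain ⟨x, y, s, r, h⟩ := D.exists_retract_of_entryNonzero i Finset.univ fun j _ => hJ j
  exact ⟨isFiniteSemisimpleBimodule_row _, isFiniteSemisimpleBimodule_col _,
    isRelativeTensor_rowColMul _, isRelativeTensor_colRowMul x y s r (h.trans D.sum_proj_inc)⟩

end Indecomposable

/-! ### Products of bimodule categories -/

section PiActions

-- For a product of monoidal categories acting on itself these actions agree definitionally with the
-- regular ones; the low priority lets instance search find the latter.

variable {K : Type w} {A : Type u₁} [Category.{v₁} A] [MonoidalCategory A]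
  {B : K → Type u₂} [∀ k, Category.{v₂} (B k)] [∀ k, MonoidalCategory (B k)]
  {C : K → Type u₃} [∀ k, Category.{v₃} (C k)]

open MonoidalLeftAction in
/-- A monoidal category acts diagonally on a product. -/
instance (priority := low) piLeftAction
    [∀ k, MonoidalLeftAction A (C k)] : MonoidalLeftAction A (∀ k, C k) where
  actionObj a x k := a ⊙ₗ x k
  actionHomLeft f x k := f ⊵ₗ x k
  actionHomRight a _ _ f k := a ⊴ₗ f k
  actionHom f g k := f ⊙ₗₘ g k
  actionAssocIso a b x := Pi.isoMk fun k => αₗ a b (x k)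
  actionUnitIso x := Pi.isoMk fun k => λₗ (x k)
  actionHom_def f g := funext fun k => actionHom_def f (g k)
  actionHomRight_id a x := funext fun k => actionHomRight_id a (x k)
  id_actionHomLeft a x := funext fun k => id_actionHomLeft a (x k)
  actionHom_comp f f' g g' := funext fun k => actionHom_comp f f' (g k) (g' k)
  actionAssocIso_hom_naturality f g h :=
    funext fun k => actionAssocIso_hom_naturality f g (h k)
  actionUnitIso_hom_naturality f := funext fun k => actionUnitIso_hom_naturality (f k)
  whiskerLeft_actionHomLeft a _ _ f x := funext fun k => whiskerLeft_actionHomLeft a f (x k)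
  whiskerRight_actionHomLeft a f x := funext fun k => whiskerRight_actionHomLeft a f (x k)
  associator_actionHom a b c x := funext fun k => associator_actionHom a b c (x k)
  leftUnitor_actionHom a x := funext fun k => leftUnitor_actionHom a (x k)
  rightUnitor_actionHom a x := funext fun k => rightUnitor_actionHom a (x k)

open MonoidalLeftAction in
/-- A product of monoidal categories acts componentwise. -/
instance (priority := low) piLeftActionPi [∀ k, MonoidalLeftAction (B k) (C k)] :
    MonoidalLeftAction (∀ k, B k) (∀ k, C k) where
  actionObj a x k := a k ⊙ₗ x k
  actionHomLeft f x k := f k ⊵ₗ x k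
  actionHomRight a _ _ f k := a k ⊴ₗ f k
  actionHom f g k := f k ⊙ₗₘ g k
  actionAssocIso a b x := Pi.isoMk fun k => αₗ (a k) (b k) (x k)
  actionUnitIso x := Pi.isoMk fun k => λₗ (x k)
  actionHom_def f g := funext fun k => actionHom_def (f k) (g k)
  actionHomRight_id a x := funext fun k => actionHomRight_id (a k) (x k)
  id_actionHomLeft a x := funext fun k => id_actionHomLeft (a k) (x k)
  actionHom_comp f f' g g' := funext fun k => actionHom_comp (f k) (f' k) (g k) (g' k)
  actionAssocIso_hom_naturality f g h :=
    funext fun k => actionAssocIso_hom_naturality (f k) (g k) (h k)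
  actionUnitIso_hom_naturality f := funext fun k => actionUnitIso_hom_naturality (f k)
  whiskerLeft_actionHomLeft a _ _ f x :=
    funext fun k => whiskerLeft_actionHomLeft (a k) (f k) (x k)
  whiskerRight_actionHomLeft a f x := funext fun k => whiskerRight_actionHomLeft (a k) (f k) (x k)
  associator_actionHom a b c x := funext fun k => associator_actionHom (a k) (b k) (c k) (x k)
  leftUnitor_actionHom a x := funext fun k => leftUnitor_actionHom (a k) (x k)
  rightUnitor_actionHom a x := funext fun k => rightUnitor_actionHom (a k) (x k)

open MonoidalRightAction in
/-- A monoidal category acts diagonally from the right on a product. -/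
instance (priority := low) piRightAction
    [∀ k, MonoidalRightAction A (C k)] : MonoidalRightAction A (∀ k, C k) where
  actionObj x a k := x k ⊙ᵣ a
  actionHomLeft f a k := f k ⊵ᵣ a
  actionHomRight x _ _ f k := x k ⊴ᵣ f
  actionHom f g k := f k ⊙ᵣₘ g
  actionAssocIso x a b := Pi.isoMk fun k => αᵣ (x k) a b
  actionUnitIso x := Pi.isoMk fun k => ρᵣ (x k)
  actionHom_def f g := funext fun k => actionHom_def (f k) g
  actionHomRight_id a x := funext fun k => actionHomRight_id a (x k)
  id_actionHomLeft a x := funext fun k => id_actionHomLeft a (x k)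
  actionHom_comp f f' g g' := funext fun k => actionHom_comp (f k) (f' k) g g'
  actionAssocIso_hom_naturality f g h :=
    funext fun k => actionAssocIso_hom_naturality (f k) g h
  actionUnitIso_hom_naturality f := funext fun k => actionUnitIso_hom_naturality (f k)
  actionHomRight_whiskerRight f a x := funext fun k => actionHomRight_whiskerRight f a (x k)
  whiskerRight_actionHomLeft a _ _ f x := funext fun k => whiskerRight_actionHomLeft a f (x k)
  actionHom_associator a b c x := funext fun k => actionHom_associator a b c (x k)
  actionHom_leftUnitor a x := funext fun k => actionHom_leftUnitor a (x k)
  actionHom_rightUnitor a x := funext fun k => actionHom_rightUnitor a (x k)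

open MonoidalRightAction in
/-- A product of monoidal categories acts componentwise from the right. -/
instance (priority := low) piRightActionPi [∀ k, MonoidalRightAction (B k) (C k)] :
    MonoidalRightAction (∀ k, B k) (∀ k, C k) where
  actionObj x a k := x k ⊙ᵣ a k
  actionHomLeft f a k := f k ⊵ᵣ a k
  actionHomRight x _ _ f k := x k ⊴ᵣ f k
  actionHom f g k := f k ⊙ᵣₘ g k
  actionAssocIso x a b := Pi.isoMk fun k => αᵣ (x k) (a k) (b k)
  actionUnitIso x := Pi.isoMk fun k => ρᵣ (x k)
  actionHom_def f g := funext fun k => actionHom_def (f k) (g k)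
  actionHomRight_id a x := funext fun k => actionHomRight_id (a k) (x k)
  id_actionHomLeft a x := funext fun k => id_actionHomLeft (a k) (x k)
  actionHom_comp f f' g g' := funext fun k => actionHom_comp (f k) (f' k) (g k) (g' k)
  actionAssocIso_hom_naturality f g h :=
    funext fun k => actionAssocIso_hom_naturality (f k) (g k) (h k)
  actionUnitIso_hom_naturality f := funext fun k => actionUnitIso_hom_naturality (f k)
  actionHomRight_whiskerRight f a x :=
    funext fun k => actionHomRight_whiskerRight (f k) (a k) (x k)
  whiskerRight_actionHomLeft a _ _ f x :=
    funext fun k => whiskerRight_actionHomLeft (a k) (f k) (x k)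
  actionHom_associator a b c x := funext fun k => actionHom_associator (a k) (b k) (c k) (x k)
  actionHom_leftUnitor a x := funext fun k => actionHom_leftUnitor (a k) (x k)
  actionHom_rightUnitor a x := funext fun k => actionHom_rightUnitor (a k) (x k)

open BimoduleCategory

/-- A product of `(Bₖ, A)`-bimodule categories is a `(∏ Bₖ, A)`-bimodule category. -/
instance piBimoduleLeftPi [∀ k, MonoidalLeftAction (B k) (C k)] [∀ k, MonoidalRightAction A (C k)]
    [∀ k, BimoduleCategory (B k) A (C k)] : BimoduleCategory (∀ k, B k) A (∀ k, C k) where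
  mid a x b := Pi.isoMk fun k => mid (a k) (x k) b
  mid_naturality_left f x b := funext fun k => mid_naturality_left (f k) (x k) b
  mid_naturality_middle a _ _ f b := funext fun k => mid_naturality_middle (a k) (f k) b
  mid_naturality_right a x _ _ f := funext fun k => mid_naturality_right (a k) (x k) f
  pentagon_left a a' x b := funext fun k => pentagon_left (a k) (a' k) (x k) b
  pentagon_right a x b b' := funext fun k => pentagon_right (a k) (x k) b b'
  triangle_left x b := funext fun k => triangle_left (x k) b
  triangle_right a x := funext fun k => triangle_right (a k) (x k)

/-- A product of `(A, Bₖ)`-bimodule categories is an `(A, ∏ Bₖ)`-bimodule category. -/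
instance piBimoduleRightPi [∀ k, MonoidalLeftAction A (C k)]
    [∀ k, MonoidalRightAction (B k) (C k)] [∀ k, BimoduleCategory A (B k) (C k)] :
    BimoduleCategory A (∀ k, B k) (∀ k, C k) where
  mid a x b := Pi.isoMk fun k => mid a (x k) (b k)
  mid_naturality_left f x b := funext fun k => mid_naturality_left f (x k) (b k)
  mid_naturality_middle a _ _ f b := funext fun k => mid_naturality_middle a (f k) (b k)
  mid_naturality_right a x _ _ f := funext fun k => mid_naturality_right a (x k) (f k)
  pentagon_left a a' x b := funext fun k => pentagon_left a a' (x k) (b k)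
  pentagon_right a x b b' := funext fun k => pentagon_right a (x k) (b k) (b' k)
  triangle_left x b := funext fun k => triangle_left (x k) (b k)
  triangle_right a x := funext fun k => triangle_right a (x k)

end PiActions

section PiRowCol

variable {Φ : Type u} [Category.{v} Φ] [MonoidalCategory Φ] {K : Type} {p : K → Φ}
  (P : ∀ k, Retract (p k) (𝟙_ Φ))

/-- The componentwise multiplication `∏ pₖ·Φ × ∏ Φ·pₖ → ∏ pₖ·Φ·pₖ`. -/
def piRowColMul : (∀ k, Row (P k)) ⥤ (∀ k, Col (P k)) ⥤ ∀ k, Corner (P k) where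
  obj x :=
    { obj y k := ((rowColMul (P k)).obj (x k)).obj (y k)
      map f k := ((rowColMul (P k)).obj (x k)).map (f k)
      map_id _ := funext fun _ => CategoryTheory.Functor.map_id _ _
      map_comp _ _ := funext fun _ => Functor.map_comp _ _ _ }
  map f :=
    { app y k := ((rowColMul (P k)).map (f k)).app (y k)
      naturality _ _ g := funext fun k => ((rowColMul (P k)).map (f k)).naturality (g k) }
  map_id x := NatTrans.ext (funext fun y => funext fun k =>
    NatTrans.congr_app ((rowColMul (P k)).map_id (x k)) (y k))
  map_comp f g := NatTrans.ext (funext fun y => funext fun k =>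
    NatTrans.congr_app ((rowColMul (P k)).map_comp (f k) (g k)) (y k))

/-- The structure of a balanced bimodule functor on the componentwise multiplication. -/
def piRowColBalancing : BimoduleBalancing (∀ k, Corner (P k)) Φ (∀ k, Corner (P k))
    (piRowColMul P) where
  iso x b z := Pi.isoMk fun k => (rowColBalancing (P k)).iso (x k) b (z k)
  naturality_left f b z := funext fun k => (rowColBalancing (P k)).naturality_left (f k) b (z k)
  naturality_middle x _ _ f z :=
    funext fun k => (rowColBalancing (P k)).naturality_middle (x k) f (z k)
  naturality_right x b _ _ f :=
    funext fun k => (rowColBalancing (P k)).naturality_right (x k) b (f k)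
  pentagon x b b' z := funext fun k => (rowColBalancing (P k)).pentagon (x k) b b' (z k)
  triangle x z := funext fun k => (rowColBalancing (P k)).triangle (x k) (z k)
  left c x z := Pi.isoMk fun k => (rowColBalancing (P k)).left (c k) (x k) (z k)
  left_naturality₁ f x z :=
    funext fun k => (rowColBalancing (P k)).left_naturality₁ (f k) (x k) (z k)
  left_naturality₂ c _ _ f z :=
    funext fun k => (rowColBalancing (P k)).left_naturality₂ (c k) (f k) (z k)
  left_naturality₃ c x _ _ f :=
    funext fun k => (rowColBalancing (P k)).left_naturality₃ (c k) (x k) (f k)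
  left_assoc c c' x z :=
    funext fun k => (rowColBalancing (P k)).left_assoc (c k) (c' k) (x k) (z k)
  left_unit x z := funext fun k => (rowColBalancing (P k)).left_unit (x k) (z k)
  right x z c := Pi.isoMk fun k => (rowColBalancing (P k)).right (x k) (z k) (c k)
  right_naturality₁ f z c :=
    funext fun k => (rowColBalancing (P k)).right_naturality₁ (f k) (z k) (c k)
  right_naturality₂ x _ _ f c :=
    funext fun k => (rowColBalancing (P k)).right_naturality₂ (x k) (f k) (c k)
  right_naturality₃ x z _ _ f :=
    funext fun k => (rowColBalancing (P k)).right_naturality₃ (x k) (z k) (f k)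
  right_assoc x z c c' :=
    funext fun k => (rowColBalancing (P k)).right_assoc (x k) (z k) (c k) (c' k)
  right_unit x z := funext fun k => (rowColBalancing (P k)).right_unit (x k) (z k)
  left_balancing c x b z :=
    funext fun k => (rowColBalancing (P k)).left_balancing (c k) (x k) b (z k)
  right_balancing x b z c :=
    funext fun k => (rowColBalancing (P k)).right_balancing (x k) b (z k) (c k)
  left_right c x z c' :=
    funext fun k => (rowColBalancing (P k)).left_right (c k) (x k) (z k) (c' k)

variable [Preadditive Φ] [Linear ℂ Φ] [MonoidalPreadditive Φ] [MonoidalLinear ℂ Φ]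
  [IsFiniteSemisimple Φ] [Finite K]

lemma isFiniteSemisimpleBimodule_piRow :
    IsFiniteSemisimpleBimodule (∀ k, Corner (P k)) Φ (∀ k, Row (P k)) :=
  have := isFiniteSemisimple_pi fun k => Row (P k)
  have := isFiniteSemisimple_pi fun k => Corner (P k)
  { finiteSemisimple := inferInstance
    left := isRexBilinear_of_isFiniteSemisimple
      (fun _ _ _ _ _ => funext fun _ => by ext; exact MonoidalPreadditive.whiskerLeft_add _ _)
      (fun _ _ _ _ _ => funext fun _ => by ext; exact MonoidalLinear.whiskerLeft_smul _ _ _)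
      (fun _ _ _ => funext fun _ => by ext; exact MonoidalPreadditive.add_whiskerRight _ _)
      (fun _ _ _ => funext fun _ => by ext; exact MonoidalLinear.smul_whiskerRight _ _ _)
    right := isRexBilinear_of_isFiniteSemisimple
      (fun _ _ _ _ _ => funext fun _ => by ext; exact MonoidalPreadditive.add_whiskerRight _ _)
      (fun _ _ _ _ _ => funext fun _ => by ext; exact MonoidalLinear.smul_whiskerRight _ _ _)
      (fun _ _ _ => funext fun _ => by ext; exact MonoidalPreadditive.whiskerLeft_add _ _)
      (fun _ _ _ => funext fun _ => by ext; exact MonoidalLinear.whiskerLeft_smul _ _ _) }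

lemma isFiniteSemisimpleBimodule_piCol :
    IsFiniteSemisimpleBimodule Φ (∀ k, Corner (P k)) (∀ k, Col (P k)) :=
  have := isFiniteSemisimple_pi fun k => Col (P k)
  have := isFiniteSemisimple_pi fun k => Corner (P k)
  { finiteSemisimple := inferInstance
    left := isRexBilinear_of_isFiniteSemisimple
      (fun _ _ _ _ _ => funext fun _ => by ext; exact MonoidalPreadditive.whiskerLeft_add _ _)
      (fun _ _ _ _ _ => funext fun _ => by ext; exact MonoidalLinear.whiskerLeft_smul _ _ _)
      (fun _ _ _ => funext fun _ => by ext; exact MonoidalPreadditive.add_whiskerRight _ _)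
      (fun _ _ _ => funext fun _ => by ext; exact MonoidalLinear.smul_whiskerRight _ _ _)
    right := isRexBilinear_of_isFiniteSemisimple
      (fun _ _ _ _ _ => funext fun _ => by ext; exact MonoidalPreadditive.add_whiskerRight _ _)
      (fun _ _ _ _ _ => funext fun _ => by ext; exact MonoidalLinear.smul_whiskerRight _ _ _)
      (fun _ _ _ => funext fun _ => by ext; exact MonoidalPreadditive.whiskerLeft_add _ _)
      (fun _ _ _ => funext fun _ => by ext; exact MonoidalLinear.whiskerLeft_smul _ _ _) }

lemma isRexBilinear_piRowColMul : IsRexBilinear (piRowColMul P) :=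
  have := isFiniteSemisimple_pi fun k => Row (P k)
  have := isFiniteSemisimple_pi fun k => Col (P k)
  have := isFiniteSemisimple_pi fun k => Corner (P k)
  isRexBilinear_of_isFiniteSemisimple
    (fun _ _ _ _ _ => funext fun _ => by ext; exact MonoidalPreadditive.whiskerLeft_add _ _)
    (fun _ _ _ _ _ => funext fun _ => by ext; exact MonoidalLinear.whiskerLeft_smul _ _ _)
    (fun _ _ _ => funext fun _ => by ext; exact MonoidalPreadditive.add_whiskerRight _ _)
    (fun _ _ _ => funext fun _ => by ext; exact MonoidalLinear.smul_whiskerRight _ _ _)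

end PiRowCol

/-! ### The sum of the multiplications of columns and rows

The coherence isomorphisms of the functor `(x, z) ↦ ⨁ xₖ ⊗ zₖ` are treated for arbitrary families of
objects of `Φ`; each identity is checked on the summands. -/

section SumAssoc

variable {Φ : Type u} [Category.{v} Φ] [MonoidalCategory Φ] [Preadditive Φ] [HasFiniteBiproducts Φ]
  {K : Type} [Finite K]

/-- The isomorphism `⨁ (xₖ ⊗ bₖ) ⊗ zₖ ≅ ⨁ xₖ ⊗ (bₖ ⊗ zₖ)`. -/
def sumAssoc (x b z : K → Φ) :
    (⨁ fun k => (x k ⊗ b k) ⊗ z k) ≅ ⨁ fun k => x k ⊗ (b k ⊗ z k) :=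
  biproduct.mapIso fun k => α_ (x k) (b k) (z k)

lemma ι_sumAssoc (x b z : K → Φ) (k : K) :
    biproduct.ι (fun k => (x k ⊗ b k) ⊗ z k) k ≫ (sumAssoc x b z).hom =
      (α_ (x k) (b k) (z k)).hom ≫ biproduct.ι (fun k => x k ⊗ (b k ⊗ z k)) k := by
  simp [sumAssoc]

lemma ι_sumAssoc_assoc (x b z : K → Φ) (k : K) {w : Φ} (h : (⨁ fun k => x k ⊗ (b k ⊗ z k)) ⟶ w) :
    biproduct.ι (fun k => (x k ⊗ b k) ⊗ z k) k ≫ (sumAssoc x b z).hom ≫ h =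
      (α_ (x k) (b k) (z k)).hom ≫ biproduct.ι (fun k => x k ⊗ (b k ⊗ z k)) k ≫ h := by
  rw [← Category.assoc, ι_sumAssoc, Category.assoc]

variable {x x' b b' z z' : K → Φ}

lemma sumAssoc_naturality_left (f : ∀ k, x k ⟶ x' k) :
    biproduct.map (fun k => (f k ▷ b k) ▷ z k) ≫ (sumAssoc x' b z).hom =
      (sumAssoc x b z).hom ≫ biproduct.map fun k => f k ▷ (b k ⊗ z k) := by
  apply biproduct.hom_ext'; intro k
  simp [ι_sumAssoc, ι_sumAssoc_assoc]

lemma sumAssoc_naturality_middle (f : ∀ k, b k ⟶ b' k) :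
    biproduct.map (fun k => (x k ◁ f k) ▷ z k) ≫ (sumAssoc x b' z).hom =
      (sumAssoc x b z).hom ≫ biproduct.map fun k => x k ◁ (f k ▷ z k) := by
  apply biproduct.hom_ext'; intro k
  simp [ι_sumAssoc, ι_sumAssoc_assoc]

lemma sumAssoc_naturality_right (f : ∀ k, z k ⟶ z' k) :
    biproduct.map (fun k => (x k ⊗ b k) ◁ f k) ≫ (sumAssoc x b z').hom =
      (sumAssoc x b z).hom ≫ biproduct.map fun k => x k ◁ (b k ◁ f k) := by
  apply biproduct.hom_ext'; intro k
  simp [ι_sumAssoc, ι_sumAssoc_assoc]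

lemma sumAssoc_pentagon :
    biproduct.map (fun k => (α_ (x k) (b k) (b' k)).inv ▷ z k) ≫
        (sumAssoc (fun k => x k ⊗ b k) b' z).hom ≫ (sumAssoc x b fun k => b' k ⊗ z k).hom =
      (sumAssoc x (fun k => b k ⊗ b' k) z).hom ≫
        biproduct.map fun k => x k ◁ (α_ (b k) (b' k) (z k)).hom := by
  apply biproduct.hom_ext'; intro k
  simp [ι_sumAssoc, ι_sumAssoc_assoc]

lemma sumAssoc_triangle {p : K → Φ} {f : ∀ k, p k ⊗ z k ⟶ z k} {g : ∀ k, x k ⊗ p k ⟶ x k}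
    (h : ∀ k, (α_ (x k) (p k) (z k)).hom ≫ x k ◁ f k = g k ▷ z k) :
    (sumAssoc x p z).hom ≫ biproduct.map (fun k => x k ◁ f k) =
      biproduct.map fun k => g k ▷ z k := by
  apply biproduct.hom_ext'; intro k
  simp [ι_sumAssoc_assoc, ← h]

end SumAssoc

section SumMul

variable {Φ : Type u} [Category.{v} Φ] [MonoidalCategory Φ] [Preadditive Φ] [MonoidalPreadditive Φ]
  [HasFiniteBiproducts Φ] {K : Type} [Finite K]

/-- The isomorphism `⨁ (a ⊗ xₖ) ⊗ zₖ ≅ a ⊗ ⨁ xₖ ⊗ zₖ`. -/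
def sumLeft (a : Φ) (x z : K → Φ) : (⨁ fun k => (a ⊗ x k) ⊗ z k) ≅ a ⊗ ⨁ fun k => x k ⊗ z k :=
  biproduct.mapIso (fun k => α_ a (x k) (z k)) ≪≫ (leftDistributor a _).symm

/-- The isomorphism `⨁ xₖ ⊗ (zₖ ⊗ c) ≅ (⨁ xₖ ⊗ zₖ) ⊗ c`. -/
def sumRight (x z : K → Φ) (c : Φ) : (⨁ fun k => x k ⊗ (z k ⊗ c)) ≅ (⨁ fun k => x k ⊗ z k) ⊗ c :=
  biproduct.mapIso (fun k => (α_ (x k) (z k) c).symm) ≪≫ (rightDistributor _ c).symm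

lemma ι_sumLeft (a : Φ) (x z : K → Φ) (k : K) :
    biproduct.ι (fun k => (a ⊗ x k) ⊗ z k) k ≫ (sumLeft a x z).hom =
      (α_ a (x k) (z k)).hom ≫ a ◁ biproduct.ι (fun k => x k ⊗ z k) k := by
  simp [sumLeft]

lemma ι_sumLeft_assoc (a : Φ) (x z : K → Φ) (k : K) {w : Φ} (h : (a ⊗ ⨁ fun k => x k ⊗ z k) ⟶ w) :
    biproduct.ι (fun k => (a ⊗ x k) ⊗ z k) k ≫ (sumLeft a x z).hom ≫ h =
      (α_ a (x k) (z k)).hom ≫ a ◁ biproduct.ι (fun k => x k ⊗ z k) k ≫ h := by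
  rw [← Category.assoc, ι_sumLeft, Category.assoc]

lemma ι_sumRight (x z : K → Φ) (c : Φ) (k : K) :
    biproduct.ι (fun k => x k ⊗ (z k ⊗ c)) k ≫ (sumRight x z c).hom =
      (α_ (x k) (z k) c).inv ≫ biproduct.ι (fun k => x k ⊗ z k) k ▷ c := by
  simp [sumRight]

lemma ι_sumRight_assoc (x z : K → Φ) (c : Φ) (k : K) {w : Φ}
    (h : (⨁ fun k => x k ⊗ z k) ⊗ c ⟶ w) :
    biproduct.ι (fun k => x k ⊗ (z k ⊗ c)) k ≫ (sumRight x z c).hom ≫ h =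
      (α_ (x k) (z k) c).inv ≫ biproduct.ι (fun k => x k ⊗ z k) k ▷ c ≫ h := by
  rw [← Category.assoc, ι_sumRight, Category.assoc]

section Coherence

variable {x x' b b' z z' : K → Φ} {a a' c c' : Φ}

lemma sumLeft_naturality_left (f : a ⟶ a') :
    biproduct.map (fun k => (f ▷ x k) ▷ z k) ≫ (sumLeft a' x z).hom =
      (sumLeft a x z).hom ≫ f ▷ ⨁ fun k => x k ⊗ z k := by
  apply biproduct.hom_ext'; intro k
  simp [ι_sumLeft, ι_sumLeft_assoc, whisker_exchange]

lemma sumLeft_naturality_middle (f : ∀ k, x k ⟶ x' k) :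
    biproduct.map (fun k => (a ◁ f k) ▷ z k) ≫ (sumLeft a x' z).hom =
      (sumLeft a x z).hom ≫ a ◁ biproduct.map fun k => f k ▷ z k := by
  apply biproduct.hom_ext'; intro k
  simp [ι_sumLeft, ι_sumLeft_assoc, ← whiskerLeft_comp]

lemma sumLeft_naturality_right (f : ∀ k, z k ⟶ z' k) :
    biproduct.map (fun k => (a ⊗ x k) ◁ f k) ≫ (sumLeft a x z').hom =
      (sumLeft a x z).hom ≫ a ◁ biproduct.map fun k => x k ◁ f k := by
  apply biproduct.hom_ext'; intro k
  simp [ι_sumLeft, ι_sumLeft_assoc, ← whiskerLeft_comp]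

lemma sumLeft_assoc :
    biproduct.map (fun k => (α_ a a' (x k)).hom ▷ z k) ≫
        (sumLeft a (fun k => a' ⊗ x k) z).hom ≫ a ◁ (sumLeft a' x z).hom =
      (sumLeft (a ⊗ a') x z).hom ≫ (α_ a a' _).hom := by
  apply biproduct.hom_ext'; intro k
  simp only [biproduct.ι_map_assoc, ι_sumLeft_assoc, ← whiskerLeft_comp, ι_sumLeft]
  simp

lemma sumLeft_unit :
    (sumLeft (𝟙_ Φ) x z).hom ≫ (λ_ _).hom = biproduct.map fun k => (λ_ (x k)).hom ▷ z k := by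
  apply biproduct.hom_ext'; intro k
  simp [ι_sumLeft_assoc]

lemma sumRight_naturality_left (f : ∀ k, x k ⟶ x' k) :
    biproduct.map (fun k => f k ▷ (z k ⊗ c)) ≫ (sumRight x' z c).hom =
      (sumRight x z c).hom ≫ biproduct.map (fun k => f k ▷ z k) ▷ c := by
  apply biproduct.hom_ext'; intro k
  simp [ι_sumRight, ι_sumRight_assoc, ← comp_whiskerRight]

lemma sumRight_naturality_middle (f : ∀ k, z k ⟶ z' k) :
    biproduct.map (fun k => x k ◁ (f k ▷ c)) ≫ (sumRight x z' c).hom =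
      (sumRight x z c).hom ≫ biproduct.map (fun k => x k ◁ f k) ▷ c := by
  apply biproduct.hom_ext'; intro k
  simp only [biproduct.ι_map_assoc, ι_sumRight, ι_sumRight_assoc, ← comp_whiskerRight,
    biproduct.ι_map]
  simp

lemma sumRight_naturality_right (f : c ⟶ c') :
    biproduct.map (fun k => x k ◁ (z k ◁ f)) ≫ (sumRight x z c').hom =
      (sumRight x z c).hom ≫ (⨁ fun k => x k ⊗ z k) ◁ f := by
  apply biproduct.hom_ext'; intro k
  simp [ι_sumRight, ι_sumRight_assoc, ← whisker_exchange]

lemma sumRight_assoc :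
    biproduct.map (fun k => x k ◁ (α_ (z k) c c').inv) ≫
        (sumRight x (fun k => z k ⊗ c) c').hom ≫ (sumRight x z c).hom ▷ c' =
      (sumRight x z (c ⊗ c')).hom ≫ (α_ _ c c').inv := by
  apply biproduct.hom_ext'; intro k
  simp only [biproduct.ι_map_assoc, ι_sumRight_assoc, ← comp_whiskerRight, ι_sumRight]
  simp

lemma sumRight_unit :
    (sumRight x z (𝟙_ Φ)).hom ≫ (ρ_ _).hom = biproduct.map fun k => x k ◁ (ρ_ (z k)).hom := by
  apply biproduct.hom_ext'; intro k
  simp [ι_sumRight_assoc]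

lemma sumAssoc_sumLeft :
    (sumAssoc (fun k => a ⊗ x k) b z).hom ≫ (sumLeft a x fun k => b k ⊗ z k).hom =
      biproduct.map (fun k => (α_ a (x k) (b k)).hom ▷ z k) ≫
        (sumLeft a (fun k => x k ⊗ b k) z).hom ≫ a ◁ (sumAssoc x b z).hom := by
  apply biproduct.hom_ext'; intro k
  simp only [biproduct.ι_map_assoc, ι_sumLeft_assoc, ι_sumAssoc_assoc, ← whiskerLeft_comp,
    ι_sumLeft, ι_sumAssoc]
  simp

lemma sumAssoc_sumRight :
    (sumAssoc x b fun k => z k ⊗ c).hom ≫ biproduct.map (fun k => x k ◁ (α_ (b k) (z k) c).inv) ≫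
        (sumRight x (fun k => b k ⊗ z k) c).hom =
      (sumRight (fun k => x k ⊗ b k) z c).hom ≫ (sumAssoc x b z).hom ▷ c := by
  apply biproduct.hom_ext'; intro k
  simp only [biproduct.ι_map_assoc, ι_sumRight_assoc, ι_sumAssoc_assoc, ← comp_whiskerRight,
    ι_sumRight, ι_sumAssoc]
  simp

lemma sumLeft_sumRight :
    (sumLeft a x fun k => z k ⊗ c).hom ≫ a ◁ (sumRight x z c).hom =
      (sumRight (fun k => a ⊗ x k) z c).hom ≫ (sumLeft a x z).hom ▷ c ≫
        (α_ a (⨁ fun k => x k ⊗ z k) c).hom := by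
  apply biproduct.hom_ext'; intro k
  simp only [ι_sumLeft_assoc, ι_sumRight_assoc, ← whiskerLeft_comp, ← comp_whiskerRight_assoc,
    ι_sumRight, ι_sumLeft]
  simp

end Coherence

variable {p : K → Φ} (P : ∀ k, Retract (p k) (𝟙_ Φ))

/-- The multiplication `∏ Φ·pₖ × ∏ pₖ·Φ → Φ`, sending `(x, z)` to `⨁ xₖ ⊗ zₖ`. -/
def sumColRowMul : (∀ k, Col (P k)) ⥤ (∀ k, Row (P k)) ⥤ Φ where
  obj x :=
    { obj z := ⨁ fun k => (x k).obj ⊗ (z k).obj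
      map f := biproduct.map fun k => (x k).obj ◁ (f k).hom
      map_id _ := by ext k; simp
      map_comp _ _ := by ext k; simp }
  map f :=
    { app z := biproduct.map fun k => (f k).hom ▷ (z k).obj
      naturality _ _ _ := by ext k; simp [whisker_exchange] }
  map_id _ := by ext z k; simp
  map_comp _ _ := by ext z k; simp

/-- The structure of a balanced bimodule functor on `sumColRowMul`, given by associators and
distributors. -/
def sumColRowBalancing : BimoduleBalancing Φ (∀ k, Corner (P k)) Φ (sumColRowMul P) where
  iso x b z := sumAssoc (fun k => (x k).obj) (fun k => (b k).obj) fun k => (z k).obj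
  naturality_left f _ _ := sumAssoc_naturality_left fun k => (f k).hom
  naturality_middle _ _ _ f _ := sumAssoc_naturality_middle fun k => (f k).hom
  naturality_right _ _ _ _ f := sumAssoc_naturality_right fun k => (f k).hom
  pentagon _ _ _ _ := sumAssoc_pentagon
  triangle x z := sumAssoc_triangle fun k => assoc_corner_triangle (P k) (x k).obj (z k).obj
  left c x z := sumLeft c (fun k => (x k).obj) fun k => (z k).obj
  left_naturality₁ f _ _ := sumLeft_naturality_left f
  left_naturality₂ _ _ _ f _ := sumLeft_naturality_middle fun k => (f k).hom
  left_naturality₃ _ _ _ _ f := sumLeft_naturality_right fun k => (f k).hom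
  left_assoc _ _ _ _ := sumLeft_assoc
  left_unit _ _ := sumLeft_unit
  right x z c := sumRight (fun k => (x k).obj) (fun k => (z k).obj) c
  right_naturality₁ f _ _ := sumRight_naturality_left fun k => (f k).hom
  right_naturality₂ _ _ _ f _ := sumRight_naturality_middle fun k => (f k).hom
  right_naturality₃ _ _ _ _ f := sumRight_naturality_right f
  right_assoc _ _ _ _ := sumRight_assoc
  right_unit _ _ := sumRight_unit
  left_balancing _ _ _ _ := sumAssoc_sumLeft
  right_balancing _ _ _ _ := sumAssoc_sumRight
  left_right _ _ _ _ := sumLeft_sumRight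

lemma isRexBilinear_sumColRowMul [Linear ℂ Φ] [MonoidalLinear ℂ Φ] [IsFiniteSemisimple Φ] :
    IsRexBilinear (sumColRowMul P) :=
  have := isFiniteSemisimple_pi fun k => Row (P k)
  have := isFiniteSemisimple_pi fun k => Col (P k)
  isRexBilinear_of_isFiniteSemisimple
    (fun x _ _ f g => by
      apply biproduct.hom_ext'; intro k
      change _ ≫ biproduct.map (fun k => (x k).obj ◁ ((f k).hom + (g k).hom)) =
        _ ≫ (biproduct.map (fun k => (x k).obj ◁ (f k).hom) +
          biproduct.map (fun k => (x k).obj ◁ (g k).hom))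
      simp)
    (fun x _ _ c f => by
      apply biproduct.hom_ext'; intro k
      change _ ≫ biproduct.map (fun k => (x k).obj ◁ (c • (f k).hom)) =
        _ ≫ (c • biproduct.map (fun k => (x k).obj ◁ (f k).hom))
      simp)
    (fun f g z => by
      apply biproduct.hom_ext'; intro k
      change _ ≫ biproduct.map (fun k => ((f k).hom + (g k).hom) ▷ (z k).obj) =
        _ ≫ (biproduct.map (fun k => (f k).hom ▷ (z k).obj) +
          biproduct.map (fun k => (g k).hom ▷ (z k).obj))
      simp)
    (fun c f z => by
      apply biproduct.hom_ext'; intro k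
      change _ ≫ biproduct.map (fun k => (c • (f k).hom) ▷ (z k).obj) =
        _ ≫ (c • biproduct.map (fun k => (f k).hom ▷ (z k).obj))
      simp)

end SumMul

/-! ### Orthogonal summands of the unit -/

section IsOrthogonal

variable {Φ : Type u} [Category.{v} Φ] [MonoidalCategory Φ] [Preadditive Φ] {K : Type} {p : K → Φ}
  (P : ∀ k, Retract (p k) (𝟙_ Φ))

/-- The products of the objects of different rows and columns vanish, that is, `pₖ·Φ·pₗ = 0` for
`k ≠ l`. -/
def IsOrthogonal : Prop :=
  ∀ k l, k ≠ l → ∀ (y : Row (P k)) (x : Col (P l)), IsZero (y.obj ⊗ x.obj)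

variable {P}

/-- On the column of `pₖ` only the `k`-th term of `∑ sₗ ≫ rₗ = 𝟙` acts nontrivially, because the
others factor through `xₗ ⊗ (yₗ ⊗ m) = 0`. -/
lemma whiskerRight_eq_id_of_isOrthogonal [MonoidalPreadditive Φ] [Fintype K] (x : ∀ k, Col (P k))
    (y : ∀ k, Row (P k)) (s : ∀ k, 𝟙_ Φ ⟶ (x k).obj ⊗ (y k).obj)
    (r : ∀ k, (x k).obj ⊗ (y k).obj ⟶ 𝟙_ Φ) (hsr : ∑ k, s k ≫ r k = 𝟙 _) (orth : IsOrthogonal P)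
    {k : K} (m : Col (P k)) : (s k ≫ r k) ▷ m.obj = 𝟙 _ := by
  rw [← id_whiskerRight, ← hsr, sum_whiskerRight]
  symm
  refine Finset.sum_eq_single_of_mem k (Finset.mem_univ k) fun l _ hl => ?_
  rw [comp_whiskerRight, ((isZero_tensor_right _ (orth l k hl (y l) m)).of_iso
    (α_ (x l).obj (y l).obj m.obj)).eq_of_tgt (s l ▷ m.obj) 0, zero_comp]

end IsOrthogonal

section Orthogonal

variable {Φ : Type u} [Category.{v} Φ] [MonoidalCategory Φ] [Preadditive Φ] [MonoidalPreadditive Φ]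
  [HasFiniteBiproducts Φ] {K : Type} [Finite K]

lemma π_ι_whiskerRight (f : K → Φ) {k : K} {z : Φ} (h : ∀ l, l ≠ k → IsZero (f l ⊗ z)) :
    biproduct.π f k ▷ z ≫ biproduct.ι f k ▷ z = 𝟙 _ := by
  have := Fintype.ofFinite K
  rw [← comp_whiskerRight, ← id_whiskerRight, ← biproduct.total, sum_whiskerRight]
  symm
  refine Finset.sum_eq_single_of_mem k (Finset.mem_univ k) fun l _ hl => ?_
  rw [comp_whiskerRight, (h l hl).eq_of_tgt (biproduct.π f l ▷ z) 0, zero_comp]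

lemma whiskerLeft_π_ι (f : K → Φ) {k : K} {z : Φ} (h : ∀ l, l ≠ k → IsZero (z ⊗ f l)) :
    z ◁ biproduct.π f k ≫ z ◁ biproduct.ι f k = 𝟙 _ := by
  have := Fintype.ofFinite K
  rw [← whiskerLeft_comp, ← whiskerLeft_id, ← biproduct.total, whiskerLeft_sum]
  symm
  refine Finset.sum_eq_single_of_mem k (Finset.mem_univ k) fun l _ hl => ?_
  rw [whiskerLeft_comp, (h l hl).eq_of_tgt (z ◁ biproduct.π f l) 0, zero_comp]

variable {p : K → Φ} {P : ∀ k, Retract (p k) (𝟙_ Φ)} (orth : IsOrthogonal P)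

/-- The isomorphism `(⨁ yₗ) ⊗ nₖ ≅ yₖ ⊗ nₖ`. -/
@[simps]
def sumRowTensorIso (y : ∀ k, Row (P k)) (n : ∀ k, Col (P k)) (k : K) :
    (⨁ fun k => (y k).obj) ⊗ (n k).obj ≅ (y k).obj ⊗ (n k).obj where
  hom := biproduct.π (fun k => (y k).obj) k ▷ (n k).obj
  inv := biproduct.ι (fun k => (y k).obj) k ▷ (n k).obj
  hom_inv_id := π_ι_whiskerRight _ fun l hl => orth l k hl (y l) (n k)
  inv_hom_id := by rw [← comp_whiskerRight, biproduct.ι_π_self, id_whiskerRight]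

/-- The isomorphism `(yₖ ⊗ mₖ) ⊗ nₖ ≅ yₖ ⊗ ⨁ mₗ ⊗ nₗ`. -/
@[simps]
def rowTensorSumIso (y : ∀ k, Row (P k)) (m : ∀ k, Col (P k)) (n : ∀ k, Row (P k)) (k : K) :
    ((y k).obj ⊗ (m k).obj) ⊗ (n k).obj ≅ (y k).obj ⊗ ⨁ fun l => (m l).obj ⊗ (n l).obj where
  hom := (α_ _ _ _).hom ≫ (y k).obj ◁ biproduct.ι (fun l => (m l).obj ⊗ (n l).obj) k
  inv := (y k).obj ◁ biproduct.π (fun l => (m l).obj ⊗ (n l).obj) k ≫ (α_ _ _ _).inv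
  hom_inv_id := by
    rw [Category.assoc, ← whiskerLeft_comp_assoc, biproduct.ι_π_self, whiskerLeft_id,
      Category.id_comp, Iso.hom_inv_id]
  inv_hom_id := by
    rw [Category.assoc, Iso.inv_hom_id_assoc]
    exact whiskerLeft_π_ι _ fun l hl =>
      (isZero_tensor_left (orth k l hl.symm (y k) (m l)) _).of_iso (α_ _ _ _).symm

/-- Every `y` in `∏ pₖ·Φ` is `p · ⨁ yₖ`, where `p = (pₖ)ₖ`. -/
def piRowTensorContext : TensorContext (piRowColMul P) (piRowColBalancing P).toBalancing where
  base k := ⟨p k, (summand_cornerProperty (P k)).1⟩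
  comp :=
    { obj y := ⨁ fun k => (y k).obj
      map f := biproduct.map fun k => (f k).hom
      map_id _ := by
        apply biproduct.hom_ext'; intro k
        simp only [biproduct.ι_map, Category.comp_id]
        exact Category.id_comp _
      map_comp f g := by
        apply biproduct.hom_ext'; intro k
        simp only [biproduct.ι_map, biproduct.ι_map_assoc]
        exact Category.assoc _ _ _ }
  ret :=
    { obj c k := (cornerToCol (P k)).obj (c k)
      map f k := (cornerToCol (P k)).map (f k) }
  assoc y n := Pi.isoMk fun k => ObjectProperty.isoMk _ (sumRowTensorIso orth y n k)
  assoc_naturality_left f n := funext fun k => by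
    ext
    change (biproduct.map fun k => (f k).hom) ▷ (n k).obj ≫ biproduct.π _ k ▷ (n k).obj =
      biproduct.π _ k ▷ (n k).obj ≫ (f k).hom ▷ (n k).obj
    rw [← comp_whiskerRight, biproduct.map_π, comp_whiskerRight]
  assoc_naturality_right y _ _ f := funext fun k => by
    ext
    exact whisker_exchange _ _
  inc y k := ObjectProperty.homMk ((rowUnitor (P k) (y k).obj).inv ≫
    p k ◁ biproduct.ι (fun k => (y k).obj) k)
  proj y k := ObjectProperty.homMk (p k ◁ biproduct.π (fun k => (y k).obj) k ≫
    (rowUnitor (P k) (y k).obj).hom)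
  proj_naturality f := funext fun k => by
    ext
    change p k ◁ (biproduct.map fun k => (f k).hom) ≫ p k ◁ biproduct.π _ k ≫
      (rowUnitor (P k) _).hom = (p k ◁ biproduct.π _ k ≫ (rowUnitor (P k) _).hom) ≫ (f k).hom
    rw [← whiskerLeft_comp_assoc, biproduct.map_π]
    simp [whisker_exchange_assoc]
  inc_proj y := funext fun k => by
    ext
    change ((rowUnitor (P k) (y k).obj).inv ≫ p k ◁ biproduct.ι (fun k => (y k).obj) k) ≫
      p k ◁ biproduct.π _ k ≫ (rowUnitor (P k) _).hom = 𝟙 _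
    rw [Category.assoc, ← whiskerLeft_comp_assoc, biproduct.ι_π_self, whiskerLeft_id,
      Category.id_comp, Iso.inv_hom_id]
  coinc c k := (rowTensorContext (P k)).coinc (c k)
  coproj c k := (rowTensorContext (P k)).coproj (c k)
  coinc_naturality f := funext fun k => (rowTensorContext (P k)).coinc_naturality (f k)
  coproj_naturality f := funext fun k => (rowTensorContext (P k)).coproj_naturality (f k)
  coinc_coproj c := funext fun k => (rowTensorContext (P k)).coinc_coproj (c k)
  inc_coinc y n := funext fun k => by
    ext
    have : IsIso ((P k).i ▷ ((y k).obj ⊗ (n k).obj)) :=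
      isIso_whiskerRight_tensor (y k).property (n k).obj
    change ((rowUnitor (P k) (y k).obj).inv ≫ p k ◁ biproduct.ι (fun k => (y k).obj) k) ▷
      (n k).obj ≫ (α_ (p k) _ (n k).obj).hom ≫ p k ◁ (biproduct.π _ k ▷ (n k).obj) =
        (rowUnitor (P k) ((y k).obj ⊗ (n k).obj)).inv
    rw [← associator_naturality_middle, ← comp_whiskerRight_assoc, Category.assoc,
      ← whiskerLeft_comp, biproduct.ι_π_self, whiskerLeft_id, Category.comp_id,
      rowUnitor_inv_tensor]
  compAct y b := biproduct.desc fun k => biproduct.ι (fun k => (y k).obj) k ▷ b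
  compAct_assoc y b n := funext fun k => by
    ext
    change (biproduct.desc fun k => biproduct.ι (fun k => (y k).obj) k ▷ b) ▷ (n k).obj ≫
      (α_ _ b (n k).obj).hom ≫ biproduct.π _ k ▷ (b ⊗ (n k).obj) =
        biproduct.π (fun k => (y k).obj ⊗ b) k ▷ (n k).obj ≫ (α_ (y k).obj b (n k).obj).hom
    rw [← associator_naturality_left, ← comp_whiskerRight_assoc]
    congr 2
    apply biproduct.hom_ext'; intro l
    rw [biproduct.ι_desc_assoc, ← comp_whiskerRight]
    by_cases h : l = k
    · subst h
      simp
    · rw [biproduct.ι_π_ne _ h, biproduct.ι_π_ne _ h, MonoidalPreadditive.zero_whiskerRight]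
  compAct_proj y b := funext fun k => by
    ext
    have : IsIso ((P k).i ▷ ((y k).obj ⊗ b)) := isIso_whiskerRight_tensor (y k).property b
    change p k ◁ (biproduct.desc fun k => biproduct.ι (fun k => (y k).obj) k ▷ b) ≫
      (α_ (p k) _ b).inv ≫ (p k ◁ biproduct.π _ k ≫ (rowUnitor (P k) (y k).obj).hom) ▷ b =
        p k ◁ biproduct.π (fun k => (y k).obj ⊗ b) k ≫ (rowUnitor (P k) ((y k).obj ⊗ b)).hom
    rw [comp_whiskerRight, ← associator_inv_naturality_middle_assoc, rowUnitor_hom_tensor,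
      ← whiskerLeft_comp_assoc]
    congr 2
    apply biproduct.hom_ext'; intro l
    rw [biproduct.ι_desc_assoc, ← comp_whiskerRight]
    by_cases h : l = k
    · subst h
      simp
    · rw [biproduct.ι_π_ne _ h, biproduct.ι_π_ne _ h, MonoidalPreadditive.zero_whiskerRight]

theorem isRelativeTensor_piRowColMul (orth : IsOrthogonal P) [Linear ℂ Φ]
    [MonoidalLinear ℂ Φ] [IsFiniteSemisimple Φ] :
    IsRelativeTensor.{w', w} (piRowColMul P) (piRowColBalancing P).toBalancing :=
  have := isFiniteSemisimple_pi fun k => Corner (P k)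
  have : (piRowTensorContext orth).ret.Additive := ⟨rfl⟩
  have : (piRowTensorContext orth).ret.Linear ℂ := ⟨fun _ _ => rfl⟩
  (piRowTensorContext orth).isRelativeTensor (isRexBilinear_piRowColMul P)

end Orthogonal

section SumContext

variable {Φ : Type u} [Category.{v} Φ] [MonoidalCategory Φ] [Preadditive Φ] [MonoidalPreadditive Φ]
  [HasFiniteBiproducts Φ] {K : Type} [Fintype K] {p : K → Φ} {P : ∀ k, Retract (p k) (𝟙_ Φ)}
  (orth : IsOrthogonal P) (x : ∀ k, Col (P k)) (y : ∀ k, Row (P k))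
  (s : ∀ k, 𝟙_ Φ ⟶ (x k).obj ⊗ (y k).obj) (r : ∀ k, (x k).obj ⊗ (y k).obj ⟶ 𝟙_ Φ)

lemma lift_insertion_desc_contraction (hsr : ∑ k, s k ≫ r k = 𝟙 _) (a : Φ) :
    biproduct.lift (fun k => insertion (s k) a) ≫ biproduct.desc (fun k => contraction (r k) a) =
      𝟙 a := by
  rw [biproduct.lift_desc]
  have h (k : K) : insertion (s k) a ≫ contraction (r k) a =
      (λ_ a).inv ≫ ((s k ≫ r k) ▷ a) ≫ (λ_ a).hom := by
    simp [insertion, contraction]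
  simp only [h, ← Preadditive.comp_sum, ← Preadditive.sum_comp, ← sum_whiskerRight, hsr]
  simp

/-- If the unit of `Φ` is a retract of `⨁ xₖ ⊗ yₖ`, with `xₖ` in the column and `yₖ` in the row of
`pₖ`, then every `m` in `∏ Φ·pₖ` is a retract of `(xₖ ⊗ (yₖ ⊗ mₖ))ₖ`. -/
def sumColTensorContext (hsr : ∑ k, s k ≫ r k = 𝟙 _) :
    TensorContext (sumColRowMul P) (sumColRowBalancing P).toBalancing where
  base := x
  comp := (piRowColMul P).obj y
  ret :=
    { obj a k := y k ⊙ᵣ a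
      map f k := y k ⊴ᵣ f
      map_id a := funext fun k => by ext; exact whiskerLeft_id _ _
      map_comp f g := funext fun k => by ext; exact whiskerLeft_comp _ _ _ }
  assoc m n := Pi.isoMk fun k => ObjectProperty.isoMk _ (rowTensorSumIso orth y m n k)
  assoc_naturality_left {m m'} f n := funext fun k => by
    ext
    change ((y k).obj ◁ (f k).hom) ▷ (n k).obj ≫ (α_ _ _ _).hom ≫
        (y k).obj ◁ biproduct.ι (fun l => (m' l).obj ⊗ (n l).obj) k =
      ((α_ _ _ _).hom ≫ (y k).obj ◁ biproduct.ι (fun l => (m l).obj ⊗ (n l).obj) k) ≫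
        (y k).obj ◁ biproduct.map fun l => (f l).hom ▷ (n l).obj
    rw [associator_naturality_middle_assoc, Category.assoc, ← whiskerLeft_comp,
      ← whiskerLeft_comp, biproduct.ι_map]
  assoc_naturality_right m {n n'} f := funext fun k => by
    ext
    change ((y k).obj ⊗ (m k).obj) ◁ (f k).hom ≫ (α_ _ _ _).hom ≫
        (y k).obj ◁ biproduct.ι (fun l => (m l).obj ⊗ (n' l).obj) k =
      ((α_ _ _ _).hom ≫ (y k).obj ◁ biproduct.ι (fun l => (m l).obj ⊗ (n l).obj) k) ≫
        (y k).obj ◁ biproduct.map fun l => (m l).obj ◁ (f l).hom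
    rw [associator_naturality_right_assoc, Category.assoc, ← whiskerLeft_comp,
      ← whiskerLeft_comp, biproduct.ι_map]
  inc m k := ObjectProperty.homMk (insertion (s k) (m k).obj)
  proj m k := ObjectProperty.homMk (contraction (r k) (m k).obj)
  proj_naturality f := funext fun k => by ext; exact contraction_naturality (r k) (f k).hom
  inc_proj m := funext fun k => by
    ext
    exact insertion_contraction (s k) (r k)
      (whiskerRight_eq_id_of_isOrthogonal x y s r hsr orth (m k))
  coinc a := biproduct.lift fun k => insertion (s k) a
  coproj a := biproduct.desc fun k => contraction (r k) a
  coinc_naturality {a a'} f := by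
    apply biproduct.hom_ext; intro k
    change (f ≫ biproduct.lift fun k => insertion (s k) a') ≫ biproduct.π _ k =
      (biproduct.lift (fun k => insertion (s k) a) ≫
        biproduct.map fun k => (x k).obj ◁ ((y k).obj ◁ f)) ≫ biproduct.π _ k
    simp [insertion_naturality]
  coproj_naturality {a a'} f := by
    apply biproduct.hom_ext'; intro k
    change biproduct.ι _ k ≫ (biproduct.map fun k => (x k).obj ◁ ((y k).obj ◁ f)) ≫
        (biproduct.desc fun k => contraction (r k) a') =
      biproduct.ι _ k ≫ (biproduct.desc fun k => contraction (r k) a) ≫ f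
    simp [contraction_naturality]
  coinc_coproj a := lift_insertion_desc_contraction x y s r hsr a
  inc_coinc m n := by
    change biproduct.map (fun k => insertion (s k) (m k).obj ▷ (n k).obj) ≫
        (sumAssoc _ _ _).hom ≫ biproduct.map (fun k => (x k).obj ◁ ((α_ _ _ _).hom ≫
          (y k).obj ◁ biproduct.ι (fun l => (m l).obj ⊗ (n l).obj) k)) =
      biproduct.lift fun k => insertion (s k) (⨁ fun l => (m l).obj ⊗ (n l).obj)
    apply biproduct.hom_ext'; intro l
    apply biproduct.hom_ext; intro k
    have h : biproduct.ι (fun l => (m l).obj ⊗ (n l).obj) l ≫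
        insertion (s k) (⨁ fun l => (m l).obj ⊗ (n l).obj) =
      insertion (s k) ((m l).obj ⊗ (n l).obj) ≫
        (x k).obj ◁ ((y k).obj ◁ biproduct.ι (fun l => (m l).obj ⊗ (n l).obj) l) :=
      insertion_naturality _ _
    simp only [Category.assoc, biproduct.lift_π]
    rw [h, ← insertion_tensor]
    simp only [biproduct.ι_map_assoc, ι_sumAssoc_assoc, Category.assoc]
    by_cases hlk : l = k
    · subst hlk
      simp
    · rw [biproduct.ι_π_ne _ hlk]
      have hz : IsZero ((x k).obj ⊗ ((y k).obj ⊗ (m l).obj ⊗ (n l).obj)) :=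
        isZero_tensor_right _ ((isZero_tensor_left
          (orth k l (Ne.symm hlk) (y k) (m l)) (n l).obj).of_iso (α_ _ _ _).symm)
      rw [hz.eq_of_src ((x k).obj ◁ ((y k).obj ◁ _)) 0]
      simp
  compAct m b k := ObjectProperty.homMk (α_ (y k).obj (m k).obj (b k).obj).inv
  compAct_assoc m b n := funext fun k => by
    ext
    change (α_ (y k).obj (m k).obj (b k).obj).inv ▷ (n k).obj ≫ (α_ _ _ _).hom ≫ (α_ _ _ _).hom ≫
        (y k).obj ◁ biproduct.ι (fun l => (m l).obj ⊗ ((b l).obj ⊗ (n l).obj)) k =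
      ((α_ _ _ _).hom ≫
        (y k).obj ◁ biproduct.ι (fun l => ((m l).obj ⊗ (b l).obj) ⊗ (n l).obj) k) ≫
          (y k).obj ◁ (sumAssoc (fun k => (m k).obj) (fun k => (b k).obj) fun k => (n k).obj).hom
    rw [Category.assoc, ← whiskerLeft_comp, ι_sumAssoc]
    simp
  compAct_proj m b := funext fun k => by
    ext
    exact contraction_tensor (r k) (m k).obj (b k).obj

theorem isRelativeTensor_sumColRowMul (orth : IsOrthogonal P) [Linear ℂ Φ] [MonoidalLinear ℂ Φ]
    [IsFiniteSemisimple Φ] (hsr : ∑ k, s k ≫ r k = 𝟙 _) :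
    IsRelativeTensor.{w', w} (sumColRowMul P) (sumColRowBalancing P).toBalancing :=
  have : (sumColTensorContext orth x y s r hsr).ret.Additive :=
    ⟨by intros; funext k; ext; exact MonoidalPreadditive.whiskerLeft_add _ _⟩
  have : (sumColTensorContext orth x y s r hsr).ret.Linear ℂ :=
    ⟨by intros; funext k; ext; exact MonoidalLinear.whiskerLeft_smul _ _ _⟩
  (sumColTensorContext orth x y s r hsr).isRelativeTensor (isRexBilinear_sumColRowMul P)

end SumContext

/-! ### The general case -/

section General

variable {Φ : Type u} [Category.{v} Φ] [Preadditive Φ] [Linear ℂ Φ]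
    [MonoidalCategory Φ] [MonoidalPreadditive Φ] [MonoidalLinear ℂ Φ] [IsFusion Φ]

/-- The product of the columns and the product of the rows of representatives of the blocks give a
Morita equivalence between `Φ` and the product of the corresponding corners. -/
theorem exists_moritaEquivalent_pi_corner (D : UnitDecomposition Φ) :
    ∃ (n : ℕ) (rep : Fin n → Fin D.n),
      MoritaEquivalent.{w', w} Φ (∀ k, Corner (D.retract (rep k))) := by
  obtain ⟨n, c, rep, hrep, hc⟩ := D.exists_blocks
  refine ⟨n, rep, ?_⟩
  have orth : IsOrthogonal fun k => D.retract (rep k) := by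
    intro k l hkl y x
    by_contra h
    refine hkl ?_
    rw [← hrep k, ← hrep l, ← hc]
    exact (D.entryNonzero_iff _ _).2 ⟨_, isIso_whiskerRight_tensor y.property x.obj,
      isIso_tensor_whiskerLeft y.obj x.property, h⟩
  have hex (k : Fin n) := D.exists_retract_of_entryNonzero (rep k)
    (Finset.univ.filter fun j => c j = k) fun j hj => (hc _ _).2 <| by
      rw [hrep, (Finset.mem_filter.1 hj).2]
  choose x y s r hsr using hex
  have h : ∑ k, s k ≫ r k = 𝟙 (𝟙_ Φ) := by
    rw [← D.sum_proj_inc, ← Finset.sum_fiberwise Finset.univ c]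
    exact Finset.sum_congr rfl fun k _ => hsr k
  exact ⟨⟨∀ k, Col (D.retract (rep k)), isFiniteSemisimpleBimodule_piCol _⟩,
    ⟨∀ k, Row (D.retract (rep k)), isFiniteSemisimpleBimodule_piRow _⟩,
    sumColRowMul _, sumColRowBalancing _, piRowColMul _, piRowColBalancing _,
    isFiniteSemisimpleBimodule_piCol _, isFiniteSemisimpleBimodule_piRow _,
    isRelativeTensor_sumColRowMul x y s r orth h, isRelativeTensor_piRowColMul orth⟩

end General

end FusionReducibility

end

theorem mainTheorem6 (Φ : Type u) [Category.{v} Φ] [Preadditive Φ] [Linear ℂ Φ]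
    [MonoidalCategory Φ] [MonoidalPreadditive Φ] [MonoidalLinear ℂ Φ] [IsFusion Φ] :
    (∃ (n : ℕ) (Ψ : Fin n → FusionCat.{v, u}),
      (∀ i, Simple (𝟙_ (Ψ i).carrier)) ∧
      MoritaEquivalent.{w', w} Φ (∀ i, (Ψ i).carrier)) ∧
    (∀ D : UnitDecomposition Φ, D.IsIndecomposable → ∀ i : Fin D.n,
      IsFusion (Corner (D.retract i)) ∧
      Simple (𝟙_ (Corner (D.retract i))) ∧
      IsMoritaEquivalence.{w', w}
        (rowColMul (D.retract i)) (rowColBalancing (D.retract i))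
        (colRowMul (D.retract i)) (colRowBalancing (D.retract i))) := by
  refine ⟨?_, fun D hD i => ⟨inferInstance, inferInstance, isMoritaEquivalence_row_col D hD i⟩⟩
  obtain ⟨D⟩ := nonempty_unitDecomposition (Φ := Φ)
  obtain ⟨n, rep, h⟩ := exists_moritaEquivalent_pi_corner D
  exact ⟨n, fun k => ⟨Corner (D.retract (rep k))⟩,
    fun k => inferInstanceAs (Simple (𝟙_ (Corner (D.retract (rep k))))), h⟩
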